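/- A \emph{vertical plane} is a pair $(\mathcal P,\pi)$, where $\mathcal P$ is an (oriented) topological space homeomorphic to $\mathbb R^2$ and $\pi:\mathcal P\to\mathbb R$ is a locally trivial topological fibration. A \emph{domain of finite type} in $(\mathcal P,\pi)$ is a closed subset $\mathcal D\subset\mathcal P$ homeomorphic to a surface with non-empty boundary $\mathcal C$, such that $\pi|_{\mathcal D}$ is proper and such that the set $\Sigma$ of topological critical points of $\pi|_{\mathcal C}$ is finite; here $p\in\mathcal C$ is a topological critical point if no neighbourhood of $p$ in $\mathcal C$ is mapped by $\pi$ homeomorphically onto its image. Let $\rho:\mathcal P\to\tilde{\mathcal P}$ be the quotient map that collapses each connected component of each fibre of $\pi|_{\mathcal D}$ to a point, let $\tilde\pi:\tilde{\mathcal P}\to\mathbb R$ be induced by $\pi$, and let $\tilde{\mathcal D}=\rho(\mathcal D)$ be the \emph{Poincaré–Reeb set}. Its \emph{vertices} are the points of $\rho(\Sigma)$. A \emph{critical segment} is a connected component of a fibre of $\pi|_{\mathcal D}$ that meets $\Sigma$; a \emph{band} is the closure of a connected component of the complement in $\mathcal D$ of the union of the critical segments; an \emph{edge} of $\tilde{\mathcal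 D}$ is the image $\rho(R)$ of a band $R$, and an \emph{open edge} is an edge with the vertices removed. A \emph{closed segment} of $\mathbb R$ is a closed interval, possibly unbounded, with more than one point; an \emph{open segment} is a non-empty open interval, possibly unbounded. A \emph{transversal graph} in a vertical plane $(\mathcal Q,\pi')$ is a closed subset $G\subset\mathcal Q$ partitioned into finitely many points (vertices) and finitely many subsets homeomorphic to open segments (open edges), such that: for each open edge $E$, the closure $\overline E$ (an edge) is homeomorphic to a closed segment, $\overline E\setminus E$ consists of $0$, $1$ or $2$ vertices, and $\pi'|_{\overline E}$ is a homeomorphism onto its image; and $\pi'|_G$ is proper. The \emph{valency} of a vertex is the number of edges ending at it. \textbf{Proposition.} Let $\mathcal D$ be a domain of finite type in a vertical plane $(\mathcal P,\pi)$. Then each edge of the Poincaré–Reeb set $\tilde{\mathcal D}$ is homeomorphic to a closed segment of $\mathbb R$. Moreover $(\tilde{\mathcal P},\tilde\pi)$ is a vertical plane and, endowed with its vertices and open edges, $\tilde{\mathcal D}$ is a transversal graph in it, whose edges (the closures of the open edges) are exactly the edges of $\tilde{\mathcal D}$ defined above, and which has no vertex of valency $2$. -/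

import Mathlib

open Set Topology

namespace PoincareReeb

/-- `(P, π)` is a vertical plane: `P` is homeomorphic to `ℝ²` and `π : P → ℝ` is a locally trivial
topological fibration, that is, every `x : ℝ` has an open neighbourhood over which `π` is
isomorphic to a product with the fibre over `x`. (A choice of orientation of `P` is extra data
that none of the notions below uses.) -/
structure IsVerticalPlane {P : Type*} [TopologicalSpace P] (π : P → ℝ) : Prop where
  homeomorphic_plane : Nonempty (P ≃ₜ ℝ × ℝ)
  locally_trivial : ∀ x : ℝ, ∃ e : Bundle.Trivialization (π ⁻¹' {x}) π, x ∈ e.baseSet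

/-- A topological surface with (possibly empty) boundary. -/
structure IsSurface (X : Type*) [TopologicalSpace X] : Prop where
  t2 : T2Space X
  secondCountable : SecondCountableTopology X
  exists_chart : ∀ x : X, ∃ φ : OpenPartialHomeomorph X (EuclideanHalfSpace 2), x ∈ φ.source

/-- The boundary of a topological surface: the points that some chart sends to the boundary line
of the half-plane. -/
def surfaceBoundary (X : Type*) [TopologicalSpace X] : Set X :=
  {x | ∃ φ : OpenPartialHomeomorph X (EuclideanHalfSpace 2), x ∈ φ.source ∧ (φ x).1 0 = 0}

section

variable {P : Type*} [TopologicalSpace P]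

/-- The boundary `C` of a subset `D` of `P` which is a surface, as a subset of `P`. -/
def boundaryCurve (D : Set P) : Set P :=
  Subtype.val '' surfaceBoundary D

/-- The topological critical set of a curve `C`: the points of `C` no neighbourhood of which in
`C` is mapped by `π` homeomorphically onto its image. -/
def topCriticalSet (π : P → ℝ) (C : Set P) : Set P :=
  {p | p ∈ C ∧ ¬ ∃ U ∈ 𝓝 p, IsEmbedding ((C ∩ U).domRestrict π)}

/-- Domains of finite type in a vertical plane `(P, π)`. -/
structure IsDomainOfFiniteType (π : P → ℝ) (D : Set P) : Prop where
  isClosed : IsClosed D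
  isSurface : IsSurface D
  boundary_nonempty : (boundaryCurve D).Nonempty
  proper : IsProperMap (D.domRestrict π)
  finite_topCriticalSet : (topCriticalSet π (boundaryCurve D)).Finite

/-- The connected component of `p` in the fibre of `π|_D` through `p` (empty if `p ∉ D`). -/
def fiberComponent (π : P → ℝ) (D : Set P) (p : P) : Set P :=
  connectedComponentIn (π ⁻¹' {π p} ∩ D) p

/-- Vertical equivalence relative to `D`. -/
def VertEquiv (π : P → ℝ) (D : Set P) (p q : P) : Prop :=
  π p = π q ∧ (q ∈ fiberComponent π D p ∨ (p = q ∧ p ∉ D))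

theorem vertEquiv_equivalence (π : P → ℝ) (D : Set P) : Equivalence (VertEquiv π D) where
  refl p := by
    refine ⟨rfl, ?_⟩
    by_cases h : p ∈ D
    · exact Or.inl (mem_connectedComponentIn ⟨rfl, h⟩)
    · exact Or.inr ⟨rfl, h⟩
  symm := by
    rintro p q ⟨h, h' | ⟨rfl, h'⟩⟩
    · refine ⟨h.symm, Or.inl ?_⟩
      have hp : p ∈ π ⁻¹' {π p} ∩ D :=
        mem_of_mem_of_subset (mem_connectedComponentIn (connectedComponentIn_nonempty_iff.1 ⟨q, h'⟩))
          (connectedComponentIn_subset _ _)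
      unfold fiberComponent at h' ⊢
      rw [← h, ← connectedComponentIn_eq h']
      exact mem_connectedComponentIn hp
    · exact ⟨rfl, Or.inr ⟨rfl, h'⟩⟩
  trans := by
    rintro p q r ⟨h, h' | ⟨rfl, h'⟩⟩ ⟨k, k' | ⟨rfl, k'⟩⟩
    · refine ⟨h.trans k, Or.inl ?_⟩
      unfold fiberComponent at h' k' ⊢
      rw [← h, ← connectedComponentIn_eq h'] at k'
      exact k'
    · exact ⟨h, Or.inl h'⟩
    · exact ⟨k, Or.inl k'⟩
    · exact ⟨rfl, Or.inr ⟨rfl, h'⟩⟩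

/-- Vertical equivalence relative to `D`, as a setoid. -/
def collapseSetoid (π : P → ℝ) (D : Set P) : Setoid P :=
  ⟨VertEquiv π D, vertEquiv_equivalence π D⟩

/-- The `D`-collapse of `P`, with the quotient topology. -/
abbrev Collapse (π : P → ℝ) (D : Set P) : Type _ :=
  Quotient (collapseSetoid π D)

/-- The collapsing map relative to `D`. -/
def collapseMap (π : P → ℝ) (D : Set P) : P → Collapse π D :=
  Quotient.mk (collapseSetoid π D)

/-- The map from the `D`-collapse of `P` to `ℝ` induced by `π`. -/
def collapseProj (π : P → ℝ) (D : Set P) : Collapse π D → ℝ :=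
  Quotient.lift π fun _ _ h => h.1

/-- The Poincaré–Reeb set of `D`. -/
def reebSet (π : P → ℝ) (D : Set P) : Set (Collapse π D) :=
  collapseMap π D '' D

/-- The vertices of the Poincaré–Reeb set. -/
def reebVertices (π : P → ℝ) (D : Set P) : Set (Collapse π D) :=
  collapseMap π D '' topCriticalSet π (boundaryCurve D)

/-- The critical segments of `D`: the connected components of fibres of `π|_D` which contain a
topological critical point of the boundary. -/
def criticalSegments (π : P → ℝ) (D : Set P) : Set (Set P) :=
  {S | (∃ p ∈ D, S = fiberComponent π D p) ∧ (S ∩ topCriticalSet π (boundaryCurve D)).Nonempty}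

/-- The bands of `D`: the closures of the connected components of the complement in `D` of the
union of the critical segments. -/
def bands (π : P → ℝ) (D : Set P) : Set (Set P) :=
  {R | ∃ p ∈ D \ ⋃₀ criticalSegments π D,
    R = closure (connectedComponentIn (D \ ⋃₀ criticalSegments π D) p)}

/-- The edges of the Poincaré–Reeb set. -/
def reebEdges (π : P → ℝ) (D : Set P) : Set (Set (Collapse π D)) :=
  (fun R => collapseMap π D '' R) '' bands π D

/-- The open edges of the Poincaré–Reeb set: its edges with the vertices removed. -/
def reebOpenEdges (π : P → ℝ) (D : Set P) : Set (Set (Collapse π D)) :=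
  (fun e => e \ reebVertices π D) '' reebEdges π D

/-- `e` is homeomorphic to a closed segment of `ℝ`: a closed, possibly unbounded, interval which
is not empty and not a point. -/
def IsClosedSegment (e : Set P) : Prop :=
  ∃ I : Set ℝ, IsClosed I ∧ I.OrdConnected ∧ I.Nontrivial ∧ Nonempty (e ≃ₜ I)

/-- `e` is homeomorphic to an open segment of `ℝ`: a non-empty, possibly unbounded, open
interval. -/
def IsOpenSegment (e : Set P) : Prop :=
  ∃ I : Set ℝ, IsOpen I ∧ I.OrdConnected ∧ I.Nonempty ∧ Nonempty (e ≃ₜ I)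

/-- `G`, partitioned into the points of `V` (vertices) and the members of `E` (open edges), is a
transversal graph with respect to the projection `π`. The edges are the closures of the open
edges. -/
structure IsTransversalGraph (π : P → ℝ) (G V : Set P) (E : Set (Set P)) : Prop where
  isClosed : IsClosed G
  finite_vertices : V.Finite
  finite_openEdges : E.Finite
  union_eq : V ∪ ⋃₀ E = G
  openEdges_disjoint : E.PairwiseDisjoint id
  disjoint_vertices : ∀ e ∈ E, Disjoint e V
  openEdge_segment : ∀ e ∈ E, IsOpenSegment e
  edge_segment : ∀ e ∈ E, IsClosedSegment (closure e)
  ends_subset : ∀ e ∈ E, closure e \ e ⊆ V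
  ends_card : ∀ e ∈ E, (closure e \ e).encard ≤ 2
  transversal : ∀ e ∈ E, IsEmbedding ((closure e).domRestrict π)
  proper : IsProperMap (G.domRestrict π)

/-- The valency of `v` in a graph with set of open edges `E`: the number of edges ending at `v`.
(In a transversal graph no edge is a loop.) -/
noncomputable def valency (E : Set (Set P)) (v : P) : ℕ∞ :=
  {e | e ∈ E ∧ v ∈ closure e}.encard

end

end PoincareReeb

open PoincareReeb

/-!
The bundle `π` is trivial over the line, so `P ≃ F × ℝ`; compose with `P ≃ ℂ` to get a map `h`.
Then `h (x, 0) - h (y, 0)` has a logarithm `L (x, y)` on the set of pairs of distinct points of `F`,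
because `h (x, 1) - h (y, 0)` has one on a contractible space. The imaginary part of
`L (x, y) - L (y, x)` is antisymmetric without zeros, so its sign orders the connected space `F`.
Hence `F` embeds in the line, and `π` becomes the first projection of `ℝ × ℝ`.

In these coordinates, replace the height `y` of `(x, y)` by the signed length of the part of the
vertical segment from `(x, 0)` to `(x, y)` outside the domain. This is continuous by dominated
convergence, since the boundary curve meets each vertical line in a countable set. It defines a
proper surjection of the plane to itself whose fibres are exactly the segments that the collapse
shrinks, so the collapsed space is again a plane.

Near a point that is not critical the boundary curve is a graph over the line. Hence, away from
the vertices, the image of the domain is locally a section of the projection over an interval, and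
properness leaves only finitely many maximal sections. At a critical point the boundary curve stays
on one side of the vertical line, and the domain lies either between the two branches or outside
them. In the first case the vertex ends at most one edge; in the second, two edges leave it on the
side of the branches and at least one on the other side.
-/

namespace PoincareReeb

/-! ### Vertical planes are globally trivial -/

section Logarithms

open scoped unitInterval

theorem exists_log_of_homotopy {X : Type*} [TopologicalSpace X] (H : C(I × X, ℂ))
    (hH : ∀ p, H p ≠ 0) (L₀ : C(X, ℂ)) (hL₀ : ∀ x, Complex.exp (L₀ x) = H (0, x)) :
    ∃ L : C(X, ℂ), ∀ x, Complex.exp (L x) = H (1, x) := by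
  let H' : C(I × X, {z : ℂ // z ≠ 0}) := ⟨fun p => ⟨H p, hH p⟩, by fun_prop⟩
  have hinit : ∀ x, H' (0, x) = (fun z : ℂ ↦ (⟨_, z.exp_ne_zero⟩ : {z : ℂ // z ≠ 0})) (L₀ x) :=
    fun x => Subtype.ext (hL₀ x).symm
  let K := Complex.isCoveringMap_exp.liftHomotopy H' L₀ hinit
  exact ⟨⟨fun x => K (1, x), by fun_prop⟩, fun x => congrArg Subtype.val
    (congrFun (Complex.isCoveringMap_exp.liftHomotopy_lifts H' L₀ hinit) (1, x))⟩

theorem exists_log_of_contractible {X : Type*} [TopologicalSpace X] [ContractibleSpace X]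
    (G : C(X, ℂ)) (hG : ∀ x, G x ≠ 0) : ∃ L : C(X, ℂ), ∀ x, Complex.exp (L x) = G x := by
  obtain ⟨y, ⟨contraction⟩⟩ := id_nullhomotopic X
  obtain ⟨L, hL⟩ := exists_log_of_homotopy (G.comp contraction.symm.toContinuousMap) (fun p => hG _)
    (ContinuousMap.const X (Complex.log (G y))) (fun x => by simp [Complex.exp_log (hG y)])
  exact ⟨L, fun x => (hL x).trans (by simp)⟩

theorem im_ne_zero_of_exp_eq_neg_one {w : ℂ} (hw : Complex.exp w = -1) : w.im ≠ 0 := fun h => by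
  have hre := congrArg Complex.re hw
  rw [Complex.exp_re, h, Real.cos_zero, mul_one, Complex.neg_re, Complex.one_re] at hre
  linarith [Real.exp_pos w.re]

theorem exp_sub_eq_neg_one {w w' : ℂ} (h : Complex.exp w = -Complex.exp w') :
    Complex.exp (w - w') = -1 := by
  rw [Complex.exp_sub, h, neg_div, div_self (Complex.exp_ne_zero w')]

/- A logarithm `L` of an odd function would make `z ↦ Im (L z - L (-z))` an odd, hence somewhere
vanishing, function on the circle, whereas `exp (L z - L (-z)) = -1`. -/
theorem not_exists_log_odd (u : Metric.sphere (0 : ℂ) 1 → ℂ) (hu : ∀ z, u (-z) = -u z) :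
    ¬ ∃ L : C(Metric.sphere (0 : ℂ) 1, ℂ), ∀ z, Complex.exp (L z) = u z := by
  rintro ⟨L, hL⟩
  have : ConnectedSpace (Metric.sphere (0 : ℂ) 1) := by
    refine Subtype.connectedSpace (isConnected_sphere ?_ 0 zero_le_one)
    rw [Complex.rank_real_complex]
    norm_num
  let k : Metric.sphere (0 : ℂ) 1 → ℝ := fun z => (L (-z) - L z).im
  have hk : Continuous k := by
    have : Continuous fun z : Metric.sphere (0 : ℂ) 1 => L (-z) := L.continuous.comp continuous_neg
    fun_prop
  have hodd : ∀ z, k (-z) = -k z := fun z => by simp [k]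
  let z₀ : Metric.sphere (0 : ℂ) 1 := ⟨1, by simp⟩
  obtain ⟨z, hz⟩ : ∃ z, k z = 0 := by
    rcases le_total (k z₀) 0 with h | h
    · exact mem_range_of_exists_le_of_exists_ge hk ⟨z₀, h⟩ ⟨-z₀, by rw [hodd]; linarith⟩
    · exact mem_range_of_exists_le_of_exists_ge hk ⟨-z₀, by rw [hodd]; linarith⟩ ⟨z₀, h⟩
  exact im_ne_zero_of_exp_eq_neg_one (exp_sub_eq_neg_one (by rw [hL, hL, hu])) hz

/- The homotopy `f z - f (-t z)` leads to the odd function `f z - f (-z)`. -/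
theorem not_exists_log_sub_center {f : ℂ → ℂ} (hf : ContinuousOn f (Metric.closedBall 0 1))
    (hi : InjOn f (Metric.closedBall 0 1)) :
    ¬ ∃ L : C(Metric.sphere (0 : ℂ) 1, ℂ), ∀ z, Complex.exp (L z) = f z - f 0 := by
  rintro ⟨L, hL⟩
  have hmem : ∀ p : I × Metric.sphere (0 : ℂ) 1,
      -(((p.1 : ℝ) : ℂ) * (p.2 : ℂ)) ∈ Metric.closedBall (0 : ℂ) 1 := fun p => by
    rw [mem_closedBall_zero_iff, norm_neg, norm_mul, norm_eq_of_mem_sphere, mul_one,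
      Complex.norm_real, Real.norm_of_nonneg p.1.2.1]
    exact p.1.2.2
  have hne : ∀ p : I × Metric.sphere (0 : ℂ) 1, (p.2 : ℂ) ≠ -(((p.1 : ℝ) : ℂ) * (p.2 : ℂ)) :=
    fun p h => by
      have hprod : ((1 + (p.1 : ℝ) : ℝ) : ℂ) * (p.2 : ℂ) = 0 := by
        push_cast
        linear_combination h
      have hsum : 1 + (p.1 : ℝ) = 0 := by
        exact_mod_cast (mul_eq_zero.1 hprod).resolve_right (ne_zero_of_mem_unit_sphere p.2)
      linarith [p.1.2.1]
  have hfS : Continuous fun z : Metric.sphere (0 : ℂ) 1 => f z :=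
    continuousOn_iff_continuous_domRestrict.1 (hf.mono Metric.sphere_subset_closedBall)
  obtain ⟨L', hL'⟩ := exists_log_of_homotopy
    (⟨fun p : I × Metric.sphere (0 : ℂ) 1 => f p.2 - f (-(((p.1 : ℝ) : ℂ) * (p.2 : ℂ))),
      (hfS.comp continuous_snd).sub (hf.comp_continuous (by fun_prop) hmem)⟩ :
      C(I × Metric.sphere (0 : ℂ) 1, ℂ))
    (fun p => sub_ne_zero.2 fun h =>
      hne p (hi (Metric.sphere_subset_closedBall p.2.2) (hmem p) h))
    L (fun z => (hL z).trans (by simp))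
  exact not_exists_log_odd (fun z => f z - f (-z)) (fun z => by simp)
    ⟨L', fun z => (hL' z).trans (by simp)⟩

/- If `y` near `f 0` were not a value of `f`, then `f - y` would have a logarithm on the disk; move
`y` to `f 0` off the image of the circle. -/
theorem image_closedBall_mem_nhds {f : ℂ → ℂ} (hf : ContinuousOn f (Metric.closedBall 0 1))
    (hi : InjOn f (Metric.closedBall 0 1)) : f '' Metric.closedBall 0 1 ∈ 𝓝 (f 0) := by
  have hSB : Metric.sphere (0 : ℂ) 1 ⊆ Metric.closedBall 0 1 := Metric.sphere_subset_closedBall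
  have hK : IsCompact (f '' Metric.sphere (0 : ℂ) 1) :=
    (isCompact_sphere _ _).image_of_continuousOn (hf.mono hSB)
  have h0 : f 0 ∉ f '' Metric.sphere (0 : ℂ) 1 := by
    rintro ⟨z, hz, h⟩
    rw [hi (hSB hz) (by simp) h] at hz
    simp at hz
  obtain ⟨ε, hε, hdisj⟩ := Metric.mem_nhds_iff.1 (hK.isClosed.isOpen_compl.mem_nhds h0)
  refine Filter.mem_of_superset (Metric.ball_mem_nhds _ hε) fun y hy => ?_
  by_contra hyf
  have : ContractibleSpace (Metric.closedBall (0 : ℂ) 1) :=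
    (convex_closedBall _ _).contractibleSpace ⟨0, by simp⟩
  obtain ⟨L, hL⟩ := exists_log_of_contractible
    (⟨fun z : Metric.closedBall (0 : ℂ) 1 => f z - y,
      (continuousOn_iff_continuous_domRestrict.1 hf).sub continuous_const⟩ :
      C(Metric.closedBall (0 : ℂ) 1, ℂ))
    (fun z => sub_ne_zero.2 fun h => hyf ⟨z, z.2, h⟩)
  have hfS : Continuous fun z : Metric.sphere (0 : ℂ) 1 => f z :=
    continuousOn_iff_continuous_domRestrict.1 (hf.mono hSB)
  have hseg : ∀ t : I, y + ((t : ℝ) : ℂ) * (f 0 - y) ∈ Metric.ball (f 0) ε := fun t => by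
    simpa using (convex_ball (f 0) ε).add_smul_sub_mem hy (Metric.mem_ball_self hε) t.2
  obtain ⟨L', hL'⟩ := exists_log_of_homotopy
    (⟨fun p : I × Metric.sphere (0 : ℂ) 1 => f p.2 - (y + ((p.1 : ℝ) : ℂ) * (f 0 - y)),
      (hfS.comp continuous_snd).sub (by fun_prop)⟩ : C(I × Metric.sphere (0 : ℂ) 1, ℂ))
    (fun p => sub_ne_zero.2 fun h => hdisj (h ▸ hseg p.1) ⟨_, p.2.2, rfl⟩)
    ⟨fun z => L ⟨z, hSB z.2⟩, by fun_prop⟩ (fun z => (hL _).trans (by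
      change f z - y = f z - (y + ((0 : ℝ) : ℂ) * (f 0 - y))
      simp))
  exact not_exists_log_sub_center hf hi ⟨L', fun z => (hL' z).trans (by simp)⟩

theorem isOpen_image_of_continuousOn_injOn {f : ℂ → ℂ} {U : Set ℂ} (hU : IsOpen U)
    (hf : ContinuousOn f U) (hi : InjOn f U) : IsOpen (f '' U) := by
  rw [isOpen_iff_mem_nhds]
  rintro _ ⟨x, hx, rfl⟩
  obtain ⟨r, hr, hrU⟩ := Metric.nhds_basis_closedBall.mem_iff.1 (hU.mem_nhds hx)
  let a : ℂ → ℂ := fun z => x + r * z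
  have ha : MapsTo a (Metric.closedBall 0 1) U := fun z hz => hrU (by
    rw [mem_closedBall_zero_iff] at hz
    simp only [a, Metric.mem_closedBall, dist_self_add_left, norm_mul, Complex.norm_real,
      Real.norm_of_nonneg hr.le]
    nlinarith)
  have hai : a.Injective := fun z w h => by
    have : (r : ℂ) ≠ 0 := by exact_mod_cast hr.ne'
    simpa [a, this] using h
  have himage := image_closedBall_mem_nhds (f := f ∘ a) (hf.comp (by fun_prop) ha)
    (hi.comp hai.injOn ha)
  rw [image_comp, Function.comp_apply, show a 0 = x by simp [a]] at himage
  exact Filter.mem_of_superset himage (image_mono ha.image_subset)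

theorem isOpen_image_of_homeomorph {X Y : Type*} [TopologicalSpace X] [TopologicalSpace Y]
    (a : X ≃ₜ ℂ) (b : Y ≃ₜ ℂ) {f : X → Y} {U : Set X} (hU : IsOpen U) (hf : ContinuousOn f U)
    (hi : InjOn f U) : IsOpen (f '' U) := by
  have hm : MapsTo a.symm (a '' U) U := by
    rintro _ ⟨x, hx, rfl⟩
    simpa using hx
  have himage : IsOpen ((b ∘ f ∘ a.symm) '' (a '' U)) :=
    isOpen_image_of_continuousOn_injOn (a.isOpenMap _ hU)
      (b.continuous.comp_continuousOn (hf.comp a.symm.continuous.continuousOn hm))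
      (b.injective.injOn.comp (hi.comp a.symm.injective.injOn hm) (mapsTo_univ _ _))
  have hcomp : (b ∘ f ∘ a.symm) ∘ a = b ∘ f := by
    ext
    simp
  rw [← image_comp, hcomp, image_comp] at himage
  exact b.isOpen_image.1 himage

end Logarithms

section Line

variable {F : Type*} [TopologicalSpace F]

section Order

variable [LinearOrder F] [OrderTopology F] [TopologicalSpace.SeparableSpace F]

theorem exists_dense_orderIso_rat [DenselyOrdered F] [Nontrivial F] :
    ∃ S : Set F, Dense S ∧ Nonempty (S ≃o ℚ) := by
  obtain ⟨S, hScount, hSdense, hbot, htop⟩ := exists_countable_dense_no_bot_top F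
  have hbetween : ∀ a b : F, a < b → ∃ q : S, a < q ∧ (q : F) < b := fun a b hab => by
    obtain ⟨q, hq, haq, hqb⟩ := hSdense.exists_between hab
    exact ⟨⟨q, hq⟩, haq, hqb⟩
  have : Countable S := hScount
  have : Nonempty S := hSdense.nonempty.to_subtype
  have : DenselyOrdered S := ⟨fun a b hab => hbetween a b hab⟩
  have : NoMinOrder S := ⟨fun q => by
    obtain ⟨a, ha⟩ := not_forall.1 fun h => hbot q h q.2
    obtain ⟨r, -, hr⟩ := hbetween a q (not_le.1 ha)
    exact ⟨r, hr⟩⟩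
  have : NoMaxOrder S := ⟨fun q => by
    obtain ⟨a, ha⟩ := not_forall.1 fun h => htop q h q.2
    obtain ⟨r, hr, -⟩ := hbetween q a (not_le.1 ha)
    exact ⟨r, hr⟩⟩
  exact ⟨S, hSdense, Order.iso_of_countable_dense S ℚ⟩

/- The function is the supremum of an order isomorphism between a countable dense subset and `ℚ`. -/
theorem exists_continuous_strictMono_ereal [DenselyOrdered F] [Nontrivial F] :
    ∃ f : F → EReal, Continuous f ∧ StrictMono f := by
  obtain ⟨S, hS, ⟨e⟩⟩ := exists_dense_orderIso_rat (F := F)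
  let f : F → EReal := fun x => ⨆ q : {q : S // (q : F) < x}, (((e q : ℚ) : ℝ) : EReal)
  have hle : ∀ (q : S) (x : F), (q : F) < x → (((e q : ℚ) : ℝ) : EReal) ≤ f x := fun q x h =>
    le_iSup (fun q : {q : S // (q : F) < x} => (((e q : ℚ) : ℝ) : EReal)) ⟨q, h⟩
  have hge : ∀ (q : S) (x : F), x ≤ q → f x ≤ (((e q : ℚ) : ℝ) : EReal) := fun q x h =>
    iSup_le fun q' => by exact_mod_cast e.monotone (show q'.1 ≤ q from (q'.2.trans_le h).le)
  have hmono : StrictMono f := fun x y hxy => by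
    obtain ⟨q, hq, hxq, hqy⟩ := hS.exists_between hxy
    obtain ⟨q', hq', hqq', hqy'⟩ := hS.exists_between hqy
    have : (((e ⟨q, hq⟩ : ℚ) : ℝ) : EReal) < ((e ⟨q', hq'⟩ : ℚ) : ℝ) := by
      exact_mod_cast e.strictMono hqq'
    exact (hge ⟨q, hq⟩ x hxq.le).trans_lt (this.trans_le (hle ⟨q', hq'⟩ y hqy'))
  refine ⟨f, hmono.monotone.continuous_of_denseRange ?_, hmono⟩
  refine dense_of_exists_between fun a b hab => ?_
  obtain ⟨r, har, hrb⟩ := EReal.lt_iff_exists_rat_btwn.1 hab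
  obtain ⟨s, hrs, hsb⟩ := EReal.lt_iff_exists_rat_btwn.1 hrb
  have hrs' : e.symm r < e.symm s := e.symm.strictMono (by exact_mod_cast hrs)
  refine ⟨_, mem_range_self (e.symm s : F), har.trans_le ?_, lt_of_le_of_lt ?_ hsb⟩
  · simpa using hle (e.symm r) (e.symm s) hrs'
  · simpa using hge (e.symm s) (e.symm s) le_rfl

theorem exists_continuous_strictMono_unitInterval [PreconnectedSpace F] :
    ∃ f : F → unitInterval, Continuous f ∧ StrictMono f := by
  rcases subsingleton_or_nontrivial F with _ | _
  · exact ⟨fun _ => 0, continuous_const, fun a b h => absurd (Subsingleton.elim a b) h.ne⟩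
  have := denselyOrdered_of_preconnectedSpace (α := F)
  obtain ⟨f, hf, hmono⟩ := exists_continuous_strictMono_ereal (F := F)
  let e : EReal ≃o unitInterval := EReal.expOrderIso.trans ENNReal.orderIsoUnitIntervalBirational
  exact ⟨e ∘ f, e.continuous.comp hf, e.strictMono.comp hmono⟩

end Order

section Tournament

variable [PreconnectedSpace F] {r : F → F → Prop} [Std.Asymm r] [Std.Trichotomous r]

/- If `a < b < c < a`, then the set of all `x` with `c < x < b` is clopen, contains `a` and
misses `b`. -/
theorem isTrans_of_isOpen (hl : ∀ a, IsOpen {x | r x a}) (hr : ∀ a, IsOpen {x | r a x}) :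
    IsTrans F r where
  trans a b c hab hbc := by
    have hasymm : ∀ x y, r x y → ¬ r y x := Std.Asymm.asymm
    have htri : ∀ x y, ¬ r x y → ¬ r y x → x = y := Std.Trichotomous.trichotomous
    by_contra hac
    have hca : r c a := by grind
    have hcompl : ({x | r x b} ∩ {x | r c x})ᶜ = {x | r b x} ∪ {x | r x c} := by
      ext x
      simp only [mem_compl_iff, mem_inter_iff, mem_union, mem_ofPred_eq]
      grind
    have hclopen : IsClopen ({x | r x b} ∩ {x | r c x}) :=
      ⟨isOpen_compl_iff.1 (hcompl ▸ (hr b).union (hl c)), (hl b).inter (hr c)⟩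
    have hb : b ∈ {x | r x b} ∩ {x | r c x} := hclopen.eq_univ ⟨a, hab, hca⟩ ▸ mem_univ b
    exact hasymm b b hb.1 hb.1

theorem exists_linearOrder_topology_le (hl : ∀ a, IsOpen {x | r x a})
    (hr : ∀ a, IsOpen {x | r a x}) :
    ∃ _ : LinearOrder F, ‹TopologicalSpace F› ≤ Preorder.topology F := by
  classical
  have := isTrans_of_isOpen hl hr
  have : IsStrictOrder F r := { irrefl := fun a h => Std.Asymm.asymm a a h h }
  have : IsStrictTotalOrder F r := {}
  refine ⟨linearOrderOfSTO r, le_generateFrom ?_⟩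
  rintro _ ⟨a, rfl | rfl⟩
  · exact hr a
  · exact hl a

theorem exists_continuous_injective_unitInterval [TopologicalSpace.SeparableSpace F]
    (hl : ∀ a, IsOpen {x | r x a}) (hr : ∀ a, IsOpen {x | r a x}) :
    ∃ f : F → unitInterval, Continuous f ∧ f.Injective := by
  obtain ⟨_, hle⟩ := exists_linearOrder_topology_le hl hr
  have hid : Continuous[_, Preorder.topology F] id := continuous_id_iff_le.2 hle
  have hdense : @DenseRange F (Preorder.topology F) F id := fun x => by simp
  have hord := @OrderTopology.mk F (Preorder.topology F) _ rfl
  have hconn := @DenseRange.preconnectedSpace _ _ _ (Preorder.topology F) _ _ hdense hid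
  have hsep := @DenseRange.separableSpace _ _ _ _ (Preorder.topology F) _ hdense hid
  obtain ⟨f, hf, hmono⟩ :=
    @exists_continuous_strictMono_unitInterval F (Preorder.topology F) _ hord hsep hconn
  exact ⟨f, continuous_le_dom hle hf, hmono.injective⟩

end Tournament

section Factor

/- Push the first point up the factor `ℝ`: before that its difference with the second one vanishes
only on the diagonal, and afterwards it never vanishes. -/
theorem exists_log_sub_of_prod_homeomorph (h : F × ℝ ≃ₜ ℂ) :
    ∃ L : C({p : F × F // p.1 ≠ p.2}, ℂ),
      ∀ p, Complex.exp (L p) = h (p.1.1, 0) - h (p.1.2, 0) := by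
  have : ContractibleSpace ((F × ℝ) × (F × ℝ)) :=
    (h.prodCongr h).toHomotopyEquiv.contractibleSpace
  obtain ⟨L, hL⟩ := exists_log_of_contractible
    (⟨fun p => h (p.1.1, 1) - h (p.2.1, 0), by fun_prop⟩ : C((F × ℝ) × (F × ℝ), ℂ))
    (fun p hp => by simpa using congrArg Prod.snd (h.injective (sub_eq_zero.1 hp)))
  obtain ⟨L', hL'⟩ := exists_log_of_homotopy
    (⟨fun p => h (p.2.1.1, 1 - p.1) - h (p.2.1.2, 0), by fun_prop⟩ :
      C(unitInterval × {p : F × F // p.1 ≠ p.2}, ℂ))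
    (fun p hp => p.2.2 (congrArg Prod.fst (h.injective (sub_eq_zero.1 hp))))
    ⟨fun p => L ((p.1.1, 0), (p.1.2, 0)), by fun_prop⟩ (fun p => (hL _).trans (by simp))
  exact ⟨L', fun p => (hL' p).trans (by simp)⟩

theorem exists_antisymm_of_prod_homeomorph (h : F × ℝ ≃ₜ ℂ) :
    ∃ τ : C({p : F × F // p.1 ≠ p.2}, ℝ), ∀ x y (hxy : x ≠ y),
      τ ⟨(y, x), hxy.symm⟩ = -τ ⟨(x, y), hxy⟩ ∧ τ ⟨(x, y), hxy⟩ ≠ 0 := by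
  obtain ⟨L, hL⟩ := exists_log_sub_of_prod_homeomorph h
  refine ⟨⟨fun p => (L p - L ⟨p.1.swap, p.2.symm⟩).im, by fun_prop⟩, fun x y hxy => ⟨?_, ?_⟩⟩
  · simp
  · exact im_ne_zero_of_exp_eq_neg_one (exp_sub_eq_neg_one (by simp [hL]))

theorem exists_continuous_injective_of_prod_homeomorph (h : F × ℝ ≃ₜ ℂ) :
    ∃ f : F → unitInterval, Continuous f ∧ f.Injective := by
  have hemb : IsEmbedding (fun x : F => h (x, 0)) := h.isEmbedding.comp (isEmbedding_prodMkLeft 0)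
  have : T2Space F := hemb.t2Space
  have : SecondCountableTopology F := hemb.secondCountableTopology
  have : PreconnectedSpace F := (Prod.fst_surjective.comp h.symm.surjective).denseRange
    |>.preconnectedSpace (continuous_fst.comp h.symm.continuous)
  obtain ⟨τ, hτ⟩ := exists_antisymm_of_prod_homeomorph h
  let r : F → F → Prop := fun x y => ∃ hxy : x ≠ y, 0 < τ ⟨(x, y), hxy⟩
  have : Std.Asymm r := ⟨fun x y ⟨hxy, hpos⟩ ⟨_, hneg⟩ => by
    rw [(hτ x y hxy).1] at hneg
    linarith⟩
  have : Std.Trichotomous r := ⟨fun x y hxy hyx => by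
    by_contra! hne
    rcases (hτ x y hne).2.lt_or_gt with hneg | hpos
    · exact hyx ⟨hne.symm, by rw [(hτ x y hne).1]; linarith⟩
    · exact hxy ⟨hne, hpos⟩⟩
  have hopen : IsOpen {p : F × F | r p.1 p.2} := by
    convert isClosed_diagonal.isOpen_compl.isOpenMap_subtype_val _
      ((isOpen_Ioi (a := (0 : ℝ))).preimage τ.continuous) using 1
    ext ⟨x, y⟩
    constructor
    · rintro ⟨hxy, hpos⟩
      exact ⟨⟨(x, y), hxy⟩, hpos, rfl⟩
    · rintro ⟨⟨_, hxy⟩, hpos, rfl⟩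
      exact ⟨hxy, hpos⟩
  exact exists_continuous_injective_unitInterval (r := r)
    (fun a => hopen.preimage (f := fun x => (x, a)) (by fun_prop))
    (fun a => hopen.preimage (f := fun x => (a, x)) (by fun_prop))

theorem nonempty_homeomorph_of_isOpen_convex {E : Type*} [NormedAddCommGroup E] [NormedSpace ℝ E]
    {s : Set E} (ho : IsOpen s) (hc : Convex ℝ s) (hn : s.Nonempty) (hb : Bornology.IsBounded s) :
    Nonempty (s ≃ₜ E) := by
  obtain ⟨e, he, -⟩ :=
    exists_homeomorph_image_interior_closure_frontier_eq_unitBall hc (by rwa [ho.interior_eq]) hb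
  rw [ho.interior_eq] at he
  exact ⟨(e.image s).trans ((Homeomorph.setCongr he).trans Homeomorph.unitBall.symm)⟩

theorem isOpenEmbedding_of_prod_homeomorph (h : F × ℝ ≃ₜ ℂ) {f : F → ℝ} (hf : Continuous f)
    (hi : f.Injective) : IsOpenEmbedding f := by
  refine .of_continuous_injective_isOpenMap hf hi fun U hU => ?_
  have hprod : IsOpen (Prod.map f id '' (U ×ˢ (univ : Set ℝ))) :=
    isOpen_image_of_homeomorph h Complex.equivRealProdCLM.toHomeomorph.symm
      (hU.prod isOpen_univ) (hf.prodMap continuous_id).continuousOn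
      (hi.prodMap Function.injective_id).injOn
  rw [prodMap_image_prod, image_id] at hprod
  rw [← fst_image_prod (f '' U) (univ_nonempty (α := ℝ))]
  exact isOpenMap_fst _ hprod

theorem nonempty_homeomorph_real_of_prod (h : F × ℝ ≃ₜ ℂ) : Nonempty (F ≃ₜ ℝ) := by
  have : Nonempty F := ⟨(h.symm 0).1⟩
  have : PreconnectedSpace F := (Prod.fst_surjective.comp h.symm.surjective).denseRange
    |>.preconnectedSpace (continuous_fst.comp h.symm.continuous)
  obtain ⟨f, hf, hi⟩ := exists_continuous_injective_of_prod_homeomorph h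
  have hcont : Continuous fun x => (f x : ℝ) := by fun_prop
  have hemb := isOpenEmbedding_of_prod_homeomorph h hcont (Subtype.val_injective.comp hi)
  obtain ⟨e⟩ := nonempty_homeomorph_of_isOpen_convex hemb.isOpen_range
    (isPreconnected_range hcont).ordConnected.convex (range_nonempty _)
    (Metric.isBounded_Icc (0 : ℝ) 1 |>.subset (by rintro _ ⟨x, rfl⟩; exact (f x).2))
  exact ⟨hemb.isEmbedding.toHomeomorph.trans e⟩

end Factor

end Line

section Trivial

open Bundle (Trivialization)

variable {P : Type*} [TopologicalSpace P] {F : Type*} [TopologicalSpace F]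

theorem exists_homeomorph_of_eventually_eq_trivialization {B : Type*} [TopologicalSpace B]
    {π : P → B} (T : P → B × F)
    (hT : ∀ x, ∃ e : Trivialization F π, x ∈ e.baseSet ∧ ∀ᶠ y in 𝓝 x, ∀ p, π p = y → T p = e p) :
    ∃ Φ : P ≃ₜ B × F, ∀ p, (Φ p).1 = π p := by
  choose e he hTe using hT
  have heq : ∀ p, T p = e (π p) p := fun p => (hTe (π p)).self_of_nhds p rfl
  have hsource : ∀ p, p ∈ (e (π p)).source := fun p => (e (π p)).mem_source.2 (he _)
  have hfst : ∀ p, (T p).1 = π p := fun p => by rw [heq, (e (π p)).coe_fst (hsource p)]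
  have hev : ∀ p, T =ᶠ[𝓝 p] e (π p) := fun p =>
    (((e (π p)).continuousAt_proj (hsource p)).eventually (hTe (π p))).mono fun q hq => hq q rfl
  have hcont : Continuous T := continuous_iff_continuousAt.2 fun p =>
    ((e (π p)).continuousAt (hsource p)).congr (hev p).symm
  have hopen : IsOpenMap T := isOpenMap_iff_nhds_le.2 fun p => by
    rw [Filter.map_congr (hev p), (hev p).eq_of_nhds]
    exact ((e (π p)).map_nhds_eq (hsource p)).ge
  have hinj : T.Injective := fun p q hpq => by
    have hπ : π p = π q := by rw [← hfst, hpq, hfst]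
    rw [heq, heq q, ← hπ] at hpq
    exact (e (π p)).injOn (hsource p) ((e (π p)).mem_source.2 (hπ ▸ he _)) hpq
  have hsurj : T.Surjective := fun z => by
    have hz : z ∈ (e z.1).target := (e z.1).mem_target.2 (he _)
    refine ⟨(e z.1).toOpenPartialHomeomorph.symm z, ?_⟩
    rw [heq, (e z.1).proj_symm_apply hz]
    exact (e z.1).apply_symm_apply hz
  exact ⟨(Equiv.ofBijective T ⟨hinj, hsurj⟩).toHomeomorphOfContinuousOpen hcont hopen, hfst⟩

variable {π : P → ℝ}

theorem exists_trivialization_Icc (h : ∀ x : ℝ, ∃ e : Trivialization F π, x ∈ e.baseSet) {a b : ℝ}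
    (hab : a ≤ b) : ∃ e : Trivialization F π, Icc a b ⊆ e.baseSet := by
  choose e he using h
  obtain ⟨t, ht0, htm, ⟨m, hm⟩, ht⟩ := exists_monotone_Icc_subset_open_cover_Icc hab
    (c := fun x : ℝ => ((↑) : Icc a b → ℝ) ⁻¹' (e x).baseSet)
    (fun x => (e x).open_baseSet.preimage continuous_subtype_val)
    (fun x _ => mem_iUnion.2 ⟨x, he x⟩)
  have hinitial : ∀ n, ∃ e : Trivialization F π, Icc a (t n : ℝ) ⊆ e.baseSet := by
    intro n
    induction n with
    | zero => exact ⟨e a, by rw [ht0]; simp [he]⟩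
    | succ n ih =>
      obtain ⟨e₁, he₁⟩ := ih
      obtain ⟨i, hi⟩ := ht n
      have hei : ∀ x : ℝ, (t n : ℝ) ≤ x → x ≤ t (n + 1) → x ∈ (e i).baseSet := fun x hx hx' =>
        @hi ⟨x, (t n).2.1.trans hx, hx'.trans (t (n + 1)).2.2⟩ ⟨hx, hx'⟩
      have hle : (t n : ℝ) ≤ t (n + 1) := htm n.le_succ
      exact ⟨e₁.piecewiseLe (e i) (t n) (he₁ ⟨(t n).2.1, le_rfl⟩) (hei _ le_rfl hle),
        subset_ite.2 ⟨fun x hx => he₁ ⟨hx.1.1, hx.2⟩,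
          fun x hx => hei x (not_le.1 hx.2).le hx.1.2⟩⟩
  obtain ⟨e', he'⟩ := hinitial m
  exact ⟨e', by rwa [hm m le_rfl] at he'⟩

theorem exists_trivialization_extend (h : ∀ x : ℝ, ∃ e : Trivialization F π, x ∈ e.baseSet)
    {a b : ℝ} (ha : 0 ≤ a) (hab : a ≤ b) (e : Trivialization F π) (he : Icc (-a) a ⊆ e.baseSet) :
    ∃ e' : Trivialization F π, Icc (-b) b ⊆ e'.baseSet ∧ ∀ p, |π p| ≤ a → e' p = e p := by
  obtain ⟨e₀, he₀⟩ := exists_trivialization_Icc h (a := -b) (b := b) (by linarith)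
  let eR := e.piecewiseLe e₀ a (he ⟨by linarith, le_rfl⟩) (he₀ ⟨by linarith, hab⟩)
  have heR : Icc (-a) b ⊆ eR.baseSet := subset_ite.2 ⟨fun x hx => he ⟨hx.1.1, hx.2⟩,
    fun x hx => he₀ ⟨by linarith [hx.1.1], hx.1.2⟩⟩
  have hmem₀ : -a ∈ e₀.baseSet := he₀ ⟨by linarith, by linarith⟩
  have hmemR : -a ∈ eR.baseSet := heR ⟨le_rfl, by linarith⟩
  let eL := e₀.transFiberHomeomorph (e₀.coordChangeHomeomorph eR hmem₀ hmemR)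
  have heq : ∀ p, π p = -a → eL p = eR p := by
    intro p hp
    rw [← hp] at hmem₀ hmemR
    ext1
    · simp [eL, *]
    · simpa [eL, ← hp] using e₀.coordChange_apply_snd eR hmem₀
  refine ⟨eL.piecewiseLeOfEq eR (-a) hmem₀ hmemR heq, subset_ite.2
    ⟨fun x hx => he₀ hx.1, fun x hx => heR ⟨(not_le.1 hx.2).le, hx.1.2⟩⟩, fun p hp => ?_⟩
  obtain ⟨hleft, hright⟩ := abs_le.1 hp
  rw [← show eR p = e p from if_pos hright]
  rcases hleft.eq_or_lt with hp' | hp'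
  · rw [← heq p hp'.symm]
    exact if_pos (show π p ≤ -a from hp'.symm.le)
  · exact if_neg fun hp'' : π p ≤ -a => hp'.not_ge hp''

theorem exists_seq_trivialization (h : ∀ x : ℝ, ∃ e : Trivialization F π, x ∈ e.baseSet) :
    ∃ f : ℕ → Trivialization F π, (∀ n : ℕ, Icc (-(n : ℝ)) n ⊆ (f n).baseSet) ∧
      ∀ m n : ℕ, m ≤ n → ∀ p, |π p| ≤ m → f n p = f m p := by
  obtain ⟨e₀, he₀⟩ := h 0
  have hextend : ∀ (n : ℕ) (e : {e : Trivialization F π // Icc (-(n : ℝ)) n ⊆ e.baseSet}),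
      ∃ e' : {e : Trivialization F π // Icc (-((n + 1 : ℕ) : ℝ)) (n + 1 : ℕ) ⊆ e.baseSet},
        ∀ p, |π p| ≤ n → e'.1 p = e.1 p := fun n e => by
    obtain ⟨e', he', heq⟩ := exists_trivialization_extend h (Nat.cast_nonneg n)
      (Nat.cast_le.2 n.le_succ) e.1 e.2
    exact ⟨⟨e', he'⟩, heq⟩
  choose next hnext using hextend
  let f : ∀ n : ℕ, {e : Trivialization F π // Icc (-(n : ℝ)) n ⊆ e.baseSet} := fun n =>
    Nat.rec ⟨e₀, by simpa using he₀⟩ next n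
  refine ⟨fun n => (f n).1, fun n => (f n).2, fun m n hmn p hp => ?_⟩
  induction n, hmn using Nat.le_induction with
  | base => rfl
  | succ n hmn ih => exact (hnext n (f n) p (hp.trans (Nat.cast_le.2 hmn))).trans ih

theorem exists_homeomorph_prod (h : ∀ x : ℝ, ∃ e : Trivialization F π, x ∈ e.baseSet) :
    ∃ Φ : P ≃ₜ ℝ × F, ∀ p, (Φ p).1 = π p := by
  obtain ⟨f, hbase, hcompat⟩ := exists_seq_trivialization h
  refine exists_homeomorph_of_eventually_eq_trivialization (fun p => f ⌈|π p|⌉₊ p) fun x => ?_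
  obtain ⟨n, hn⟩ := exists_nat_gt |x|
  refine ⟨f n, hbase n (abs_le.1 hn.le), ?_⟩
  filter_upwards [continuous_abs.continuousAt.eventually (gt_mem_nhds hn)] with y hy p hp
  subst hp
  exact (hcompat _ n (Nat.ceil_le.2 hy.le) p (Nat.le_ceil _)).symm

theorem IsVerticalPlane.nonempty_fiber_homeomorph (hP : IsVerticalPlane π) (x y : ℝ) :
    Nonempty (π ⁻¹' {x} ≃ₜ π ⁻¹' {y}) := by
  have hlocal : ∀ x : ℝ, ∀ᶠ y in 𝓝 x, Nonempty (π ⁻¹' {x} ≃ₜ π ⁻¹' {y}) := fun x => by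
    obtain ⟨e, he⟩ := hP.locally_trivial x
    filter_upwards [e.open_baseSet.mem_nhds he] with y hy
    exact ⟨(e.preimageSingletonHomeomorph hy).symm⟩
  refine PreconnectedSpace.induction₂' (fun x y : ℝ => Nonempty (π ⁻¹' {x} ≃ₜ π ⁻¹' {y}))
    (fun x => ?_) ⟨?_⟩ x y
  · filter_upwards [hlocal x] with y hy
    exact ⟨hy, hy.map Homeomorph.symm⟩
  · rintro x y z ⟨a⟩ ⟨b⟩
    exact ⟨a.trans b⟩

theorem IsVerticalPlane.exists_homeomorph (hP : IsVerticalPlane π) :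
    ∃ Φ : P ≃ₜ ℝ × ℝ, ∀ p, (Φ p).1 = π p := by
  obtain ⟨Φ, hΦ⟩ := exists_homeomorph_prod (F := π ⁻¹' {0}) (π := π) fun x => by
    obtain ⟨e, he⟩ := hP.locally_trivial x
    obtain ⟨k⟩ := hP.nonempty_fiber_homeomorph x 0
    exact ⟨e.transFiberHomeomorph k, he⟩
  obtain ⟨a⟩ := hP.homeomorphic_plane
  obtain ⟨k⟩ := nonempty_homeomorph_real_of_prod (((Homeomorph.prodComm _ _).trans Φ.symm).trans
    (a.trans Complex.equivRealProdCLM.toHomeomorph.symm))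
  exact ⟨Φ.trans ((Homeomorph.refl ℝ).prodCongr k), hΦ⟩

end Trivial

/-! ### The boundary curve of a surface in a plane -/

theorem isOpen_range_of_homeomorph {X Y : Type*} [TopologicalSpace X] [TopologicalSpace Y]
    (a : X ≃ₜ ℂ) (b : Y ≃ₜ ℂ) {U : Set X} (hU : IsOpen U) {f : U → Y} (hf : Continuous f)
    (hi : f.Injective) : IsOpen (range f) := by
  let g : X → Y := Function.extend Subtype.val f fun _ => b.symm 0
  have hg : U.domRestrict g = f := by
    ext x
    exact Subtype.val_injective.extend_apply f (fun _ => b.symm 0) x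
  rw [← hg, range_domRestrict]
  exact isOpen_image_of_homeomorph a b hU (continuousOn_iff_continuous_domRestrict.2 (hg ▸ hf))
    (injOn_iff_injective.2 (hg ▸ hi))

section Charts

variable {P : Type*} [TopologicalSpace P] {D : Set P}

theorem mem_interior_of_chart_pos (a : P ≃ₜ ℂ)
    (φ : OpenPartialHomeomorph D (EuclideanHalfSpace 2)) {p : D} (hp : p ∈ φ.source)
    (h0 : 0 < (φ p).1 0) : p.1 ∈ interior D := by
  obtain ⟨T, hT, hT'⟩ := isOpen_induced_iff.1 φ.open_target
  have hO : IsOpen (T ∩ {v : EuclideanSpace ℝ (Fin 2) | 0 < v 0}) :=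
    hT.inter (isOpen_lt continuous_const (by fun_prop))
  let lift : ↥(T ∩ {v : EuclideanSpace ℝ (Fin 2) | 0 < v 0}) → EuclideanHalfSpace 2 :=
    fun v => ⟨v.1, v.2.2.le⟩
  have hlift : ∀ v, lift v ∈ φ.target := fun v => by rw [← hT']; exact v.2.1
  have hlc : Continuous lift := by fun_prop
  have hopen := isOpen_range_of_homeomorph
    (Complex.orthonormalBasisOneI.repr.toHomeomorph.symm) a hO
    (f := fun v => (φ.symm (lift v)).1)
    (continuous_subtype_val.comp (φ.continuousOn_symm.comp_continuous hlc hlift))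
    (fun v w h => Subtype.ext (congrArg (fun z : EuclideanHalfSpace 2 => z.1)
      (φ.symm.injOn (hlift v) (hlift w) (Subtype.ext h))))
  refine mem_interior.2 ⟨_, ?_, hopen, ?_⟩
  · rintro _ ⟨v, rfl⟩
    exact (φ.symm (lift v)).2
  · have hm : φ p ∈ φ.target := φ.map_source hp
    rw [← hT'] at hm
    exact ⟨⟨(φ p).1, hm, h0⟩, congrArg Subtype.val (φ.left_inv hp)⟩

theorem notMem_interior_of_chart_eq_zero (a : P ≃ₜ ℂ)
    (φ : OpenPartialHomeomorph D (EuclideanHalfSpace 2)) {p : D} (hp : p ∈ φ.source)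
    (h0 : (φ p).1 0 = 0) : p.1 ∉ interior D := by
  intro hpi
  obtain ⟨S, hS, hS'⟩ := isOpen_induced_iff.1 φ.open_source
  have hO : IsOpen (S ∩ interior D) := hS.inter isOpen_interior
  let lift : ↥(S ∩ interior D) → D := fun q => ⟨q.1, interior_subset q.2.2⟩
  have hlift : ∀ q, lift q ∈ φ.source := fun q => by rw [← hS']; exact q.2.1
  have hlc : Continuous lift := by fun_prop
  have hopen := isOpen_range_of_homeomorph a
    (Complex.orthonormalBasisOneI.repr.toHomeomorph.symm) hO
    (f := fun q => (φ (lift q)).1)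
    (continuous_subtype_val.comp (φ.continuousOn.comp_continuous hlc hlift))
    (fun v w h => Subtype.ext (congrArg (fun z : D => z.1)
      (φ.injOn (hlift v) (hlift w) (Subtype.ext h))))
  have hpS : p ∈ Subtype.val ⁻¹' S := hS' ▸ hp
  have hmem : (φ p).1 ∈ range fun q => (φ (lift q)).1 := ⟨⟨p.1, hpS, hpi⟩, rfl⟩
  let k : ℝ → EuclideanSpace ℝ (Fin 2) := fun t => !₂[t, (φ p).1 1]
  have hk : Continuous k := by fun_prop
  have hk0 : k 0 = (φ p).1 := by
    ext i
    fin_cases i <;> simp [k, h0]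
  have hev : ∀ᶠ t in 𝓝[<] (0 : ℝ), k t ∈ range fun q => (φ (lift q)).1 :=
    (hk.tendsto 0).mono_left nhdsWithin_le_nhds (hopen.mem_nhds (hk0 ▸ hmem))
  obtain ⟨t, ⟨q, hq⟩, ht⟩ := (hev.and self_mem_nhdsWithin).exists
  have hcoord : (φ (lift q)).1 0 = t := by
    simpa [k] using congrArg (fun v : EuclideanSpace ℝ (Fin 2) => v 0) hq
  exact (hcoord ▸ (φ (lift q)).2 : (0 : ℝ) ≤ t).not_gt ht

theorem chart_eq_zero_iff (a : P ≃ₜ ℂ) (hc : IsClosed D)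
    (φ : OpenPartialHomeomorph D (EuclideanHalfSpace 2)) {p : D} (hp : p ∈ φ.source) :
    (φ p).1 0 = 0 ↔ p.1 ∈ frontier D := by
  rw [hc.frontier_eq]
  refine ⟨fun h => ⟨p.2, notMem_interior_of_chart_eq_zero a φ hp h⟩, fun h => ?_⟩
  by_contra h0
  exact h.2 (mem_interior_of_chart_pos a φ hp ((φ p).2.lt_of_ne' h0))

theorem boundaryCurve_eq_frontier (a : P ≃ₜ ℂ) (hc : IsClosed D) (hs : IsSurface D) :
    boundaryCurve D = frontier D := by
  ext p
  constructor
  · rintro ⟨q, ⟨φ, hq, h0⟩, rfl⟩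
    exact (chart_eq_zero_iff a hc φ hq).1 h0
  · intro hp
    obtain ⟨φ, hφ⟩ := hs.exists_chart ⟨p, hc.frontier_subset hp⟩
    exact ⟨_, ⟨φ, hφ, (chart_eq_zero_iff a hc φ hφ).2 hp⟩, rfl⟩

/-- The point of the boundary of the half-plane with second coordinate `t`. -/
def boundaryPoint (t : ℝ) : EuclideanHalfSpace 2 := ⟨!₂[0, t], by simp⟩

theorem continuous_boundaryPoint : Continuous boundaryPoint := by
  unfold boundaryPoint
  fun_prop

theorem boundaryPoint_eq {z : EuclideanHalfSpace 2} (hz : z.1 0 = 0) :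
    boundaryPoint (z.1 1) = z := by
  apply Subtype.ext
  ext i
  fin_cases i <;> simp [boundaryPoint, hz]

theorem chart_symm_boundaryPoint_mem_frontier (a : P ≃ₜ ℂ) (hc : IsClosed D)
    (φ : OpenPartialHomeomorph D (EuclideanHalfSpace 2)) {t : ℝ} (ht : boundaryPoint t ∈ φ.target) :
    (φ.symm (boundaryPoint t)).1 ∈ frontier D := by
  refine (chart_eq_zero_iff a hc φ (φ.map_target ht)).1 ?_
  rw [φ.right_inv ht]
  simp [boundaryPoint]

theorem image_chart_symm_boundaryPoint_mem_nhdsWithin (a : P ≃ₜ ℂ) (hc : IsClosed D)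
    (φ : OpenPartialHomeomorph D (EuclideanHalfSpace 2)) {t : ℝ} (ht : boundaryPoint t ∈ φ.target)
    {V : Set ℝ} (hV : V ∈ 𝓝 t) :
    (fun s => (φ.symm (boundaryPoint s)).1) '' V ∈ 𝓝[frontier D] (φ.symm (boundaryPoint t)).1 := by
  set q := φ.symm (boundaryPoint t)
  have hq : q ∈ φ.source := φ.map_target ht
  have hcont : ContinuousAt (fun z : D => (φ z).1 1) q :=
    (by fun_prop : Continuous fun z : EuclideanHalfSpace 2 => z.1 1).continuousAt.comp
      (φ.continuousAt hq)
  have hqt : (φ q).1 1 = t := by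
    rw [φ.right_inv ht]
    simp [boundaryPoint]
  have hev : {z : D | z ∈ φ.source ∧ (φ z).1 1 ∈ V} ∈ 𝓝 q :=
    Filter.inter_mem (φ.open_source.mem_nhds hq) (hcont (show V ∈ 𝓝 ((φ q).1 1) from hqt.symm ▸ hV))
  have himage : Subtype.val '' {z : D | z ∈ φ.source ∧ (φ z).1 1 ∈ V} ∈ 𝓝[D] q.1 := by
    rw [nhdsWithin_eq_map_subtype_coe q.2]
    exact Filter.image_mem_map hev
  filter_upwards [nhdsWithin_mono q.1 hc.frontier_subset himage, self_mem_nhdsWithin]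
  rintro _ ⟨z, ⟨hz, hzV⟩, rfl⟩ hzf
  refine ⟨_, hzV, ?_⟩
  beta_reduce
  rw [boundaryPoint_eq ((chart_eq_zero_iff a hc φ hz).2 hzf), φ.left_inv hz]

theorem exists_arc_of_mem_frontier (a : P ≃ₜ ℂ) (hc : IsClosed D) (hs : IsSurface D) {p : P}
    (hp : p ∈ frontier D) : ∃ r > 0, ∃ γ : ℝ → P, γ 0 = p ∧ ContinuousOn γ (Ioo (-r) r) ∧
      InjOn γ (Ioo (-r) r) ∧ MapsTo γ (Ioo (-r) r) (frontier D) ∧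
      ∀ t ∈ Ioo (-r) r, ∀ V ∈ 𝓝 t, γ '' V ∈ 𝓝[frontier D] (γ t) := by
  obtain ⟨φ, hφ⟩ := hs.exists_chart ⟨p, hc.frontier_subset hp⟩
  set p' : D := ⟨p, hc.frontier_subset hp⟩
  let k : ℝ → EuclideanHalfSpace 2 := fun t => boundaryPoint ((φ p').1 1 + t)
  have hk : Continuous k := continuous_boundaryPoint.comp (by fun_prop)
  have hk0 : k 0 = φ p' := by
    simpa [k] using boundaryPoint_eq ((chart_eq_zero_iff a hc φ hφ).2 hp)
  obtain ⟨r, hr, hrt⟩ : ∃ r > 0, MapsTo k (Ioo (-r) r) φ.target := by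
    have hnhds : k ⁻¹' φ.target ∈ 𝓝 (0 : ℝ) :=
      (φ.open_target.preimage hk).mem_nhds (by rw [mem_preimage, hk0]; exact φ.map_source hφ)
    obtain ⟨r, hr, hrs⟩ := Metric.mem_nhds_iff.1 hnhds
    exact ⟨r, hr, fun t ht => hrs (by rw [Real.ball_eq_Ioo]; simpa using ht)⟩
  refine ⟨r, hr, fun t => (φ.symm (k t)).1, ?_, ?_, ?_, fun t ht =>
    chart_symm_boundaryPoint_mem_frontier a hc φ (hrt ht), fun t ht V hV => ?_⟩
  · beta_reduce
    rw [hk0, φ.left_inv hφ]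
  · exact continuous_subtype_val.comp_continuousOn (φ.continuousOn_symm.comp hk.continuousOn hrt)
  · intro s hs' t ht h
    have hst := congrArg (fun z : EuclideanHalfSpace 2 => z.1 1)
      (φ.symm.injOn (hrt hs') (hrt ht) (Subtype.ext h))
    simpa [k, boundaryPoint] using hst
  · have himage := image_chart_symm_boundaryPoint_mem_nhdsWithin a hc φ (hrt ht)
      ((Homeomorph.addLeft ((φ p').1 1)).isOpenMap.image_mem_nhds hV)
    rwa [image_image] at himage

theorem mem_closure_interior_of_mem_frontier (a : P ≃ₜ ℂ) (hc : IsClosed D) (hs : IsSurface D)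
    {p : P} (hp : p ∈ frontier D) : p ∈ closure (interior D) := by
  obtain ⟨φ, hφ⟩ := hs.exists_chart ⟨p, hc.frontier_subset hp⟩
  set p' : D := ⟨p, hc.frontier_subset hp⟩
  have h0 : (φ p').1 0 = 0 := (chart_eq_zero_iff a hc φ hφ).2 hp
  let k : ℝ → EuclideanHalfSpace 2 := fun t => ⟨!₂[|t|, (φ p').1 1], by simp⟩
  have hk : Continuous k := by fun_prop
  have hk0 : k 0 = φ p' := by
    apply Subtype.ext
    ext i
    fin_cases i <;> simp [k, h0]
  have htarget : ∀ᶠ t in 𝓝 (0 : ℝ), k t ∈ φ.target :=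
    (φ.open_target.preimage hk).mem_nhds (by rw [mem_preimage, hk0]; exact φ.map_source hφ)
  have hlim : Filter.Tendsto (fun t => (φ.symm (k t)).1) (𝓝[>] (0 : ℝ)) (𝓝 p) := by
    have hcont : ContinuousAt (fun t => (φ.symm (k t)).1) 0 := by
      refine continuous_subtype_val.continuousAt.comp (.comp (g := φ.symm) ?_ hk.continuousAt)
      rw [hk0]
      exact φ.continuousAt_symm (φ.map_source hφ)
    have hvalue : (φ.symm (k 0)).1 = p := by rw [hk0, φ.left_inv hφ]
    exact (hvalue ▸ hcont.tendsto).mono_left nhdsWithin_le_nhds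
  refine mem_closure_of_tendsto hlim ?_
  filter_upwards [self_mem_nhdsWithin, mem_nhdsWithin_of_mem_nhds htarget] with t ht0 htt
  refine mem_interior_of_chart_pos a φ (φ.map_target htt) ?_
  rw [φ.right_inv htt]
  simpa [k] using (ne_of_gt ht0)

end Charts

section Arcs

theorem not_isLocalExtr_of_injOn {X : ℝ → ℝ} {t : ℝ} {V : Set ℝ} (hV : V ∈ 𝓝 t)
    (hc : ContinuousOn X V) (hi : InjOn X V) : ¬ IsLocalExtr X t := by
  intro hext
  obtain ⟨W, hW, hext⟩ : ∃ W ∈ 𝓝 t, (∀ x ∈ W, X t ≤ X x) ∨ ∀ x ∈ W, X x ≤ X t :=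
    hext.elim (fun h => ⟨_, h, Or.inl fun _ => id⟩) fun h => ⟨_, h, Or.inr fun _ => id⟩
  obtain ⟨η, hη, hsub⟩ := Metric.nhds_basis_closedBall.mem_iff.1 (Filter.inter_mem hV hW)
  rw [Real.closedBall_eq_Icc] at hsub
  have hmid : t ∈ Icc (t - η) (t + η) := ⟨by linarith, by linarith⟩
  have hleft : t - η ∈ Icc (t - η) (t + η) := ⟨le_rfl, by linarith⟩
  have hright : t + η ∈ Icc (t - η) (t + η) := ⟨by linarith, le_rfl⟩
  have hVsub : Icc (t - η) (t + η) ⊆ V := fun x hx => (hsub hx).1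
  rcases ContinuousOn.strictMonoOn_of_injOn_Icc' (by linarith) (hc.mono hVsub) (hi.mono hVsub)
    with hmono | hanti <;> rcases hext with hmin | hmax
  · exact (hmono hleft hmid (by linarith)).not_ge (hmin _ (hsub hleft).2)
  · exact (hmono hmid hright (by linarith)).not_ge (hmax _ (hsub hright).2)
  · exact (hanti hmid hright (by linarith)).not_ge (hmin _ (hsub hright).2)
  · exact (hanti hleft hmid (by linarith)).not_ge (hmax _ (hsub hleft).2)

theorem injOn_Icc_of_locally {X : ℝ → ℝ} {a b : ℝ} (hc : ContinuousOn X (Icc a b))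
    (hl : ∀ t ∈ Ioo a b, ∃ V ∈ 𝓝 t, InjOn X V) : InjOn X (Icc a b) := by
  have hne : ∀ x ∈ Icc a b, ∀ y ∈ Icc a b, x < y → X x ≠ X y := by
    intro x hx y hy hxy heq
    obtain ⟨t, ht, hext⟩ := exists_isLocalExtr_Ioo hxy (hc.mono (Icc_subset_Icc hx.1 hy.2)) heq
    have htab : t ∈ Ioo a b := ⟨hx.1.trans_lt ht.1, ht.2.trans_le hy.2⟩
    obtain ⟨V, hV, hVi⟩ := hl t htab
    exact not_isLocalExtr_of_injOn (Filter.inter_mem hV (Icc_mem_nhds htab.1 htab.2))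
      (hc.mono inter_subset_right) (hVi.mono inter_subset_left) hext
  intro x hx y hy h
  rcases lt_trichotomy x y with hxy | hxy | hxy
  · exact absurd h (hne x hx y hy hxy)
  · exact hxy
  · exact absurd h.symm (hne y hy x hx hxy)

theorem continuousOn_invFunOn_of_isCompact {X Y : Type*} [TopologicalSpace X] [Nonempty X]
    [TopologicalSpace Y] [T2Space Y] {K : Set X} (hK : IsCompact K) {f : X → Y}
    (hc : ContinuousOn f K) (hi : InjOn f K) : ContinuousOn (Function.invFunOn f K) (f '' K) := by
  have : CompactSpace K := isCompact_iff_compactSpace.1 hK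
  have hemb : IsEmbedding (K.domRestrict f) :=
    ((continuousOn_iff_continuous_domRestrict.1 hc).isClosedEmbedding
      (injOn_iff_injective.1 hi)).isEmbedding
  let inv : f '' K → K := fun y => ⟨Function.invFunOn f K y, Function.invFunOn_mem y.2⟩
  have hinv : Continuous inv := by
    rw [hemb.continuous_iff]
    exact continuous_subtype_val.congr fun y => (Function.invFunOn_eq y.2).symm
  exact continuousOn_iff_continuous_domRestrict.2 (continuous_subtype_val.comp hinv)

theorem sign_mul_self {s : ℝ} (hs : s = 1 ∨ s = -1) : s * s = 1 := by
  rcases hs with rfl | rfl <;> norm_num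

theorem abs_sign_mul {s : ℝ} (hs : s = 1 ∨ s = -1) (x : ℝ) : |s * x| = |x| := by
  rcases hs with rfl | rfl <;> simp

theorem exists_sign_strictMonoOn {X : ℝ → ℝ} {a b : ℝ} (hab : a ≤ b)
    (hc : ContinuousOn X (Icc a b)) (hi : InjOn X (Icc a b)) :
    ∃ s : ℝ, (s = 1 ∨ s = -1) ∧ StrictMonoOn (fun t => s * (X t - X a)) (Icc a b) := by
  rcases ContinuousOn.strictMonoOn_of_injOn_Icc' hab hc hi with h | h
  · exact ⟨1, Or.inl rfl, fun x hx y hy hxy => by linarith [h hx hy hxy]⟩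
  · exact ⟨-1, Or.inr rfl, fun x hx y hy hxy => by linarith [h hx hy hxy]⟩

theorem exists_graph_of_arc {α : ℝ → ℝ × ℝ} {c d r : ℝ} (hr : 0 < r)
    (hα : ContinuousOn α (Icc 0 r)) (hi : InjOn (fun t => (α t).1) (Icc 0 r)) (h0 : α 0 = (c, d)) :
    ∃ s : ℝ, (s = 1 ∨ s = -1) ∧ ∃ ε > 0, ∃ g : ℝ → ℝ, ContinuousOn g (Ico 0 ε) ∧ g 0 = d ∧
      ∀ x y, |x - c| < ε →
        ((x, y) ∈ α '' Icc 0 r ↔ 0 ≤ s * (x - c) ∧ y = g (s * (x - c))) := by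
  have hX : ContinuousOn (fun t => (α t).1) (Icc 0 r) := continuous_fst.comp_continuousOn hα
  obtain ⟨s, hs, hmono⟩ := exists_sign_strictMonoOn hr.le hX hi
  simp only [h0] at hmono
  set W : ℝ → ℝ := fun t => s * ((α t).1 - c)
  have hW : ContinuousOn W (Icc 0 r) := continuousOn_const.mul (hX.sub continuousOn_const)
  have h0r : (0 : ℝ) ∈ Icc 0 r := left_mem_Icc.2 hr.le
  have hW0 : W 0 = 0 := by simp [W, h0]
  have hWr : 0 < W r := hW0 ▸ hmono h0r (right_mem_Icc.2 hr.le) hr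
  let T := Function.invFunOn W (Icc 0 r)
  have himage : Ico 0 (W r) ⊆ W '' Icc 0 r :=
    Ico_subset_Icc_self.trans (by simpa only [hW0] using intermediate_value_Icc hr.le hW)
  have hT : ContinuousOn T (Ico 0 (W r)) :=
    (continuousOn_invFunOn_of_isCompact isCompact_Icc hW hmono.injOn).mono himage
  have hTmem : ∀ u ∈ Ico 0 (W r), T u ∈ Icc 0 r := fun u hu => Function.invFunOn_mem (himage hu)
  have hWT : ∀ u ∈ Ico 0 (W r), W (T u) = u := fun u hu => Function.invFunOn_eq (himage hu)
  have hTW : ∀ t ∈ Icc 0 r, T (W t) = t := hmono.injOn.leftInvOn_invFunOn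
  refine ⟨s, hs, W r, hWr, fun u => (α (T u)).2,
    continuous_snd.comp_continuousOn (hα.comp hT hTmem), ?_, fun x y hx => ⟨?_, ?_⟩⟩
  · simpa [hW0, h0] using congrArg (fun t => (α t).2) (hTW 0 h0r)
  · rintro ⟨t, ht, hxy⟩
    have hWt : W t = s * (x - c) := by simp only [W, hxy]
    refine ⟨?_, ?_⟩
    · rw [← hWt, ← hW0]
      exact hmono.monotoneOn h0r ht ht.1
    · simp only [← hWt, hTW t ht, hxy]
  · rintro ⟨hpos, rfl⟩
    have hu : s * (x - c) ∈ Ico 0 (W r) :=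
      ⟨hpos, (le_abs_self _).trans_lt ((abs_sign_mul hs _).trans_lt hx)⟩
    refine ⟨_, hTmem _ hu, Prod.ext ?_ rfl⟩
    linear_combination s * hWT _ hu - ((α (T (s * (x - c)))).1 - x) * sign_mul_self hs

theorem exists_forall_abs_sub_lt {k : ℝ → ℝ} {η ρ : ℝ} (hη : 0 < η) (hρ : 0 < ρ)
    (hk : ContinuousOn k (Ico 0 η)) : ∃ ε > 0, ε ≤ η ∧ ∀ u ∈ Ico 0 ε, |k u - k 0| < ρ := by
  obtain ⟨ε, hε, hclose⟩ := Metric.continuousWithinAt_iff.1 (hk 0 ⟨le_rfl, hη⟩) ρ hρ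
  refine ⟨min ε η, lt_min hε hη, min_le_right _ _, fun u hu =>
    hclose ⟨hu.1, hu.2.trans_le (min_le_right _ _)⟩ ?_⟩
  rw [Real.dist_eq, sub_zero, abs_of_nonneg hu.1]
  exact hu.2.trans_le (min_le_left _ _)

end Arcs

/-- The frontier of `A` in the box `|x - c| < ε`, `|y - d| < δ` is the union of two graphs `g`, `h`
over half-open intervals with end `c`, which meet only at `(c, d)`. They are parametrised by the
distances `s * (x - c)` and `t * (x - c)` to the vertical line of `(c, d)`, the signs `s` and `t`
telling on which side of that line they lie. -/
structure IsGraphPair (A : Set (ℝ × ℝ)) (c d s t ε δ : ℝ) (g h : ℝ → ℝ) : Prop where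
  sign_left : s = 1 ∨ s = -1
  sign_right : t = 1 ∨ t = -1
  width_pos : 0 < ε
  height_pos : 0 < δ
  continuousOn_left : ContinuousOn g (Ico 0 ε)
  continuousOn_right : ContinuousOn h (Ico 0 ε)
  left_zero : g 0 = d
  right_zero : h 0 = d
  abs_left_lt : ∀ u ∈ Ico 0 ε, |g u - d| < δ / 2
  abs_right_lt : ∀ u ∈ Ico 0 ε, |h u - d| < δ / 2
  mem_frontier_iff : ∀ x y, |x - c| < ε → |y - d| < δ → ((x, y) ∈ frontier A ↔
    (0 ≤ s * (x - c) ∧ y = g (s * (x - c))) ∨ (0 ≤ t * (x - c) ∧ y = h (t * (x - c))))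
  ne_of_eq : s = t → ∀ u ∈ Ioo 0 ε, g u ≠ h u

section Frontier

variable {A : Set (ℝ × ℝ)} {c d : ℝ}

theorem exists_locally_injective_arc (hc : IsClosed A) (hs : IsSurface A)
    (hp : (c, d) ∈ frontier A)
    (hl : ∀ᶠ q in 𝓝[≠] (c, d), q ∈ frontier A → ∃ U ∈ 𝓝 q, InjOn Prod.fst (frontier A ∩ U)) :
    ∃ r > 0, ∃ γ : ℝ → ℝ × ℝ, γ 0 = (c, d) ∧ ContinuousOn γ (Icc (-r) r) ∧ InjOn γ (Icc (-r) r) ∧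
      MapsTo γ (Icc (-r) r) (frontier A) ∧ γ '' Icc (-r) r ∈ 𝓝[frontier A] (c, d) ∧
      ∀ t ∈ Ioo (-r) r, t ≠ 0 → ∃ V ∈ 𝓝 t, InjOn (fun t => (γ t).1) V := by
  obtain ⟨r, hr, γ, hγ0, hγc, hγi, hγA, hγn⟩ := exists_arc_of_mem_frontier
    Complex.equivRealProdCLM.toHomeomorph.symm hc hs hp
  have h0r : (0 : ℝ) ∈ Ioo (-r) r := ⟨by linarith, hr⟩
  have hγ_at : ∀ {t}, t ∈ Ioo (-r) r → ContinuousAt γ t := fun ht =>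
    hγc.continuousAt (isOpen_Ioo.mem_nhds ht)
  have htendsto : Filter.Tendsto γ (𝓝[≠] 0) (𝓝[≠] (c, d)) := by
    refine tendsto_nhdsWithin_iff.2 ⟨hγ0 ▸ (hγ_at h0r).tendsto.mono_left nhdsWithin_le_nhds, ?_⟩
    filter_upwards [self_mem_nhdsWithin,
      mem_nhdsWithin_of_mem_nhds (isOpen_Ioo.mem_nhds h0r)] with t ht htr h
    exact ht (hγi htr h0r (h.trans hγ0.symm))
  obtain ⟨η, hη, hηl⟩ := Metric.eventually_nhds_iff_ball.1
    (eventually_nhdsWithin_iff.1 (htendsto.eventually hl))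
  set ρ := min η r / 2
  have hmin : 0 < min η r := lt_min hη hr
  have hρη : ρ < η := (half_lt_self hmin).trans_le (min_le_left _ _)
  have hρr : ρ < r := (half_lt_self hmin).trans_le (min_le_right _ _)
  have hsub : Icc (-ρ) ρ ⊆ Ioo (-r) r := Icc_subset_Ioo (neg_lt_neg hρr) hρr
  refine ⟨ρ, half_pos hmin, γ, hγ0, hγc.mono hsub, hγi.mono hsub, hγA.mono_left hsub, ?_,
    fun t ht ht0 => ?_⟩
  · exact hγ0 ▸ hγn 0 h0r _ (Icc_mem_nhds (neg_lt_zero.2 (half_pos hmin)) (half_pos hmin))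
  · have htr : t ∈ Ioo (-r) r := hsub (Ioo_subset_Icc_self ht)
    obtain ⟨U, hU, hUi⟩ := hηl t (by simpa using (abs_lt.2 ht).trans hρη) ht0 (hγA htr)
    refine ⟨Ioo (-r) r ∩ γ ⁻¹' U, Filter.inter_mem (isOpen_Ioo.mem_nhds htr) (hγ_at htr hU),
      fun x hx z hz h => hγi hx.1 hz.1 (hUi ⟨hγA hx.1, hx.2⟩ ⟨hγA hz.1, hz.2⟩ h)⟩

theorem exists_half_arcs (hc : IsClosed A) (hs : IsSurface A) (hp : (c, d) ∈ frontier A)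
    (hl : ∀ᶠ q in 𝓝[≠] (c, d), q ∈ frontier A → ∃ U ∈ 𝓝 q, InjOn Prod.fst (frontier A ∩ U)) :
    ∃ r > 0, ∃ α β : ℝ → ℝ × ℝ, (α 0 = (c, d) ∧ β 0 = (c, d)) ∧
      (ContinuousOn α (Icc 0 r) ∧ ContinuousOn β (Icc 0 r)) ∧
      (InjOn (fun t => (α t).1) (Icc 0 r) ∧ InjOn (fun t => (β t).1) (Icc 0 r)) ∧
      (∀ q ∈ α '' Icc 0 r, q ∈ β '' Icc 0 r → q = (c, d)) ∧
      ∃ δ > 0, ∀ x y, |x - c| < δ → |y - d| < δ →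
        ((x, y) ∈ frontier A ↔ (x, y) ∈ α '' Icc 0 r ∨ (x, y) ∈ β '' Icc 0 r) := by
  obtain ⟨r, hr, γ, hγ0, hγc, hγi, hγA, hγn, hloc⟩ := exists_locally_injective_arc hc hs hp hl
  have hpos : Icc 0 r ⊆ Icc (-r) r := Icc_subset_Icc_left (by linarith)
  have hneg : MapsTo Neg.neg (Icc 0 r) (Icc (-r) r) := fun t ht =>
    ⟨neg_le_neg ht.2, by linarith [ht.1, ht.2]⟩
  have hγ' : ContinuousOn (fun t => γ (-t)) (Icc 0 r) := hγc.comp continuous_neg.continuousOn hneg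
  refine ⟨r, hr, γ, fun t => γ (-t), ⟨hγ0, by simpa using hγ0⟩, ⟨hγc.mono hpos, hγ'⟩, ⟨?_, ?_⟩,
    ?_, ?_⟩
  · exact injOn_Icc_of_locally (continuous_fst.comp_continuousOn (hγc.mono hpos)) fun t ht =>
      hloc t ⟨by linarith [ht.1, ht.2], ht.2⟩ ht.1.ne'
  · refine injOn_Icc_of_locally (continuous_fst.comp_continuousOn hγ') fun t ht => ?_
    obtain ⟨V, hV, hVi⟩ := hloc (-t) ⟨neg_lt_neg ht.2, by linarith [ht.1, ht.2]⟩
      (neg_ne_zero.2 ht.1.ne')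
    exact ⟨_, continuous_neg.continuousAt hV, fun x hx z hz h => neg_injective (hVi hx hz h)⟩
  · rintro _ ⟨t, ht, rfl⟩ ⟨u, hu, hut⟩
    have htu : -u = t := hγi (hneg hu) (hpos ht) hut
    rw [show t = 0 by linarith [ht.1, hu.1], hγ0]
  · obtain ⟨δ, hδ, hball⟩ := Metric.mem_nhdsWithin_iff.1 hγn
    refine ⟨δ, hδ, fun x y hx hy => ⟨fun hxy => ?_, ?_⟩⟩
    · obtain ⟨t, ht, htxy⟩ := hball ⟨max_lt hx hy, hxy⟩
      rcases le_total 0 t with h | h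
      · exact Or.inl ⟨t, ⟨h, ht.2⟩, htxy⟩
      · exact Or.inr ⟨-t, ⟨by linarith, by linarith [ht.1]⟩, by simpa using htxy⟩
    · rintro (⟨t, ht, htxy⟩ | ⟨t, ht, htxy⟩)
      · exact htxy ▸ hγA (hpos ht)
      · exact htxy ▸ hγA (hneg ht)

theorem exists_isGraphPair (hc : IsClosed A) (hs : IsSurface A) (hp : (c, d) ∈ frontier A)
    (hl : ∀ᶠ q in 𝓝[≠] (c, d), q ∈ frontier A → ∃ U ∈ 𝓝 q, InjOn Prod.fst (frontier A ∩ U)) :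
    ∃ s t ε δ : ℝ, ∃ g h : ℝ → ℝ, IsGraphPair A c d s t ε δ g h := by
  obtain ⟨r, hr, α, β, ⟨hα0, hβ0⟩, ⟨hα, hβ⟩, ⟨hαi, hβi⟩, hαβ, δ, hδ, hbox⟩ :=
    exists_half_arcs hc hs hp hl
  obtain ⟨s, hs, ε₁, hε₁, g, hg, hg0, hgα⟩ := exists_graph_of_arc hr hα hαi hα0
  obtain ⟨t, ht, ε₂, hε₂, h, hh, hh0, hhβ⟩ := exists_graph_of_arc hr hβ hβi hβ0
  obtain ⟨ε₃, hε₃, hε₃₁, hgδ⟩ := exists_forall_abs_sub_lt hε₁ (half_pos hδ) hg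
  obtain ⟨ε₄, hε₄, hε₄₂, hhδ⟩ := exists_forall_abs_sub_lt hε₂ (half_pos hδ) hh
  set ε := min δ (min ε₃ ε₄)
  have hεδ : ε ≤ δ := min_le_left _ _
  have hε3 : ε ≤ ε₃ := (min_le_right _ _).trans (min_le_left _ _)
  have hε4 : ε ≤ ε₄ := (min_le_right _ _).trans (min_le_right _ _)
  refine ⟨s, t, ε, δ, g, h, hs, ht, lt_min hδ (lt_min hε₃ hε₄), hδ,
    hg.mono (Ico_subset_Ico_right (hε3.trans hε₃₁)),
    hh.mono (Ico_subset_Ico_right (hε4.trans hε₄₂)), hg0, hh0,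
    fun u hu => hg0 ▸ hgδ u ⟨hu.1, hu.2.trans_le hε3⟩,
    fun u hu => hh0 ▸ hhδ u ⟨hu.1, hu.2.trans_le hε4⟩, fun x y hx hy => ?_, ?_⟩
  · rw [hbox x y (hx.trans_le hεδ) hy, hgα x y (hx.trans_le (hε3.trans hε₃₁)),
      hhβ x y (hx.trans_le (hε4.trans hε₄₂))]
  · rintro rfl u hu heq
    have hu_abs : |c + s * u - c| < ε := by
      rw [add_sub_cancel_left, abs_sign_mul hs, abs_of_pos hu.1]
      exact hu.2
    have hsu : s * (c + s * u - c) = u := by linear_combination u * sign_mul_self hs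
    have hpoint := hαβ (c + s * u, g u)
      ((hgα _ _ (hu_abs.trans_le (hε3.trans hε₃₁))).2 (by rw [hsu]; exact ⟨hu.1.le, rfl⟩))
      ((hhβ _ _ (hu_abs.trans_le (hε4.trans hε₄₂))).2 (by rw [hsu]; exact ⟨hu.1.le, heq⟩))
    have hzero : c + s * u = c := congrArg Prod.fst hpoint
    rw [hzero, sub_self, mul_zero] at hsu
    exact hu.1.ne hsu

theorem exists_injOn_of_notMem_topCriticalSet {P : Type*} [TopologicalSpace P] {π : P → ℝ}
    {C : Set P} {p : P} (hp : p ∈ C) (hp' : p ∉ topCriticalSet π C) :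
    ∃ U ∈ 𝓝 p, InjOn π (C ∩ U) := by
  by_contra hcon
  push Not at hcon
  exact hp' ⟨hp, fun ⟨U, hU, h⟩ => hcon U hU (injOn_iff_injective.2 h.injective)⟩

theorem box_mem_nhds {ε δ : ℝ} (hε : 0 < ε) (hδ : 0 < δ) :
    {q : ℝ × ℝ | |q.1 - c| < ε ∧ |q.2 - d| < δ} ∈ 𝓝 (c, d) :=
  ((isOpen_lt (f := fun q : ℝ × ℝ => |q.1 - c|) (by fun_prop) continuous_const).inter
    (isOpen_lt (f := fun q : ℝ × ℝ => |q.2 - d|) (by fun_prop) continuous_const)).mem_nhds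
    (by simp [hε, hδ])

theorem subset_or_disjoint_of_disjoint_frontier {X : Type*} [TopologicalSpace X] {A R : Set X}
    (hR : IsPreconnected R) (hd : ∀ p ∈ R, p ∉ frontier A) : R ⊆ A ∨ ∀ p ∈ R, p ∉ A := by
  by_contra! hcon
  obtain ⟨hnotsub, p, hp, hpA⟩ := hcon
  obtain ⟨q, hq, hqA⟩ := not_subset.1 hnotsub
  have hcov : R ⊆ interior A ∪ (closure A)ᶜ := fun z hz => by
    by_cases hz' : z ∈ closure A
    · exact Or.inl (by_contra fun h => hd z hz ⟨hz', h⟩)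
    · exact Or.inr hz'
  obtain ⟨z, -, hzi, hzc⟩ := hR _ _ isOpen_interior isClosed_closure.isOpen_compl hcov
    ⟨p, hp, (hcov hp).resolve_right fun h => h (subset_closure hpA)⟩
    ⟨q, hq, (hcov hq).resolve_left fun h => hqA (interior_subset h)⟩
  exact hzc (subset_closure (interior_subset hzi))

/- The surface cannot lie on both sides of its boundary, since then the boundary point would be
interior, nor on neither side, since it is the closure of its interior. -/
theorem mem_iff_notMem_or_mem_iff_notMem (hc : IsClosed A) (hs : IsSurface A) {p : ℝ × ℝ}
    (hp : p ∈ frontier A) {B U V : Set (ℝ × ℝ)} (hB : B ∈ 𝓝 p)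
    (hcov : ∀ q ∈ B, q ∉ frontier A → q ∈ U ∨ q ∈ V)
    (hU : IsPreconnected U) (hV : IsPreconnected V)
    (hUA : ∀ q ∈ U, q ∉ frontier A) (hVA : ∀ q ∈ V, q ∉ frontier A) :
    (∀ q ∈ B, q ∈ A ↔ q ∉ V) ∨ (∀ q ∈ B, q ∈ A ↔ q ∉ U) := by
  have hA : ∀ q ∈ frontier A, q ∈ A := fun q hq => hc.frontier_subset hq
  rcases subset_or_disjoint_of_disjoint_frontier hU hUA with hUin | hUout <;>
    rcases subset_or_disjoint_of_disjoint_frontier hV hVA with hVin | hVout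
  · refine absurd (mem_interior_iff_mem_nhds.2 (Filter.mem_of_superset hB fun q hq => ?_)) hp.2
    by_cases hqA : q ∈ frontier A
    · exact hA q hqA
    · exact (hcov q hq hqA).elim (hUin ·) (hVin ·)
  · refine Or.inl fun q hq => ⟨fun h hqV => hVout q hqV h, fun hqV => ?_⟩
    by_cases hqA : q ∈ frontier A
    · exact hA q hqA
    · exact hUin ((hcov q hq hqA).resolve_right hqV)
  · refine Or.inr fun q hq => ⟨fun h hqU => hUout q hqU h, fun hqU => ?_⟩
    by_cases hqA : q ∈ frontier A
    · exact hA q hqA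
    · exact hVin ((hcov q hq hqA).resolve_left hqU)
  · obtain ⟨q, hq, hqi⟩ := mem_closure_iff_nhds.1 (mem_closure_interior_of_mem_frontier
      Complex.equivRealProdCLM.toHomeomorph.symm hc hs hp) _ hB
    exact ((hcov q hq fun h => h.2 hqi).elim (hUout q) (hVout q) (interior_subset hqi)).elim

theorem isPreconnected_regionBetween {I : Set ℝ} (hI : IsPreconnected I) {l u m : ℝ → ℝ}
    (hm : ContinuousOn m I) (hl : ∀ x ∈ I, l x < m x) (hu : ∀ x ∈ I, m x < u x) :
    IsPreconnected (regionBetween l u I) := by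
  have hgraph : IsPreconnected ((fun x => (x, m x)) '' I) :=
    hI.image _ (continuousOn_id.prodMk hm)
  rcases I.eq_empty_or_nonempty with rfl | ⟨x₀, hx₀⟩
  · simpa [regionBetween] using isPreconnected_empty
  refine isPreconnected_of_forall (x₀, m x₀) fun p hp => ?_
  refine ⟨{p.1} ×ˢ Ioo (l p.1) (u p.1) ∪ (fun x => (x, m x)) '' I, ?_,
    Or.inr (mem_image_of_mem _ hx₀), Or.inl ⟨rfl, hp.2⟩, ?_⟩
  · rintro q (⟨hq, hq'⟩ | ⟨x, hx, rfl⟩)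
    · rw [mem_singleton_iff] at hq
      exact ⟨hq ▸ hp.1, hq ▸ hq'⟩
    · exact ⟨hx, hl x hx, hu x hx⟩
  · exact (isPreconnected_singleton.prod isPreconnected_Ioo).union (p.1, m p.1)
      ⟨rfl, hl _ hp.1, hu _ hp.1⟩ (mem_image_of_mem _ hp.1) hgraph

theorem isPreconnected_abs_sub_lt_inter {s : ℝ} (c ε : ℝ) (J : Set ℝ) (hJ : J.OrdConnected)
    (hs : s = 1 ∨ s = -1) : IsPreconnected {x | |x - c| < ε ∧ s * (x - c) ∈ J} := by
  have himage : {x | |x - c| < ε ∧ s * (x - c) ∈ J} =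
      (fun u => c + s * u) '' (Ioo (-ε) ε ∩ J) := by
    ext x
    constructor
    · rintro ⟨hx, hxJ⟩
      refine ⟨s * (x - c), ⟨abs_lt.1 ((abs_sign_mul hs _).trans_lt hx), hxJ⟩, ?_⟩
      linear_combination (x - c) * sign_mul_self hs
    · rintro ⟨u, ⟨hu, huJ⟩, rfl⟩
      rw [mem_ofPred_eq, add_sub_cancel_left, abs_sign_mul hs, ← mul_assoc, sign_mul_self hs,
        one_mul]
      exact ⟨abs_lt.2 hu, huJ⟩
  rw [himage]
  exact (ordConnected_Ioo.inter hJ).isPreconnected.image _ (by fun_prop)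

theorem isPreconnected_abs_sub_lt (c ε : ℝ) : IsPreconnected {x : ℝ | |x - c| < ε} := by
  simpa using isPreconnected_abs_sub_lt_inter c ε univ ordConnected_univ (Or.inl rfl)

section Strip

variable {ε δ : ℝ} {G : ℝ → ℝ}

theorem isPreconnected_above_graph (hδ : 0 < δ) (hG : ∀ x, |x - c| < ε → |G x - d| < δ / 2) :
    IsPreconnected (regionBetween G (fun _ => d + δ) {x | |x - c| < ε}) :=
  isPreconnected_regionBetween (isPreconnected_abs_sub_lt c ε) (m := fun _ => d + δ / 2)
    continuousOn_const (fun x hx => by linarith [abs_lt.1 (hG x hx)]) fun x _ => by linarith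

theorem isPreconnected_below_graph (hδ : 0 < δ) (hG : ∀ x, |x - c| < ε → |G x - d| < δ / 2) :
    IsPreconnected (regionBetween (fun _ => d - δ) G {x | |x - c| < ε}) :=
  isPreconnected_regionBetween (isPreconnected_abs_sub_lt c ε) (m := fun _ => d - δ / 2)
    continuousOn_const (fun x _ => by linarith) fun x hx => by linarith [abs_lt.1 (hG x hx)]

theorem isPreconnected_outside_graphs {s : ℝ} {G' : ℝ → ℝ} (hs : s = 1 ∨ s = -1) (hε : 0 < ε)
    (hδ : 0 < δ) (hG : ∀ x, |x - c| < ε → |G x - d| < δ / 2)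
    (hG' : ∀ x, |x - c| < ε → |G' x - d| < δ / 2) :
    IsPreconnected {q : ℝ × ℝ | |q.1 - c| < ε ∧ |q.2 - d| < δ ∧
      (s * (q.1 - c) < 0 ∨ q.2 < G q.1 ∨ G' q.1 < q.2)} := by
  set left := regionBetween (fun _ => d - δ) (fun _ => d + δ)
    {x | |x - c| < ε ∧ s * (x - c) ∈ Iio 0} with left_def
  have hleft : IsPreconnected left := isPreconnected_regionBetween
    (isPreconnected_abs_sub_lt_inter c ε _ ordConnected_Iio hs) (m := fun _ => d)
    continuousOn_const (fun _ _ => by linarith) fun _ _ => by linarith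
  set a := c + s * (-(ε / 2))
  have ha : |a - c| < ε := by
    rw [add_sub_cancel_left, abs_sign_mul hs, abs_neg, abs_of_pos (half_pos hε)]
    exact half_lt_self hε
  have hsa : s * (a - c) < 0 := by
    linarith [show s * (a - c) = -(ε / 2) by linear_combination -(ε / 2) * sign_mul_self hs]
  have hleft_mem : ∀ y ∈ Ioo (d - δ) (d + δ), (a, y) ∈ left := fun y hy => ⟨⟨ha, hsa⟩, hy⟩
  have hbelow : (a, d - δ / 2) ∈ regionBetween (fun _ => d - δ) G {x | |x - c| < ε} :=
    ⟨ha, by constructor <;> dsimp only <;> linarith [abs_lt.1 (hG a ha)]⟩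
  have habove : (a, d + δ / 2) ∈ regionBetween G' (fun _ => d + δ) {x | |x - c| < ε} :=
    ⟨ha, by constructor <;> dsimp only <;> linarith [abs_lt.1 (hG' a ha)]⟩
  have hunion := (hleft.union (a, d - δ / 2) (hleft_mem _ ⟨by linarith, by linarith⟩) hbelow
    (isPreconnected_below_graph hδ hG)).union (a, d + δ / 2)
    (Or.inl (hleft_mem _ ⟨by linarith, by linarith⟩)) habove (isPreconnected_above_graph hδ hG')
  convert hunion using 1
  ext ⟨x, y⟩
  simp only [left_def, regionBetween, mem_union, mem_ofPred_eq, mem_Ioo, mem_Iio, abs_lt]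
  constructor
  · rintro ⟨⟨hxl, hxr⟩, ⟨hyl, hyr⟩, hneg | hlt | hlt⟩
    · exact Or.inl (Or.inl ⟨⟨⟨hxl, hxr⟩, hneg⟩, by linarith, by linarith⟩)
    · exact Or.inl (Or.inr ⟨⟨hxl, hxr⟩, by linarith, hlt⟩)
    · exact Or.inr ⟨⟨hxl, hxr⟩, hlt, by linarith⟩
  · rintro ((⟨⟨hx, hneg⟩, hyl, hyr⟩ | ⟨hx, hyl, hlt⟩) | ⟨hx, hlt, hyr⟩)
    · exact ⟨hx, ⟨by linarith, by linarith⟩, Or.inl hneg⟩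
    · exact ⟨hx, ⟨by linarith, by linarith [abs_lt.1 (hG x (abs_lt.2 hx))]⟩, Or.inr (Or.inl hlt)⟩
    · exact ⟨hx, ⟨by linarith [abs_lt.1 (hG' x (abs_lt.2 hx))], by linarith⟩, Or.inr (Or.inr hlt)⟩

theorem above_or_below_of_graph (hc : IsClosed A) (hs : IsSurface A) (hp : (c, d) ∈ frontier A)
    (hε : 0 < ε) (hδ : 0 < δ) (hG : ∀ x, |x - c| < ε → |G x - d| < δ / 2)
    (hf : ∀ x y, |x - c| < ε → |y - d| < δ → ((x, y) ∈ frontier A ↔ y = G x)) :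
    (∀ x y, |x - c| < ε → |y - d| < δ → ((x, y) ∈ A ↔ G x ≤ y)) ∨
    (∀ x y, |x - c| < ε → |y - d| < δ → ((x, y) ∈ A ↔ y ≤ G x)) := by
  refine (mem_iff_notMem_or_mem_iff_notMem hc hs hp (box_mem_nhds hε hδ)
    (U := regionBetween G (fun _ => d + δ) {x | |x - c| < ε})
    (V := regionBetween (fun _ => d - δ) G {x | |x - c| < ε}) ?_
    (isPreconnected_above_graph hδ hG) (isPreconnected_below_graph hδ hG) ?_ ?_).imp ?_ ?_
  · rintro ⟨x, y⟩ ⟨hx, hy⟩ hxy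
    rw [hf x y hx hy] at hxy
    have hy' := abs_lt.1 hy
    exact (Ne.lt_or_gt hxy).symm.imp (⟨hx, ·, by linarith⟩) (⟨hx, by linarith, ·⟩)
  · rintro ⟨x, y⟩ ⟨hx, hlow, hupp⟩ hxy
    have hGx := abs_lt.1 (hG x hx)
    exact hlow.ne' ((hf x y hx (abs_lt.2 ⟨by linarith, by linarith⟩)).1 hxy)
  · rintro ⟨x, y⟩ ⟨hx, hlow, hupp⟩ hxy
    have hGx := abs_lt.1 (hG x hx)
    exact hupp.ne ((hf x y hx (abs_lt.2 ⟨by linarith, by linarith⟩)).1 hxy)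
  · intro h x y hx hy
    rw [h (x, y) ⟨hx, hy⟩, ← not_lt]
    exact not_congr ⟨fun hV => hV.2.2, fun hlt => ⟨hx, by linarith [(abs_lt.1 hy).1], hlt⟩⟩
  · intro h x y hx hy
    rw [h (x, y) ⟨hx, hy⟩, ← not_lt]
    exact not_congr ⟨fun hU => hU.2.1, fun hlt => ⟨hx, hlt, by linarith [(abs_lt.1 hy).2]⟩⟩

theorem notMem_topCriticalSet_of_graph (hε : 0 < ε) (hδ : 0 < δ)
    (hG : ContinuousOn G (Ioo (c - ε) (c + ε)))
    (hf : ∀ x y, |x - c| < ε → |y - d| < δ → ((x, y) ∈ frontier A ↔ y = G x)) :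
    (c, d) ∉ topCriticalSet Prod.fst (frontier A) := by
  intro h
  refine h.2 ⟨_, box_mem_nhds hε hδ, ?_⟩
  set Z := frontier A ∩ {q : ℝ × ℝ | |q.1 - c| < ε ∧ |q.2 - d| < δ}
  have hI : ∀ q : Z, q.1.1 ∈ Ioo (c - ε) (c + ε) := fun q => by
    have := abs_lt.1 q.2.2.1
    constructor <;> linarith
  let f : Z → Ioo (c - ε) (c + ε) := fun q => ⟨q.1.1, hI q⟩
  let k : Ioo (c - ε) (c + ε) → ℝ × ℝ := fun x => (x, G x)
  have hf' : IsEmbedding f := by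
    refine .of_comp (g := k) (by fun_prop)
      (continuous_subtype_val.prodMk (continuousOn_iff_continuous_domRestrict.1 hG)) ?_
    convert IsEmbedding.subtypeVal (p := fun q => q ∈ Z) using 1
    ext1 q
    exact Prod.ext rfl ((hf _ _ q.2.2.1 q.2.2.2).1 q.2.1).symm
  exact IsEmbedding.subtypeVal.comp hf'

end Strip

end Frontier

theorem max_sign_mul_mem_Ico {s x c ε : ℝ} (hs : s = 1 ∨ s = -1) (hx : |x - c| < ε) :
    max 0 (s * (x - c)) ∈ Ico 0 ε :=
  ⟨le_max_left _ _, max_lt ((abs_nonneg _).trans_lt hx)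
    ((le_abs_self _).trans_lt ((abs_sign_mul hs _).trans_lt hx))⟩

namespace IsGraphPair

variable {A : Set (ℝ × ℝ)} {c d s t ε δ : ℝ} {g h : ℝ → ℝ}

theorem symm (H : IsGraphPair A c d s t ε δ g h) : IsGraphPair A c d t s ε δ h g :=
  ⟨H.sign_right, H.sign_left, H.width_pos, H.height_pos, H.continuousOn_right,
    H.continuousOn_left, H.right_zero, H.left_zero, H.abs_right_lt, H.abs_left_lt,
    fun x y hx hy => (H.mem_frontier_iff x y hx hy).trans or_comm,
    fun hts u hu => (H.ne_of_eq hts.symm u hu).symm⟩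

theorem mem_frontier (H : IsGraphPair A c d s t ε δ g h) : (c, d) ∈ frontier A :=
  (H.mem_frontier_iff c d (by simpa using H.width_pos) (by simpa using H.height_pos)).2
    (Or.inl (by simp [H.left_zero]))

theorem exists_graph (H : IsGraphPair A c d s (-s) ε δ g h) :
    ∃ G : ℝ → ℝ, ContinuousOn G (Ioo (c - ε) (c + ε)) ∧
      (∀ x, |x - c| < ε → |G x - d| < δ / 2) ∧
      ∀ x y, |x - c| < ε → |y - d| < δ → ((x, y) ∈ frontier A ↔ y = G x) := by
  let G : ℝ → ℝ := fun x => g (max 0 (s * (x - c))) + h (max 0 (-s * (x - c))) - d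
  have hG_left : ∀ x, 0 ≤ s * (x - c) → G x = g (s * (x - c)) := fun x hx => by
    simp only [G]
    rw [max_eq_right hx, max_eq_left (by linarith), H.right_zero, add_sub_cancel_right]
  have hG_right : ∀ x, 0 ≤ -s * (x - c) → G x = h (-s * (x - c)) := fun x hx => by
    simp only [G]
    rw [max_eq_right hx, max_eq_left (by linarith), H.left_zero, add_sub_cancel_left]
  have hlt : ∀ {s x : ℝ}, (s = 1 ∨ s = -1) → |x - c| < ε → s * (x - c) < ε := fun hs hx =>
    (le_max_right _ _).trans_lt (max_sign_mul_mem_Ico hs hx).2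
  have hI : ∀ {x}, x ∈ Ioo (c - ε) (c + ε) → |x - c| < ε := fun hx =>
    abs_lt.2 ⟨by linarith [hx.1], by linarith [hx.2]⟩
  refine ⟨G, ?_, fun x hx => ?_, fun x y hx hy => ?_⟩
  · exact ((H.continuousOn_left.comp (by fun_prop) fun x hx =>
      max_sign_mul_mem_Ico H.sign_left (hI hx)).add (H.continuousOn_right.comp (by fun_prop)
        fun x hx => max_sign_mul_mem_Ico H.sign_right (hI hx))).sub continuousOn_const
  · rcases le_total 0 (s * (x - c)) with hpos | hneg
    · rw [hG_left x hpos]; exact H.abs_left_lt _ ⟨hpos, hlt H.sign_left hx⟩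
    · have hpos : 0 ≤ -s * (x - c) := by linarith
      rw [hG_right x hpos]; exact H.abs_right_lt _ ⟨hpos, hlt H.sign_right hx⟩
  · rw [H.mem_frontier_iff x y hx hy]
    refine ⟨?_, fun hy => ?_⟩
    · rintro (⟨hpos, hyg⟩ | ⟨hpos, hyh⟩)
      · rw [hG_left x hpos, hyg]
      · rw [hG_right x hpos, hyh]
    · rcases le_total 0 (s * (x - c)) with hpos | hneg
      · exact Or.inl ⟨hpos, hG_left x hpos ▸ hy⟩
      · have hpos : 0 ≤ -s * (x - c) := by linarith
        exact Or.inr ⟨hpos, hG_right x hpos ▸ hy⟩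

theorem le_of_lt (H : IsGraphPair A c d s t ε δ g h) (hgh : ∀ u ∈ Ioo 0 ε, g u < h u) {u : ℝ}
    (hu : u ∈ Ico 0 ε) : g u ≤ h u := by
  rcases hu.1.eq_or_lt with rfl | hpos
  · rw [H.left_zero, H.right_zero]
  · exact (hgh u ⟨hpos, hu.2⟩).le

theorem isPreconnected_between (H : IsGraphPair A c d s s ε δ g h)
    (hgh : ∀ u ∈ Ioo 0 ε, g u < h u) :
    IsPreconnected (regionBetween (fun x => g (s * (x - c))) (fun x => h (s * (x - c)))
      {x | |x - c| < ε ∧ s * (x - c) ∈ Ioi 0}) := by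
  have hmaps : MapsTo (fun x => s * (x - c)) {x | |x - c| < ε ∧ s * (x - c) ∈ Ioi 0} (Ioo 0 ε) :=
    fun x hx => ⟨hx.2, (le_abs_self _).trans_lt ((abs_sign_mul H.sign_left _).trans_lt hx.1)⟩
  have hg : ContinuousOn (fun x => g (s * (x - c))) {x | |x - c| < ε ∧ s * (x - c) ∈ Ioi 0} :=
    (H.continuousOn_left.mono Ioo_subset_Ico_self).comp (by fun_prop) hmaps
  have hh : ContinuousOn (fun x => h (s * (x - c))) {x | |x - c| < ε ∧ s * (x - c) ∈ Ioi 0} :=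
    (H.continuousOn_right.mono Ioo_subset_Ico_self).comp (by fun_prop) hmaps
  exact isPreconnected_regionBetween
    (isPreconnected_abs_sub_lt_inter c ε _ ordConnected_Ioi H.sign_left) ((hg.add hh).div_const 2)
    (fun x hx => left_lt_add_div_two.2 (hgh _ (hmaps hx)))
    fun x hx => add_div_two_lt_right.2 (hgh _ (hmaps hx))

theorem isPreconnected_outside (H : IsGraphPair A c d s s ε δ g h) :
    IsPreconnected {q : ℝ × ℝ | |q.1 - c| < ε ∧ |q.2 - d| < δ ∧ (s * (q.1 - c) < 0 ∨
      q.2 < g (s * (q.1 - c)) ∨ h (s * (q.1 - c)) < q.2)} := by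
  convert isPreconnected_outside_graphs (G := fun x => g (max 0 (s * (x - c))))
    (G' := fun x => h (max 0 (s * (x - c)))) H.sign_left H.width_pos H.height_pos
    (fun x hx => H.abs_left_lt _ (max_sign_mul_mem_Ico H.sign_left hx))
    (fun x hx => H.abs_right_lt _ (max_sign_mul_mem_Ico H.sign_left hx)) using 4 with q
  refine and_congr_right fun _ => or_congr_right' fun hpos => ?_
  rw [max_eq_right (not_lt.1 hpos)]

theorem between_or_outside (H : IsGraphPair A c d s s ε δ g h) {x y : ℝ} (hx : |x - c| < ε)
    (hy : |y - d| < δ) (hxy : (x, y) ∉ frontier A) :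
    (0 < s * (x - c) ∧ g (s * (x - c)) < y ∧ y < h (s * (x - c))) ∨
      (s * (x - c) < 0 ∨ y < g (s * (x - c)) ∨ h (s * (x - c)) < y) := by
  rw [H.mem_frontier_iff x y hx hy] at hxy
  push Not at hxy
  rcases lt_trichotomy (s * (x - c)) 0 with hneg | hzero | hpos
  · exact Or.inr (Or.inl hneg)
  · have hyd : y ≠ d := by simpa only [hzero, H.left_zero] using hxy.1 hzero.ge
    simp only [hzero, H.left_zero, H.right_zero]
    exact Or.inr (Or.inr (Ne.lt_or_gt hyd))
  · rcases (hxy.1 hpos.le).lt_or_gt with hlt | hgt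
    · exact Or.inr (Or.inr (Or.inl hlt))
    · exact (hxy.2 hpos.le).lt_or_gt.imp (⟨hpos, hgt, ·⟩) (Or.inr ∘ Or.inr)

theorem notMem_frontier_of_between (H : IsGraphPair A c d s s ε δ g h) {x y : ℝ}
    (hx : |x - c| < ε) (hpos : 0 < s * (x - c)) (hg : g (s * (x - c)) < y)
    (hh : y < h (s * (x - c))) : (x, y) ∉ frontier A := by
  have hu : s * (x - c) ∈ Ico 0 ε := max_eq_right hpos.le ▸ max_sign_mul_mem_Ico H.sign_left hx
  have hgb := abs_lt.1 (H.abs_left_lt _ hu)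
  have hhb := abs_lt.1 (H.abs_right_lt _ hu)
  rw [H.mem_frontier_iff x y hx (abs_lt.2 ⟨by linarith, by linarith⟩)]
  rintro (⟨-, h⟩ | ⟨-, h⟩) <;> linarith

theorem notMem_frontier_of_outside (H : IsGraphPair A c d s s ε δ g h)
    (hgh : ∀ u ∈ Ioo 0 ε, g u < h u) {x y : ℝ} (hx : |x - c| < ε) (hy : |y - d| < δ)
    (hxy : s * (x - c) < 0 ∨ y < g (s * (x - c)) ∨ h (s * (x - c)) < y) :
    (x, y) ∉ frontier A := by
  rw [H.mem_frontier_iff x y hx hy]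
  intro hmem
  have hnonneg : 0 ≤ s * (x - c) := hmem.elim And.left And.left
  have hle := H.le_of_lt hgh (max_eq_right hnonneg ▸ max_sign_mul_mem_Ico H.sign_left hx)
  rcases hxy with hneg | hlt | hlt <;> rcases hmem with ⟨-, h⟩ | ⟨-, h⟩ <;> linarith

theorem inside_or_outside (H : IsGraphPair A c d s s ε δ g h) (hc : IsClosed A)
    (hA : IsSurface A) (hgh : ∀ u ∈ Ioo 0 ε, g u < h u) :
    (∀ x y, |x - c| < ε → |y - d| < δ → ((x, y) ∈ A ↔
      0 ≤ s * (x - c) ∧ g (s * (x - c)) ≤ y ∧ y ≤ h (s * (x - c)))) ∨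
    (∀ x y, |x - c| < ε → |y - d| < δ → ((x, y) ∈ A ↔
      s * (x - c) < 0 ∨ y ≤ g (s * (x - c)) ∨ h (s * (x - c)) ≤ y)) := by
  refine (mem_iff_notMem_or_mem_iff_notMem hc hA H.mem_frontier
    (box_mem_nhds H.width_pos H.height_pos)
    (U := regionBetween (fun x => g (s * (x - c))) (fun x => h (s * (x - c)))
      {x | |x - c| < ε ∧ s * (x - c) ∈ Ioi 0})
    (V := {q | |q.1 - c| < ε ∧ |q.2 - d| < δ ∧ (s * (q.1 - c) < 0 ∨
      q.2 < g (s * (q.1 - c)) ∨ h (s * (q.1 - c)) < q.2)})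
    (fun q hq hqA => (H.between_or_outside hq.1 hq.2 hqA).imp
      (fun hbetween => ⟨⟨hq.1, hbetween.1⟩, hbetween.2⟩) fun hout => ⟨hq.1, hq.2, hout⟩)
    (H.isPreconnected_between hgh) H.isPreconnected_outside
    (fun q hq => H.notMem_frontier_of_between hq.1.1 hq.1.2 hq.2.1 hq.2.2)
    (fun q hq => H.notMem_frontier_of_outside hgh hq.1 hq.2.1 hq.2.2)).imp ?_ ?_ <;>
    intro hAiff x y hx hy <;> rw [hAiff (x, y) ⟨hx, hy⟩]
  · simp only [mem_ofPred_eq, hx, hy, true_and, not_or, not_lt]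
  · simp only [regionBetween, mem_ofPred_eq, mem_Ioo, mem_Ioi, hx, true_and, not_and_or, not_lt]
    refine ⟨fun hout => ?_, fun hout => hout.imp_left fun hneg => hneg.le⟩
    rcases hout with hle | hout
    · rcases hle.lt_or_eq with hneg | hzero
      · exact Or.inl hneg
      · rw [hzero, H.left_zero, H.right_zero]
        exact Or.inr (le_total y d)
    · exact Or.inr hout

end IsGraphPair

/-! ### Vertical segments and the shape of the domain at critical points -/

/-- The points of `A` at heights `y` and `y'` over `x` are joined by a vertical segment in `A`. -/
def FibreJoined (A : Set (ℝ × ℝ)) (x y y' : ℝ) : Prop :=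
  ∀ z ∈ uIcc y y', (x, z) ∈ A

namespace FibreJoined

variable {A : Set (ℝ × ℝ)} {x y y' : ℝ}

theorem symm (h : FibreJoined A x y y') : FibreJoined A x y' y :=
  fun z hz => h z (uIcc_comm y y' ▸ hz)

theorem left (h : FibreJoined A x y y') : (x, y) ∈ A := h y left_mem_uIcc

theorem refl (h : (x, y) ∈ A) : FibreJoined A x y y := fun z hz => by
  rw [uIcc_self] at hz
  exact hz ▸ h

theorem mono_right (h : FibreJoined A x y y') {z : ℝ} (hz : z ∈ uIcc y y') : FibreJoined A x y z :=
  fun w hw => h w (uIcc_subset_uIcc_left hz hw)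

end FibreJoined

/-- To one side of the vertical line through the boundary point `(c, d)`, and only there, `A` is
near `(c, d)` a union of vertical segments through the graph of `g`. The sign `s` tells on which
side; `g` is parametrised by the distance `s * (x - c)` to the line. -/
structure IsCap (A : Set (ℝ × ℝ)) (c d s ε δ : ℝ) (g : ℝ → ℝ) : Prop where
  sign : s = 1 ∨ s = -1
  width_pos : 0 < ε
  height_pos : 0 < δ
  continuousOn : ContinuousOn g (Ioo 0 ε)
  mem : ∀ u ∈ Ioo 0 ε, (c + s * u, g u) ∈ A
  nonneg : ∀ x y, |x - c| < ε → |y - d| < δ → (x, y) ∈ A → 0 ≤ s * (x - c)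
  eq_of_mem : ∀ y, |y - d| < δ → (c, y) ∈ A → y = d
  fibreJoined : ∀ x y, |x - c| < ε → |y - d| < δ → (x, y) ∈ A →
    FibreJoined A x y (g (s * (x - c)))

/-- The points of `A` at heights `y₁` and `y₂` below and above the boundary point `(c, d)` lie on a
common vertical segment of `A` over `c`, and this segment is cut in two when one moves away from
`c` to the side indicated by the sign `s`. -/
structure IsFork (A : Set (ℝ × ℝ)) (c d s ε y₁ y₂ : ℝ) : Prop where
  sign : s = 1 ∨ s = -1
  width_pos : 0 < ε
  lower_lt : y₁ < d
  lt_upper : d < y₂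
  fibreJoined : FibreJoined A c y₁ y₂
  mem_lower : ∀ x, |x - c| < ε → (x, y₁) ∈ A
  mem_upper : ∀ x, |x - c| < ε → (x, y₂) ∈ A
  not_fibreJoined : ∀ x, |x - c| < ε → 0 < s * (x - c) → ¬ FibreJoined A x y₁ y₂

theorem eq_neg_of_sign_of_ne {s t : ℝ} (hs : s = 1 ∨ s = -1) (ht : t = 1 ∨ t = -1) (hst : s ≠ t) :
    t = -s := by
  rcases hs with rfl | rfl <;> rcases ht with rfl | rfl <;> simp at hst ⊢

namespace IsGraphPair

variable {A : Set (ℝ × ℝ)} {c d s ε δ : ℝ} {g h : ℝ → ℝ}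

theorem eventually_mem_left {t : ℝ} (H : IsGraphPair A c d s t ε δ g h) {U : Set (ℝ × ℝ)}
    (hU : U ∈ 𝓝 (c, d)) : ∀ᶠ u in 𝓝[>] (0 : ℝ), (c + s * u, g u) ∈ frontier A ∩ U := by
  have htendsto : Filter.Tendsto (fun u => (c + s * u, g u)) (𝓝[>] 0) (𝓝 (c, d)) := by
    have hcont : ContinuousWithinAt (fun u => (c + s * u, g u)) (Ico 0 ε) 0 :=
      (by fun_prop : Continuous fun u : ℝ => c + s * u).continuousWithinAt.prodMk
        (H.continuousOn_left 0 ⟨le_rfl, H.width_pos⟩)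
    simpa only [mul_zero, add_zero, H.left_zero, nhdsWithin_Ioo_eq_nhdsGT H.width_pos] using
      hcont.tendsto.mono_left (nhdsWithin_mono _ Ioo_subset_Ico_self)
  filter_upwards [htendsto hU, Ioo_mem_nhdsGT H.width_pos] with u huU hu
  refine ⟨(H.mem_frontier_iff _ _ ?_ ?_).2 (Or.inl ?_), huU⟩
  · rw [add_sub_cancel_left, abs_sign_mul H.sign_left, abs_of_pos hu.1]
    exact hu.2
  · linarith [H.abs_left_lt u ⟨hu.1.le, hu.2⟩, H.height_pos]
  · rw [add_sub_cancel_left, ← mul_assoc, sign_mul_self H.sign_left, one_mul]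
    exact ⟨hu.1.le, rfl⟩

theorem mem_topCriticalSet (H : IsGraphPair A c d s s ε δ g h) :
    (c, d) ∈ topCriticalSet Prod.fst (frontier A) := by
  by_contra hp
  obtain ⟨U, hU, hUinj⟩ := exists_injOn_of_notMem_topCriticalSet H.mem_frontier hp
  obtain ⟨u, ⟨hgU, hhU⟩, hu⟩ := (((H.eventually_mem_left hU).and
    (H.symm.eventually_mem_left hU)).and (Ioo_mem_nhdsGT H.width_pos)).exists
  exact H.ne_of_eq rfl u hu (congrArg Prod.snd (hUinj hgU hhU rfl))

theorem lt_or_gt (H : IsGraphPair A c d s s ε δ g h) :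
    (∀ u ∈ Ioo 0 ε, g u < h u) ∨ ∀ u ∈ Ioo 0 ε, h u < g u := by
  by_contra! hcon
  obtain ⟨⟨u, hu, hle⟩, v, hv, hle'⟩ := hcon
  obtain ⟨w, hw, heq⟩ := isPreconnected_Ioo.intermediate_value₂ hv hu
    (H.continuousOn_left.mono Ioo_subset_Ico_self) (H.continuousOn_right.mono Ioo_subset_Ico_self)
    hle' hle
  exact H.ne_of_eq rfl w hw heq

theorem sign_mul_mem_Ico (H : IsGraphPair A c d s s ε δ g h) {x : ℝ} (hx : |x - c| < ε)
    (hpos : 0 ≤ s * (x - c)) : s * (x - c) ∈ Ico 0 ε :=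
  max_eq_right hpos ▸ max_sign_mul_mem_Ico H.sign_left hx

theorem isCap (H : IsGraphPair A c d s s ε δ g h) (hgh : ∀ u ∈ Ioo 0 ε, g u < h u)
    (hin : ∀ x y, |x - c| < ε → |y - d| < δ → ((x, y) ∈ A ↔
      0 ≤ s * (x - c) ∧ g (s * (x - c)) ≤ y ∧ y ≤ h (s * (x - c)))) :
    IsCap A c d s ε δ g where
  sign := H.sign_left
  width_pos := H.width_pos
  height_pos := H.height_pos
  continuousOn := H.continuousOn_left.mono Ioo_subset_Ico_self
  mem u hu := by
    refine (hin _ _ ?_ ?_).2 ?_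
    · rw [add_sub_cancel_left, abs_sign_mul H.sign_left, abs_of_pos hu.1]
      exact hu.2
    · linarith [H.abs_left_lt u ⟨hu.1.le, hu.2⟩, H.height_pos]
    · rw [add_sub_cancel_left, ← mul_assoc, sign_mul_self H.sign_left, one_mul]
      exact ⟨hu.1.le, le_rfl, (hgh u hu).le⟩
  nonneg x y hx hy hA := ((hin x y hx hy).1 hA).1
  eq_of_mem y hy hA := by
    have hbetween := ((hin c y (by simpa using H.width_pos) hy).1 hA).2
    rw [sub_self, mul_zero, H.left_zero, H.right_zero] at hbetween
    exact hbetween.2.antisymm hbetween.1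
  fibreJoined x y hx hy hA z hz := by
    obtain ⟨hpos, hgy, hyh⟩ := (hin x y hx hy).1 hA
    rw [uIcc_of_ge hgy] at hz
    have hgb := abs_lt.1 (H.abs_left_lt _ (H.sign_mul_mem_Ico hx hpos))
    have hyb := abs_lt.1 hy
    exact (hin x z hx (abs_lt.2 ⟨by linarith [hz.1], by linarith [hz.2]⟩)).2
      ⟨hpos, hz.1, hz.2.trans hyh⟩

theorem isFork (H : IsGraphPair A c d s s ε δ g h) (hgh : ∀ u ∈ Ioo 0 ε, g u < h u)
    (hout : ∀ x y, |x - c| < ε → |y - d| < δ → ((x, y) ∈ A ↔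
      s * (x - c) < 0 ∨ y ≤ g (s * (x - c)) ∨ h (s * (x - c)) ≤ y)) :
    IsFork A c d s ε (d - δ / 2) (d + δ / 2) := by
  have hδ := H.height_pos
  have hbox : ∀ {z}, z ∈ Icc (d - δ / 2) (d + δ / 2) → |z - d| < δ := fun hz =>
    abs_lt.2 ⟨by linarith [hz.1], by linarith [hz.2]⟩
  have hgb := fun {u} hu => abs_lt.1 (H.abs_left_lt u hu)
  have hhb := fun {u} hu => abs_lt.1 (H.abs_right_lt u hu)
  refine ⟨H.sign_left, H.width_pos, by linarith, by linarith, fun z hz => ?_, fun x hx => ?_,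
    fun x hx => ?_, fun x hx hpos hjoined => ?_⟩
  · rw [uIcc_of_le (by linarith)] at hz
    refine (hout c z (by simpa using H.width_pos) (hbox hz)).2 (Or.inr ?_)
    rw [sub_self, mul_zero, H.left_zero, H.right_zero]
    exact le_total z d
  · refine (hout x _ hx (hbox ⟨le_rfl, by linarith⟩)).2 ((lt_or_ge _ 0).imp_right fun hpos => ?_)
    exact Or.inl (by linarith [hgb (H.sign_mul_mem_Ico hx hpos)])
  · refine (hout x _ hx (hbox ⟨by linarith, le_rfl⟩)).2 ((lt_or_ge _ 0).imp_right fun hpos => ?_)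
    exact Or.inr (by linarith [hhb (H.sign_mul_mem_Ico hx hpos)])
  · have hu := H.sign_mul_mem_Ico hx hpos.le
    have hlt := hgh _ ⟨hpos, hu.2⟩
    have hmid : (g (s * (x - c)) + h (s * (x - c))) / 2 ∈ Icc (d - δ / 2) (d + δ / 2) :=
      ⟨by linarith [hgb hu, hhb hu], by linarith [hgb hu, hhb hu]⟩
    rcases (hout x _ hx (hbox hmid)).1 (hjoined _ (by rwa [uIcc_of_le (by linarith)])) with
      hneg | hle | hle <;> linarith

end IsGraphPair

section Shapes

variable {A : Set (ℝ × ℝ)} {c d : ℝ}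

theorem eventually_exists_injOn (hfin : (topCriticalSet Prod.fst (frontier A)).Finite)
    (p : ℝ × ℝ) : ∀ᶠ q in 𝓝[≠] p, q ∈ frontier A → ∃ U ∈ 𝓝 q, InjOn Prod.fst (frontier A ∩ U) := by
  have hev : ∀ᶠ q in 𝓝 p, q ∉ topCriticalSet Prod.fst (frontier A) \ {p} :=
    (hfin.subset sdiff_subset).isClosed.isOpen_compl.mem_nhds fun h => h.2 rfl
  filter_upwards [self_mem_nhdsWithin, mem_nhdsWithin_of_mem_nhds hev] with q hqp hq hqA
  exact exists_injOn_of_notMem_topCriticalSet hqA fun h => hq ⟨h, hqp⟩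

theorem exists_graph_of_notMem (hc : IsClosed A) (hs : IsSurface A)
    (hfin : (topCriticalSet Prod.fst (frontier A)).Finite) (hp : (c, d) ∈ frontier A)
    (hp' : (c, d) ∉ topCriticalSet Prod.fst (frontier A)) :
    ∃ ε > 0, ∃ δ > 0, ∃ G : ℝ → ℝ, G c = d ∧
      ((∀ x y, |x - c| < ε → |y - d| < δ → ((x, y) ∈ A ↔ G x ≤ y)) ∨
       (∀ x y, |x - c| < ε → |y - d| < δ → ((x, y) ∈ A ↔ y ≤ G x))) := by
  obtain ⟨s, t, ε, δ, g, h, H⟩ := exists_isGraphPair hc hs hp (eventually_exists_injOn hfin _)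
  have hε := H.width_pos
  have hδ := H.height_pos
  obtain rfl := eq_neg_of_sign_of_ne H.sign_left H.sign_right fun hst => by
    subst hst
    exact hp' H.mem_topCriticalSet
  obtain ⟨G, -, hGb, hGf⟩ := H.exists_graph
  exact ⟨ε, hε, δ, hδ, G, ((hGf c d (by simpa) (by simpa)).1 hp).symm,
    above_or_below_of_graph hc hs hp hε hδ hGb hGf⟩

theorem exists_isGraphPair_of_mem (hc : IsClosed A) (hs : IsSurface A)
    (hfin : (topCriticalSet Prod.fst (frontier A)).Finite)
    (hp : (c, d) ∈ topCriticalSet Prod.fst (frontier A)) :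
    ∃ s ε δ : ℝ, ∃ g h, IsGraphPair A c d s s ε δ g h ∧ ∀ u ∈ Ioo 0 ε, g u < h u := by
  obtain ⟨s, t, ε, δ, g, h, H⟩ := exists_isGraphPair hc hs hp.1 (eventually_exists_injOn hfin _)
  by_cases hst : s = t
  · subst hst
    exact H.lt_or_gt.elim (⟨s, ε, δ, g, h, H, ·⟩) (⟨s, ε, δ, h, g, H.symm, ·⟩)
  · obtain rfl := eq_neg_of_sign_of_ne H.sign_left H.sign_right hst
    obtain ⟨G, hG, -, hGf⟩ := H.exists_graph
    exact absurd hp (notMem_topCriticalSet_of_graph H.width_pos H.height_pos hG hGf)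

theorem exists_isCap_or_exists_isFork (hc : IsClosed A) (hs : IsSurface A)
    (hfin : (topCriticalSet Prod.fst (frontier A)).Finite)
    (hp : (c, d) ∈ topCriticalSet Prod.fst (frontier A)) :
    (∃ s ε δ g, IsCap A c d s ε δ g) ∨ ∃ s ε y₁ y₂, IsFork A c d s ε y₁ y₂ := by
  obtain ⟨s, ε, δ, g, h, H, hgh⟩ := exists_isGraphPair_of_mem hc hs hfin hp
  exact (H.inside_or_outside hc hs hgh).imp (fun hin => ⟨s, ε, δ, g, H.isCap hgh hin⟩)
    fun hout => ⟨s, ε, _, _, H.isFork hgh hout⟩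

theorem exists_fibreJoined_of_mem_interior (hp : (c, d) ∈ interior A) :
    ∃ δ > 0, ∀ y, |y - d| < δ → FibreJoined A c d y := by
  have hev : ∀ᶠ y in 𝓝 d, (c, y) ∈ A :=
    (by fun_prop : Continuous fun y : ℝ => (c, y)).continuousAt (mem_interior_iff_mem_nhds.1 hp)
  obtain ⟨δ, hδ, hball⟩ := Metric.eventually_nhds_iff_ball.1 hev
  exact ⟨δ, hδ, fun y hy z hz => hball z ((abs_sub_left_of_mem_uIcc hz).trans_lt hy)⟩

theorem exists_fibreJoined_of_mem_topCriticalSet (hc : IsClosed A) (hs : IsSurface A)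
    (hfin : (topCriticalSet Prod.fst (frontier A)).Finite)
    (hp : (c, d) ∈ topCriticalSet Prod.fst (frontier A)) :
    ∃ δ > 0, ∀ y, |y - d| < δ → (c, y) ∈ A → FibreJoined A c d y := by
  rcases exists_isCap_or_exists_isFork hc hs hfin hp with
    ⟨s, ε, δ, g, H⟩ | ⟨s, ε, y₁, y₂, H⟩
  · refine ⟨δ, H.height_pos, fun y hy hA => ?_⟩
    obtain rfl := H.eq_of_mem y hy hA
    exact .refl hA
  · refine ⟨min (d - y₁) (y₂ - d), lt_min (sub_pos.2 H.lower_lt) (sub_pos.2 H.lt_upper),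
      fun y hy _ z hz => H.fibreJoined z ?_⟩
    obtain ⟨hlower, hupper⟩ := lt_min_iff.1 hy
    rw [uIcc_of_le (H.lower_lt.trans H.lt_upper).le]
    refine ordConnected_Icc.uIcc_subset ⟨H.lower_lt.le, H.lt_upper.le⟩ ⟨?_, ?_⟩ hz
    · linarith [neg_abs_le (y - d)]
    · linarith [le_abs_self (y - d)]

theorem exists_fibreJoined_of_mem (hc : IsClosed A) (hs : IsSurface A)
    (hfin : (topCriticalSet Prod.fst (frontier A)).Finite) (hp : (c, d) ∈ A) :
    ∃ δ > 0, ∀ y, |y - d| < δ → (c, y) ∈ A → FibreJoined A c d y := by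
  by_cases hS : (c, d) ∈ topCriticalSet Prod.fst (frontier A)
  · exact exists_fibreJoined_of_mem_topCriticalSet hc hs hfin hS
  by_cases hi : (c, d) ∈ interior A
  · obtain ⟨δ, hδ, hjoined⟩ := exists_fibreJoined_of_mem_interior hi
    exact ⟨δ, hδ, fun y hy _ => hjoined y hy⟩
  obtain ⟨ε, hε, δ, hδ, G, hG, hcase⟩ := exists_graph_of_notMem hc hs hfin
    ⟨subset_closure hp, hi⟩ hS
  have hcc : |c - c| < ε := by simpa
  refine ⟨δ, hδ, fun y hy hA z hz => ?_⟩
  have hzd : |z - d| < δ := (abs_sub_left_of_mem_uIcc hz).trans_lt hy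
  rcases hcase with h | h
  · exact (h c z hcc hzd).2 (ordConnected_Ici.uIcc_subset hG.le ((h c y hcc hy).1 hA) hz)
  · exact (h c z hcc hzd).2 (ordConnected_Iic.uIcc_subset hG.ge ((h c y hcc hy).1 hA) hz)

end Shapes

/-- The vertical segment over `c` between the heights `a` and `b` is a connected component of the
fibre of `A` over `c`. -/
structure IsFibreSegment (A : Set (ℝ × ℝ)) (c a b : ℝ) : Prop where
  le : a ≤ b
  mem : ∀ z ∈ Icc a b, (c, z) ∈ A
  mem_of_fibreJoined : ∀ y ∈ Icc a b, ∀ z, FibreJoined A c y z → z ∈ Icc a b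

theorem exists_isFibreSegment {A : Set (ℝ × ℝ)} {c d : ℝ} (hcpt : IsCompact {y | (c, y) ∈ A})
    (hp : (c, d) ∈ A) : ∃ a b, IsFibreSegment A c a b ∧ d ∈ Icc a b := by
  set F := {y | (c, y) ∈ A}
  set K := connectedComponentIn F d
  have hKF : K ⊆ F := connectedComponentIn_subset _ _
  have hdK : d ∈ K := mem_connectedComponentIn hp
  have hK_closed : IsClosed K := isClosed_of_closure_subset <|
    isPreconnected_connectedComponentIn.closure.subset_connectedComponentIn (subset_closure hdK)
      (hcpt.isClosed.closure_subset_iff.2 hKF)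
  have hK := eq_Icc_of_connected_compact
    ((isConnected_connectedComponentIn_iff (F := F) (x := d)).2 hp)
    (hcpt.of_isClosed_subset hK_closed hKF)
  have hd : d ∈ Icc (sInf K) (sSup K) := hK ▸ hdK
  refine ⟨sInf K, sSup K, ⟨hd.1.trans hd.2, fun z hz => hKF (hK.symm.subset hz),
    fun y hy z hyz => ?_⟩, hd⟩
  rw [← hK] at hy ⊢
  have hsub : uIcc y z ⊆ connectedComponentIn F y :=
    isPreconnected_uIcc.subset_connectedComponentIn left_mem_uIcc fun w hw => hyz w hw
  rw [← connectedComponentIn_eq hy] at hsub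
  exact hsub right_mem_uIcc

theorem exists_forall_mem_of_forall_mem_interior {A : Set (ℝ × ℝ)} {c : ℝ} {K : Set ℝ}
    (hK : IsCompact K) (h : ∀ z ∈ K, (c, z) ∈ interior A) :
    ∃ ε > 0, ∀ x, |x - c| < ε → ∀ z ∈ K, (x, z) ∈ A :=
  Metric.eventually_nhds_iff_ball.1 <| hK.eventually_forall_of_forall_eventually fun z hz =>
    mem_interior_iff_mem_nhds.1 (h z hz)

namespace IsFibreSegment

variable {A : Set (ℝ × ℝ)} {c a b : ℝ}

theorem fibreJoined (H : IsFibreSegment A c a b) {y z : ℝ} (hy : y ∈ Icc a b) (hz : z ∈ Icc a b) :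
    FibreJoined A c y z :=
  fun w hw => H.mem w (ordConnected_Icc.uIcc_subset hy hz hw)

theorem left_mem_frontier (H : IsFibreSegment A c a b) : (c, a) ∈ frontier A := by
  refine ⟨subset_closure (H.mem a (left_mem_Icc.2 H.le)), fun hi => ?_⟩
  obtain ⟨δ, hδ, hjoined⟩ := exists_fibreJoined_of_mem_interior hi
  have := H.mem_of_fibreJoined a (left_mem_Icc.2 H.le) (a - δ / 2)
    (hjoined _ (abs_lt.2 ⟨by linarith, by linarith⟩))
  linarith [this.1]

theorem right_mem_frontier (H : IsFibreSegment A c a b) : (c, b) ∈ frontier A := by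
  refine ⟨subset_closure (H.mem b (right_mem_Icc.2 H.le)), fun hi => ?_⟩
  obtain ⟨δ, hδ, hjoined⟩ := exists_fibreJoined_of_mem_interior hi
  have := H.mem_of_fibreJoined b (right_mem_Icc.2 H.le) (b + δ / 2)
    (hjoined _ (abs_lt.2 ⟨by linarith, by linarith⟩))
  linarith [this.2]

section Noncritical

variable (H : IsFibreSegment A c a b) (hc : IsClosed A) (hs : IsSurface A)
  (hfin : (topCriticalSet Prod.fst (frontier A)).Finite)
  (hno : ∀ z ∈ Icc a b, (c, z) ∉ topCriticalSet Prod.fst (frontier A))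

include H hc hs hfin hno

theorem exists_lower_graph : ∃ ε > 0, ∃ δ > 0, ∃ G : ℝ → ℝ, G c = a ∧
    ∀ x y, |x - c| < ε → |y - a| < δ → ((x, y) ∈ A ↔ G x ≤ y) := by
  obtain ⟨ε, hε, δ, hδ, G, hG, h | h⟩ := exists_graph_of_notMem hc hs hfin H.left_mem_frontier
    (hno a (left_mem_Icc.2 H.le))
  · exact ⟨ε, hε, δ, hδ, G, hG, h⟩
  · have hjoined : FibreJoined A c a (a - δ / 2) := fun z hz => by
      rw [uIcc_of_ge (by linarith)] at hz
      exact (h c z (by simpa) (abs_lt.2 ⟨by linarith [hz.1], by linarith [hz.2]⟩)).2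
        (hG.symm ▸ hz.2)
    linarith [(H.mem_of_fibreJoined a (left_mem_Icc.2 H.le) _ hjoined).1]

theorem exists_upper_graph : ∃ ε > 0, ∃ δ > 0, ∃ G : ℝ → ℝ, G c = b ∧
    ∀ x y, |x - c| < ε → |y - b| < δ → ((x, y) ∈ A ↔ y ≤ G x) := by
  obtain ⟨ε, hε, δ, hδ, G, hG, h | h⟩ := exists_graph_of_notMem hc hs hfin H.right_mem_frontier
    (hno b (right_mem_Icc.2 H.le))
  · have hjoined : FibreJoined A c b (b + δ / 2) := fun z hz => by
      rw [uIcc_of_le (by linarith)] at hz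
      exact (h c z (by simpa) (abs_lt.2 ⟨by linarith [hz.1], by linarith [hz.2]⟩)).2
        (hG.symm ▸ hz.1)
    linarith [(H.mem_of_fibreJoined b (right_mem_Icc.2 H.le) _ hjoined).2]
  · exact ⟨ε, hε, δ, hδ, G, hG, h⟩

theorem lt : a < b := by
  obtain ⟨ε, hε, δ, hδ, G, hG, h⟩ := H.exists_lower_graph hc hs hfin hno
  have hjoined : FibreJoined A c a (a + δ / 2) := fun z hz => by
    rw [uIcc_of_le (by linarith)] at hz
    exact (h c z (by simpa) (abs_lt.2 ⟨by linarith [hz.1], by linarith [hz.2]⟩)).2 (hG.symm ▸ hz.1)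
  linarith [(H.mem_of_fibreJoined a (left_mem_Icc.2 H.le) _ hjoined).2]

theorem mem_interior {z : ℝ} (hz : z ∈ Ioo a b) : (c, z) ∈ interior A := by
  by_contra hzi
  have hzA := H.mem z (Ioo_subset_Icc_self hz)
  obtain ⟨ε, hε, δ, hδ, G, hG, h | h⟩ := exists_graph_of_notMem hc hs hfin
    ⟨subset_closure hzA, hzi⟩ (hno z (Ioo_subset_Icc_self hz))
  · have hlt : max a (z - δ / 2) < z := max_lt hz.1 (by linarith)
    have hle := (h c (max a (z - δ / 2)) (by simpa)
      (abs_lt.2 ⟨by linarith [le_max_right a (z - δ / 2)], by linarith⟩)).1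
      (H.mem _ ⟨le_max_left _ _, (hlt.trans hz.2).le⟩)
    linarith
  · have hlt : z < min b (z + δ / 2) := lt_min hz.2 (by linarith)
    have hle := (h c (min b (z + δ / 2)) (by simpa)
      (abs_lt.2 ⟨by linarith, by linarith [min_le_right b (z + δ / 2)]⟩)).1
      (H.mem _ ⟨(hz.1.trans hlt).le, min_le_left _ _⟩)
    linarith

theorem exists_fibreJoined_from_below {m : ℝ} (hm : m ∈ Ioo a b) : ∃ ε > 0, ∃ δ > 0, ∀ x y,
    |x - c| < ε → a - δ < y → y ≤ m → (x, y) ∈ A → FibreJoined A x y m := by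
  obtain ⟨ε₁, hε₁, δ, hδ, G, -, hG⟩ := H.exists_lower_graph hc hs hfin hno
  obtain ⟨ε₂, hε₂, htube⟩ := exists_forall_mem_of_forall_mem_interior
    (isCompact_Icc (a := a + δ / 2) (b := m)) fun z hz =>
      H.mem_interior hc hs hfin hno ⟨by linarith [hz.1], hz.2.trans_lt hm.2⟩
  refine ⟨min ε₁ ε₂, lt_min hε₁ hε₂, δ, hδ, fun x y hx hy hym hA z hz => ?_⟩
  obtain ⟨hx₁, hx₂⟩ := lt_min_iff.1 hx
  rw [uIcc_of_le hym] at hz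
  rcases le_total (a + δ / 2) z with hza | hza
  · exact htube x hx₂ z ⟨hza, hz.2⟩
  · refine (hG x z hx₁ (abs_lt.2 ⟨by linarith [hz.1], by linarith⟩)).2 (le_trans ?_ hz.1)
    exact (hG x y hx₁ (abs_lt.2 ⟨by linarith, by linarith [hz.1]⟩)).1 hA

theorem exists_fibreJoined_from_above {m : ℝ} (hm : m ∈ Ioo a b) : ∃ ε > 0, ∃ δ > 0, ∀ x y,
    |x - c| < ε → m ≤ y → y < b + δ → (x, y) ∈ A → FibreJoined A x y m := by
  obtain ⟨ε₁, hε₁, δ, hδ, G, -, hG⟩ := H.exists_upper_graph hc hs hfin hno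
  obtain ⟨ε₂, hε₂, htube⟩ := exists_forall_mem_of_forall_mem_interior
    (isCompact_Icc (a := m) (b := b - δ / 2)) fun z hz =>
      H.mem_interior hc hs hfin hno ⟨hm.1.trans_le hz.1, by linarith [hz.2]⟩
  refine ⟨min ε₁ ε₂, lt_min hε₁ hε₂, δ, hδ, fun x y hx hmy hy hA z hz => ?_⟩
  obtain ⟨hx₁, hx₂⟩ := lt_min_iff.1 hx
  rw [uIcc_of_ge hmy] at hz
  rcases le_total z (b - δ / 2) with hzb | hzb
  · exact htube x hx₂ z ⟨hz.1, hzb⟩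
  · refine (hG x z hx₁ (abs_lt.2 ⟨by linarith, by linarith [hz.2]⟩)).2 (hz.2.trans ?_)
    exact (hG x y hx₁ (abs_lt.2 ⟨by linarith [hz.2], by linarith⟩)).1 hA

theorem exists_band : ∃ m ∈ Icc a b, ∃ ε > 0, ∃ W : Set (ℝ × ℝ), IsOpen W ∧
    (∀ z ∈ Icc a b, (c, z) ∈ W) ∧ (∀ x, |x - c| < ε → (x, m) ∈ A) ∧
    ∀ x y, (x, y) ∈ W → (x, y) ∈ A → FibreJoined A x y m := by
  obtain ⟨m, hm⟩ := nonempty_Ioo.2 (H.lt hc hs hfin hno)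
  obtain ⟨ε₁, hε₁, δ₁, hδ₁, hbelow⟩ := H.exists_fibreJoined_from_below hc hs hfin hno hm
  obtain ⟨ε₂, hε₂, δ₂, hδ₂, habove⟩ := H.exists_fibreJoined_from_above hc hs hfin hno hm
  obtain ⟨ε, hε, htube⟩ := exists_forall_mem_of_forall_mem_interior
    (isCompact_singleton (x := m)) fun z hz => hz ▸ H.mem_interior hc hs hfin hno hm
  refine ⟨m, Ioo_subset_Icc_self hm, ε, hε,
    {q | |q.1 - c| < min ε₁ ε₂} ∩ Prod.snd ⁻¹' Ioo (a - δ₁) (b + δ₂), ?_, fun z hz => ?_,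
    fun x hx => htube x hx m rfl, ?_⟩
  · exact (isOpen_lt (f := fun q : ℝ × ℝ => |q.1 - c|) (by fun_prop) continuous_const).inter
      (isOpen_Ioo.preimage continuous_snd)
  · exact ⟨by simp [hε₁, hε₂], by linarith [hz.1], by linarith [hz.2]⟩
  · rintro x y ⟨hx, hy⟩ hA
    obtain ⟨hx₁, hx₂⟩ : |x - c| < ε₁ ∧ |x - c| < ε₂ := lt_min_iff.1 hx
    exact (le_total y m).elim (hbelow x y hx₁ hy.1 · hA) (habove x y hx₂ · hy.2 hA)

end Noncritical

end IsFibreSegment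

/-! ### Graphs composed of sections -/

section Sections

variable {Q : Type*} [TopologicalSpace Q] {f : Q → ℝ} {Y : Set Q}

/-- The connected components of the subset `Y`, as a set of subsets of the ambient space. -/
def components (Y : Set Q) : Set (Set Q) :=
  connectedComponentIn Y '' Y

theorem pairwiseDisjoint_components (Y : Set Q) : (components Y).PairwiseDisjoint id := by
  rintro _ ⟨v, -, rfl⟩ _ ⟨w, -, rfl⟩ hne
  exact disjoint_left.2 fun z hzv hzw =>
    hne ((connectedComponentIn_eq hzv).trans (connectedComponentIn_eq hzw).symm)

theorem sUnion_components (Y : Set Q) : ⋃₀ components Y = Y := by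
  refine Subset.antisymm (sUnion_subset ?_) fun v hv =>
    ⟨_, mem_image_of_mem _ hv, mem_connectedComponentIn hv⟩
  rintro _ ⟨v, -, rfl⟩
  exact connectedComponentIn_subset Y v

/-- `s` is a section of `f` with values in `Y` over the set `J`. -/
structure IsSectionOn (f : Q → ℝ) (Y : Set Q) (s : ℝ → Q) (J : Set ℝ) : Prop where
  continuousOn : ContinuousOn s J
  mapsTo : MapsTo s J Y
  apply : ∀ x ∈ J, f (s x) = x

/-- Locally, `Y` is the image of a section of `f` over an interval. -/
def HasLocalSections (f : Q → ℝ) (Y : Set Q) : Prop :=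
  ∀ v ∈ Y, ∃ ε > 0, ∃ s : ℝ → Q, IsSectionOn f Y s (Ioo (f v - ε) (f v + ε)) ∧ s (f v) = v ∧
    ∃ U ∈ 𝓝 v, ∀ w ∈ Y ∩ U, f w ∈ Ioo (f v - ε) (f v + ε) ∧ s (f w) = w

namespace IsSectionOn

variable {s s' : ℝ → Q} {J J' : Set ℝ}

theorem mono (h : IsSectionOn f Y s J) (hJ : J' ⊆ J) : IsSectionOn f Y s J' :=
  ⟨h.continuousOn.mono hJ, h.mapsTo.mono_left hJ, fun x hx => h.apply x (hJ hx)⟩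

theorem congr (h : IsSectionOn f Y s J) (heq : EqOn s' s J) : IsSectionOn f Y s' J where
  continuousOn := h.continuousOn.congr heq
  mapsTo := h.mapsTo.congr heq.symm
  apply x hx := by rw [heq hx, h.apply x hx]

theorem union (h : IsSectionOn f Y s J) (h' : IsSectionOn f Y s J') (hJ : IsOpen J)
    (hJ' : IsOpen J') : IsSectionOn f Y s (J ∪ J') where
  continuousOn := h.continuousOn.union_of_isOpen h'.continuousOn hJ hJ'
  mapsTo := h.mapsTo.union h'.mapsTo
  apply x hx := hx.elim (h.apply x) (h'.apply x)

theorem mapsTo_connectedComponentIn (h : IsSectionOn f Y s J) (hJ : IsPreconnected J) {x : ℝ}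
    (hx : x ∈ J) : MapsTo s J (connectedComponentIn Y (s x)) :=
  mapsTo_iff_image_subset.2 <| (hJ.image s h.continuousOn).subset_connectedComponentIn
    (mem_image_of_mem s hx) h.mapsTo.image_subset

theorem eqOn [T2Space Q] (hY : HasLocalSections f Y) (hJ : IsPreconnected J)
    (h : IsSectionOn f Y s J) (h' : IsSectionOn f Y s' J) {x₀ : ℝ} (hx₀ : x₀ ∈ J)
    (heq : s x₀ = s' x₀) : EqOn s s' J := by
  have : PreconnectedSpace J := Subtype.preconnectedSpace hJ
  have hs := continuousOn_iff_continuous_domRestrict.1 h.continuousOn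
  have hs' := continuousOn_iff_continuous_domRestrict.1 h'.continuousOn
  have hclopen : IsClopen {x : J | s x = s' x} := by
    refine ⟨isClosed_eq hs hs', isOpen_iff_mem_nhds.2 fun x (hx : s x = s' x) => ?_⟩
    obtain ⟨_, -, k, -, -, U, hU, hk⟩ := hY (s x) (h.mapsTo x.2)
    filter_upwards [hs.continuousAt hU, hs'.continuousAt (hx ▸ hU : U ∈ 𝓝 (s' x))]
      with z hz hz'
    have hkz := (hk _ ⟨h.mapsTo z.2, hz⟩).2
    have hkz' := (hk _ ⟨h'.mapsTo z.2, hz'⟩).2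
    rw [h.apply _ z.2] at hkz
    rw [h'.apply _ z.2] at hkz'
    exact hkz.symm.trans hkz'
  exact fun x hx => (hclopen.eq_univ ⟨⟨x₀, hx₀⟩, heq⟩).symm.subset (mem_univ ⟨x, hx⟩)

end IsSectionOn

/-- `v` and `w` lie on a common section of `f` over an open interval. -/
def SectionRel (f : Q → ℝ) (Y : Set Q) (v w : Q) : Prop :=
  ∃ a b s, IsSectionOn f Y s (Ioo a b) ∧ f v ∈ Ioo a b ∧ f w ∈ Ioo a b ∧ s (f v) = v ∧ s (f w) = w

theorem SectionRel.symm {v w : Q} : SectionRel f Y v w → SectionRel f Y w v := by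
  rintro ⟨a, b, s, hs, hv, hw, hsv, hsw⟩
  exact ⟨a, b, s, hs, hw, hv, hsw, hsv⟩

theorem SectionRel.trans [T2Space Q] (hY : HasLocalSections f Y) {v w u : Q} :
    SectionRel f Y v w → SectionRel f Y w u → SectionRel f Y v u := by
  classical
  rintro ⟨a, b, s, hs, hv, hw, hsv, hsw⟩ ⟨a', b', s', hs', hw', hu, hsw', hsu⟩
  have hcap : IsPreconnected (Ioo a b ∩ Ioo a' b') :=
    (ordConnected_Ioo.inter ordConnected_Ioo).isPreconnected
  have hagree : EqOn s s' (Ioo a b ∩ Ioo a' b') := (hs.mono inter_subset_left).eqOn hY hcap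
    (hs'.mono inter_subset_right) ⟨hw, hw'⟩ (hsw.trans hsw'.symm)
  set k := (Ioo a b).piecewise s s'
  have hk : EqOn k s (Ioo a b) := piecewise_eqOn _ _ _
  have hk' : EqOn k s' (Ioo a' b') := fun x hx => by
    by_cases h : x ∈ Ioo a b
    · rw [hk h, hagree ⟨h, hx⟩]
    · exact piecewise_eq_of_notMem _ _ _ h
  have hglue := (hs.congr hk).union (hs'.congr hk') isOpen_Ioo isOpen_Ioo
  rw [Ioo_union_Ioo' (hw'.1.trans hw.2) (hw.1.trans hw'.2)] at hglue
  exact ⟨_, _, k, hglue, ⟨(min_le_left _ _).trans_lt hv.1, hv.2.trans_le (le_max_left _ _)⟩,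
    ⟨(min_le_right _ _).trans_lt hu.1, hu.2.trans_le (le_max_right _ _)⟩,
    (hk hv).trans hsv, (hk' hu).trans hsu⟩

theorem HasLocalSections.exists_nhds_sectionRel (hY : HasLocalSections f Y) {v : Q} (hv : v ∈ Y) :
    ∃ U ∈ 𝓝 v, ∀ w ∈ Y ∩ U, SectionRel f Y v w := by
  obtain ⟨ε, hε, s, hs, hsv, U, hU, h⟩ := hY v hv
  exact ⟨U, hU, fun w hw => ⟨_, _, s, hs, ⟨by linarith, by linarith⟩, (h w hw).1, hsv, (h w hw).2⟩⟩

theorem mem_connectedComponentIn_iff_sectionRel [T2Space Q] (hY : HasLocalSections f Y) {v w : Q}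
    (hv : v ∈ Y) : w ∈ connectedComponentIn Y v ↔ SectionRel f Y v w := by
  constructor
  · intro hw
    refine isPreconnected_connectedComponentIn.induction₂ (SectionRel f Y) (fun u hu => ?_)
      (fun _ _ _ _ _ _ => SectionRel.trans hY) (fun _ _ _ _ => SectionRel.symm)
      (mem_connectedComponentIn hv) hw
    obtain ⟨U, hU, hrel⟩ := hY.exists_nhds_sectionRel (connectedComponentIn_subset _ _ hu)
    filter_upwards [self_mem_nhdsWithin, mem_nhdsWithin_of_mem_nhds hU] with z hz hzU
    exact hrel z ⟨connectedComponentIn_subset _ _ hz, hzU⟩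
  · rintro ⟨a, b, s, hs, hfv, hfw, hsv, hsw⟩
    have hmem := hs.mapsTo_connectedComponentIn isPreconnected_Ioo hfv hfw
    rwa [hsv, hsw] at hmem

theorem injOn_connectedComponentIn [T2Space Q] (hY : HasLocalSections f Y) {v : Q} (hv : v ∈ Y) :
    InjOn f (connectedComponentIn Y v) := fun u hu w hw h => by
  obtain ⟨a, b, s, -, -, -, hsu, hsw⟩ :=
    ((mem_connectedComponentIn_iff_sectionRel hY hv).1 hu).symm.trans hY
      ((mem_connectedComponentIn_iff_sectionRel hY hv).1 hw)
  rw [← hsu, ← hsw, h]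

theorem exists_nhds_inter_subset_connectedComponentIn [T2Space Q] (hY : HasLocalSections f Y)
    {v : Q} (hv : v ∈ Y) : ∃ U ∈ 𝓝 v, Y ∩ U ⊆ connectedComponentIn Y v := by
  obtain ⟨U, hU, hrel⟩ := hY.exists_nhds_sectionRel hv
  exact ⟨U, hU, fun w hw => (mem_connectedComponentIn_iff_sectionRel hY hv).2 (hrel w hw)⟩

theorem closure_connectedComponentIn_inter_subset [T2Space Q] (hY : HasLocalSections f Y) (v : Q) :
    closure (connectedComponentIn Y v) ∩ Y ⊆ connectedComponentIn Y v := by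
  rintro w ⟨hw, hwY⟩
  obtain ⟨U, hU, hUY⟩ := exists_nhds_inter_subset_connectedComponentIn hY hwY
  obtain ⟨u, huU, hu⟩ := mem_closure_iff_nhds.1 hw U hU
  have huw := hUY ⟨connectedComponentIn_subset _ _ hu, huU⟩
  rw [connectedComponentIn_eq hu, ← connectedComponentIn_eq huw]
  exact mem_connectedComponentIn hwY

theorem exists_isSectionOn_connectedComponentIn (hY : HasLocalSections f Y) {v w : Q}
    (hw : w ∈ connectedComponentIn Y v) :
    ∃ J ∈ 𝓝 (f w), ∃ s, IsSectionOn f (connectedComponentIn Y v) s J := by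
  obtain ⟨ε, hε, s, hs, hsw, -⟩ := hY w (connectedComponentIn_subset _ _ hw)
  have hfw : f w ∈ Ioo (f w - ε) (f w + ε) := ⟨by linarith, by linarith⟩
  have hmaps := hs.mapsTo_connectedComponentIn isPreconnected_Ioo hfw
  rw [hsw, ← connectedComponentIn_eq hw] at hmaps
  exact ⟨_, isOpen_Ioo.mem_nhds hfw, s, hs.continuousOn, hmaps, hs.apply⟩

theorem isOpen_image_connectedComponentIn (hY : HasLocalSections f Y) (v : Q) :
    IsOpen (f '' connectedComponentIn Y v) := by
  refine isOpen_iff_mem_nhds.2 ?_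
  rintro _ ⟨w, hw, rfl⟩
  obtain ⟨J, hJ, s, hs⟩ := exists_isSectionOn_connectedComponentIn hY hw
  exact Filter.mem_of_superset hJ fun x hx => ⟨s x, hs.mapsTo hx, hs.apply x hx⟩

theorem exists_section_connectedComponentIn [T2Space Q] (hY : HasLocalSections f Y) {v : Q}
    (hv : v ∈ Y) :
    ∃ s, IsSectionOn f (connectedComponentIn Y v) s (f '' connectedComponentIn Y v) ∧
      LeftInvOn s f (connectedComponentIn Y v) := by
  have : Nonempty Q := ⟨v⟩
  set E := connectedComponentIn Y v
  have hinv : LeftInvOn (Function.invFunOn f E) f E :=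
    (injOn_connectedComponentIn hY hv).leftInvOn_invFunOn
  refine ⟨_, ⟨?_, fun x hx => Function.invFunOn_mem hx, fun x hx => Function.invFunOn_eq hx⟩, hinv⟩
  rintro _ ⟨w, hw, rfl⟩
  obtain ⟨J, hJ, s, hs⟩ := exists_isSectionOn_connectedComponentIn hY hw
  have heq : EqOn s (Function.invFunOn f E) J := fun x hx => by
    simpa only [hs.apply x hx] using (hinv (hs.mapsTo hx)).symm
  exact ((hs.continuousOn.continuousAt hJ).congr
    (heq.eventuallyEq_of_mem hJ)).continuousWithinAt

theorem mem_connectedComponentIn_of_mem_closure [T2Space Q] (hf : Continuous f)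
    (hY : HasLocalSections f Y) {v u : Q} (hv : v ∈ Y)
    (hu : u ∈ closure (connectedComponentIn Y v)) (hfu : f u ∈ f '' connectedComponentIn Y v) :
    u ∈ connectedComponentIn Y v := by
  obtain ⟨s, hs, hsf⟩ := exists_section_connectedComponentIn hY hv
  have hcont : ContinuousAt (s ∘ f) u := (hs.continuousOn.continuousAt
    ((isOpen_image_connectedComponentIn hY v).mem_nhds hfu)).comp hf.continuousAt
  have : (𝓝[connectedComponentIn Y v] u).NeBot := mem_closure_iff_nhdsWithin_neBot.1 hu
  have hid : Filter.Tendsto (s ∘ f) (𝓝[connectedComponentIn Y v] u) (𝓝 u) :=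
    (Filter.tendsto_id.mono_left nhdsWithin_le_nhds).congr'
      (eventually_nhdsWithin_of_forall fun w hw => (hsf hw).symm)
  rw [tendsto_nhds_unique hid (hcont.tendsto.mono_left nhdsWithin_le_nhds)]
  exact hs.mapsTo hfu

end Sections

section Intervals

theorem closure_diff_subset_pair {J : Set ℝ} (hJ : J.OrdConnected) :
    closure J \ J ⊆ {sInf J, sSup J} := by
  rintro x ⟨hx, hxJ⟩
  have hne : J.Nonempty := closure_nonempty_iff.1 ⟨x, hx⟩
  by_cases hub : x ∈ upperBounds J
  · exact Or.inr ((isLUB_of_mem_closure hub hx).csSup_eq hne).symm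
  have hlb : x ∈ lowerBounds J := fun y hy => by
    by_contra! hyx
    exact hub fun z hz => by_contra fun hxz => hxJ (hJ.out hy hz ⟨hyx.le, (not_le.1 hxz).le⟩)
  exact Or.inl ((isGLB_of_mem_closure hlb hx).csInf_eq hne).symm

theorem encard_closure_diff_le_two {J : Set ℝ} (hJ : J.OrdConnected) :
    (closure J \ J).encard ≤ 2 := by
  refine (encard_le_encard (closure_diff_subset_pair hJ)).trans ((encard_insert_le _ _).trans ?_)
  rw [encard_singleton, one_add_one_eq_two]

theorem notMem_of_isOpen_of_mem_upperBounds {J : Set ℝ} (ho : IsOpen J) {x : ℝ}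
    (hx : x ∈ upperBounds J) : x ∉ J := fun hxJ => by
  obtain ⟨u, hu, hsub⟩ := exists_Ico_subset_of_mem_nhds (ho.mem_nhds hxJ) (exists_gt x)
  obtain ⟨y, hy⟩ := exists_between hu
  exact (hx (hsub ⟨hy.1.le, hy.2⟩)).not_gt hy.1

theorem notMem_of_isOpen_of_mem_lowerBounds {J : Set ℝ} (ho : IsOpen J) {x : ℝ}
    (hx : x ∈ lowerBounds J) : x ∉ J := fun hxJ => by
  obtain ⟨u, hu, hsub⟩ := exists_Ioc_subset_of_mem_nhds (ho.mem_nhds hxJ) (exists_lt x)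
  obtain ⟨y, hy⟩ := exists_between hu
  exact (hx (hsub ⟨hy.1, hy.2.le⟩)).not_gt hy.2

theorem exists_finite_inter_nonempty {K : Set ℝ} (hK : K.Finite) : ∃ T : Set ℝ, T.Finite ∧
    ∀ J : Set ℝ, IsOpen J → J.OrdConnected → J.Nonempty → closure J \ J ⊆ K →
      (J ∩ T).Nonempty := by
  refine ⟨{0} ∪ ((fun k => k + 1) '' K ∪ ((fun k => k - 1) '' K ∪
    (fun p : ℝ × ℝ => (p.1 + p.2) / 2) '' (K ×ˢ K))), ?_, ?_⟩
  · exact (finite_singleton 0).union <|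
      (hK.image _).union ((hK.image _).union ((hK.prod hK).image _))
  intro J ho hc hn hJK
  have hsup (hb : BddAbove J) : sSup J ∉ J :=
    notMem_of_isOpen_of_mem_upperBounds ho fun _ => le_csSup hb
  have hinf (hb : BddBelow J) : sInf J ∉ J :=
    notMem_of_isOpen_of_mem_lowerBounds ho fun _ => csInf_le hb
  have hsupK (hb : BddAbove J) : sSup J ∈ K := hJK ⟨csSup_mem_closure hn hb, hsup hb⟩
  have hinfK (hb : BddBelow J) : sInf J ∈ K := hJK ⟨csInf_mem_closure hn hb, hinf hb⟩
  have hp := hc.isPreconnected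
  by_cases ha : BddAbove J <;> by_cases hb : BddBelow J
  · obtain ⟨x, hx⟩ := hn
    have hlt : sInf J < sSup J := (csInf_le hb hx).trans_lt
      ((le_csSup ha hx).lt_of_ne fun h => hsup ha (h ▸ hx))
    exact ⟨(sInf J + sSup J) / 2, IsConnected.Ioo_csInf_csSup_subset ⟨⟨x, hx⟩, hp⟩ hb ha
      ⟨by linarith, by linarith⟩, Or.inr (Or.inr (Or.inr
        ⟨(sInf J, sSup J), ⟨hinfK hb, hsupK ha⟩, rfl⟩))⟩
  · exact ⟨sSup J - 1, hp.Iio_csSup_subset hb ha (by simp), Or.inr (Or.inr (Or.inl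
      ⟨_, hsupK ha, rfl⟩))⟩
  · exact ⟨sInf J + 1, hp.Ioi_csInf_subset hb ha (by simp), Or.inr (Or.inl ⟨_, hinfK hb, rfl⟩)⟩
  · exact ⟨0, hp.eq_univ_of_unbounded hb ha ▸ mem_univ 0, Or.inl rfl⟩

end Intervals

section Graph

variable {Q : Type*} [TopologicalSpace Q] {f : Q → ℝ} {G V : Set Q}

/-- A closed set `G`, proper with finite fibres over `ℝ` via `f`, which is locally the image of a
section of `f` away from `V`. Together with finiteness of `V ⊆ G`, this is the criterion for a
transversal graph. -/
structure IsSectionalGraph (f : Q → ℝ) (G V : Set Q) : Prop where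
  continuous : Continuous f
  isClosed : IsClosed G
  proper : IsProperMap (G.domRestrict f)
  finite_fibre : ∀ c, (G ∩ f ⁻¹' {c}).Finite
  hasLocalSections : HasLocalSections f (G \ V)

theorem exists_forall_mem_of_fibre_subset (hcl : IsClosedMap (G.domRestrict f)) {c : ℝ} {U : Set Q}
    (hU : IsOpen U) (hfib : G ∩ f ⁻¹' {c} ⊆ U) :
    ∃ ε > 0, ∀ w ∈ G, f w ∈ Metric.ball c ε → w ∈ U := by
  obtain ⟨ε, hε, h⟩ := Metric.eventually_nhds_iff_ball.1 <|
    hcl.eventually_nhds_fiber (p := fun w => w.1 ∈ U) c fun w hw =>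
      (hU.preimage continuous_subtype_val).mem_nhds (hfib ⟨w.2, hw⟩)
  exact ⟨ε, hε, fun w hw hwc => h _ hwc ⟨w, hw⟩ rfl⟩

namespace IsSectionalGraph

theorem connectedComponentIn_subset (H : IsSectionalGraph f G V) (v : Q) :
    closure (connectedComponentIn (G \ V) v) ⊆ G :=
  closure_minimal ((_root_.connectedComponentIn_subset _ _).trans sdiff_subset) H.isClosed

variable [T2Space Q] (H : IsSectionalGraph f G V) {v : Q} (hv : v ∈ G \ V)

include H hv

theorem injOn_closure : InjOn f (closure (connectedComponentIn (G \ V) v)) := by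
  obtain ⟨s, hs, hsE⟩ := exists_section_connectedComponentIn H.hasLocalSections hv
  have hmem {u} := mem_connectedComponentIn_of_mem_closure (u := u) H.continuous
    H.hasLocalSections hv
  have hE := H.connectedComponentIn_subset v
  have hoc := (isPreconnected_connectedComponentIn (F := G \ V) (x := v)).image f
    H.continuous.continuousOn |>.ordConnected
  have hinj := injOn_connectedComponentIn H.hasLocalSections hv
  set E := connectedComponentIn (G \ V) v
  intro u hu u' hu' huu
  by_cases hfu : f u ∈ f '' E
  · exact hinj (hmem hu hfu) (hmem hu' (huu ▸ hfu)) huu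
  by_contra hne
  obtain ⟨U, U', hU, hU', huU, hfU', hd⟩ := SeparatedNhds.of_isCompact_isCompact
    (isCompact_singleton (x := u)) ((H.finite_fibre (f u)).subset
      (sdiff_subset (t := {u}))).isCompact (disjoint_singleton_left.2 fun h => h.2 rfl)
  have hu'U : u' ∈ U' := hfU' ⟨⟨hE hu', huu.symm⟩, fun h => hne h.symm⟩
  obtain ⟨ε, hε, htube⟩ := exists_forall_mem_of_fibre_subset H.proper.isClosedMap (hU.union hU')
    fun w hw => (eq_or_ne w u).imp (fun h => huU h) fun h => hfU' ⟨hw, h⟩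
  have hpre : IsPreconnected (s '' (f '' E ∩ Metric.ball (f u) ε)) := by
    refine IsPreconnected.image ?_ s (hs.continuousOn.mono inter_subset_left)
    rw [Real.ball_eq_Ioo]
    exact (hoc.inter ordConnected_Ioo).isPreconnected
  have hmeet {w O} (hw : w ∈ closure E) (hwu : f w = f u) (hO : IsOpen O) (hwO : w ∈ O) :
      (s '' (f '' E ∩ Metric.ball (f u) ε) ∩ O).Nonempty := by
    obtain ⟨z, ⟨hzO, hz⟩, hzE⟩ := mem_closure_iff.1 hw (O ∩ f ⁻¹' Metric.ball (f u) ε)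
      (hO.inter (Metric.isOpen_ball.preimage H.continuous))
      ⟨hwO, by rw [mem_preimage, hwu]; exact Metric.mem_ball_self hε⟩
    exact ⟨z, ⟨f z, ⟨mem_image_of_mem f hzE, hz⟩, hsE hzE⟩, hzO⟩
  have hcover : s '' (f '' E ∩ Metric.ball (f u) ε) ⊆ U ∪ U' := by
    rintro _ ⟨x, ⟨hx, hxε⟩, rfl⟩
    exact htube _ (hE (subset_closure (hs.mapsTo hx))) (by rwa [hs.apply x hx])
  obtain ⟨z, -, hz, hz'⟩ := hpre U U' hU hU' hcover (hmeet hu rfl hU (huU rfl))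
    (hmeet hu' huu.symm hU' hu'U)
  exact hd.le_bot ⟨hz, hz'⟩

theorem isClosedEmbedding_closure :
    IsClosedEmbedding ((closure (connectedComponentIn (G \ V) v)).domRestrict f) := by
  have hcl := H.connectedComponentIn_subset v
  refine .of_continuous_injective_isClosedMap (H.continuous.comp continuous_subtype_val)
    (injOn_iff_injective.1 (H.injOn_closure hv)) ?_
  have hincl : IsClosedEmbedding (inclusion hcl) := ⟨IsEmbedding.inclusion hcl, by
    rw [range_inclusion]
    exact isClosed_closure.preimage continuous_subtype_val⟩
  exact H.proper.isClosedMap.comp hincl.isClosedMap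

theorem isClosed_image_closure : IsClosed (f '' closure (connectedComponentIn (G \ V) v)) :=
  range_domRestrict f (closure (connectedComponentIn (G \ V) v)) ▸
    (H.isClosedEmbedding_closure hv).isClosed_range

theorem image_closure_diff :
    f '' (closure (connectedComponentIn (G \ V) v) \ connectedComponentIn (G \ V) v) =
      closure (f '' connectedComponentIn (G \ V) v) \ f '' connectedComponentIn (G \ V) v := by
  rw [InjOn.image_sdiff_subset (H.injOn_closure hv) subset_closure,
    (image_closure_subset_closure_image H.continuous).antisymm
      (closure_minimal (image_mono subset_closure) (H.isClosed_image_closure hv))]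

theorem encard_closure_diff_le_two :
    (closure (connectedComponentIn (G \ V) v) \ connectedComponentIn (G \ V) v).encard ≤ 2 := by
  rw [← ((H.injOn_closure hv).mono sdiff_subset).encard_image, H.image_closure_diff hv]
  exact PoincareReeb.encard_closure_diff_le_two (isPreconnected_connectedComponentIn.image f
    H.continuous.continuousOn).ordConnected

theorem isOpenSegment : IsOpenSegment (connectedComponentIn (G \ V) v) := by
  have hemb : IsEmbedding ((connectedComponentIn (G \ V) v).domRestrict f) :=
    (H.isClosedEmbedding_closure hv).isEmbedding.comp (IsEmbedding.inclusion subset_closure)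
  exact ⟨_, isOpen_image_connectedComponentIn H.hasLocalSections v,
    (isPreconnected_connectedComponentIn.image f H.continuous.continuousOn).ordConnected,
    ⟨f v, v, mem_connectedComponentIn hv, rfl⟩,
    ⟨hemb.toHomeomorph.trans (Homeomorph.setCongr (range_domRestrict _ _))⟩⟩

theorem isClosedSegment_closure : IsClosedSegment (closure (connectedComponentIn (G \ V) v)) := by
  have hnhds := (isOpen_image_connectedComponentIn H.hasLocalSections v).mem_nhds
    (mem_image_of_mem f (mem_connectedComponentIn hv))
  exact ⟨_, H.isClosed_image_closure hv,
    (isPreconnected_connectedComponentIn.closure.image f H.continuous.continuousOn).ordConnected,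
    (infinite_of_mem_nhds _ hnhds).nontrivial.mono (image_mono subset_closure),
    ⟨(H.isClosedEmbedding_closure hv).isEmbedding.toHomeomorph.trans
      (Homeomorph.setCongr (range_domRestrict _ _))⟩⟩

omit hv

theorem closure_diff_subset (v : Q) :
    closure (connectedComponentIn (G \ V) v) \ connectedComponentIn (G \ V) v ⊆ V :=
  fun _ hw => by_contra fun hwV => hw.2 (closure_connectedComponentIn_inter_subset
    H.hasLocalSections v ⟨hw.1, H.connectedComponentIn_subset v hw.1, hwV⟩)

/- An edge projects injectively, so it stays strictly on one side of the fibre through an end. -/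
theorem notMem_uIcc_of_mem_closure {v u u' w : Q} (hu : u ∈ connectedComponentIn (G \ V) v)
    (hu' : u' ∈ connectedComponentIn (G \ V) v)
    (hw : w ∈ closure (connectedComponentIn (G \ V) v)) (hwV : w ∈ V) :
    f w ∉ uIcc (f u) (f u') := by
  intro hfw
  have hv : v ∈ G \ V := connectedComponentIn_nonempty_iff.1 ⟨u, hu⟩
  obtain ⟨z, hz, hzw⟩ := (isPreconnected_connectedComponentIn.image f
    H.continuous.continuousOn).ordConnected.uIcc_subset (mem_image_of_mem f hu)
    (mem_image_of_mem f hu') hfw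
  obtain rfl := H.injOn_closure hv (subset_closure hz) hw hzw
  exact (_root_.connectedComponentIn_subset _ _ hz).2 hwV

theorem finite_components (hV : V.Finite) : (components (G \ V)).Finite := by
  obtain ⟨T, hT, hmeet⟩ := exists_finite_inter_nonempty (hV.image f)
  refine ((hT.biUnion fun t _ => H.finite_fibre t).image (connectedComponentIn (G \ V))).subset ?_
  rintro _ ⟨v, hv, rfl⟩
  obtain ⟨_, ⟨w, hw, rfl⟩, ht⟩ := hmeet _ (isOpen_image_connectedComponentIn H.hasLocalSections v)
    (isPreconnected_connectedComponentIn.image f H.continuous.continuousOn).ordConnected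
    ⟨f v, v, mem_connectedComponentIn hv, rfl⟩
    (H.image_closure_diff hv ▸ image_mono (H.closure_diff_subset v))
  exact ⟨w, mem_biUnion ht ⟨H.connectedComponentIn_subset v (subset_closure hw), rfl⟩,
    (connectedComponentIn_eq hw).symm⟩

theorem isTransversalGraph (hV : V.Finite) (hVG : V ⊆ G) :
    IsTransversalGraph f G V (components (G \ V)) where
  isClosed := H.isClosed
  finite_vertices := hV
  finite_openEdges := H.finite_components hV
  union_eq := by rw [sUnion_components, union_sdiff_cancel hVG]
  openEdges_disjoint := pairwiseDisjoint_components _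
  disjoint_vertices e he := disjoint_left.2 fun _ hw =>
    ((sUnion_components (G \ V)).subset (mem_sUnion_of_mem hw he)).2
  openEdge_segment := forall_mem_image.2 fun _ hv => H.isOpenSegment hv
  edge_segment := forall_mem_image.2 fun _ hv => H.isClosedSegment_closure hv
  ends_subset := forall_mem_image.2 fun v _ => H.closure_diff_subset v
  ends_card := forall_mem_image.2 fun _ hv => H.encard_closure_diff_le_two hv
  transversal := forall_mem_image.2 fun _ hv => (H.isClosedEmbedding_closure hv).isEmbedding
  proper := H.proper

end IsSectionalGraph

end Graph

/-! ### The collapse in coordinates -/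

section Transport

variable {P Q : Type*} [TopologicalSpace P] [TopologicalSpace Q]

theorem IsSurface.of_homeomorph (h : P ≃ₜ Q) (hP : IsSurface P) : IsSurface Q where
  t2 := haveI := hP.t2; h.t2Space
  secondCountable := haveI := hP.secondCountable; h.symm.secondCountableTopology
  exists_chart x := by
    obtain ⟨φ, hφ⟩ := hP.exists_chart (h.symm x)
    exact ⟨h.symm.toOpenPartialHomeomorph.trans φ, by simpa using hφ⟩

theorem subset_preimage_topCriticalSet (e : P ≃ₜ Q) {f : P → ℝ} {g : Q → ℝ}
    (h : ∀ p, g (e p) = f p) (C : Set Q) :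
    topCriticalSet f (e ⁻¹' C) ⊆ e ⁻¹' topCriticalSet g C := by
  rintro p ⟨hp, hp'⟩
  refine ⟨hp, fun ⟨U, hU, hUe⟩ => hp' ⟨e ⁻¹' U, e.continuous.continuousAt hU, ?_⟩⟩
  have hmaps : MapsTo e (e ⁻¹' C ∩ e ⁻¹' U) (C ∩ U) := fun x hx => hx
  convert hUe.comp (e.isEmbedding.restrict hmaps) using 1
  funext x
  exact (h x).symm

theorem preimage_topCriticalSet (e : P ≃ₜ Q) {f : P → ℝ} {g : Q → ℝ} (h : ∀ p, g (e p) = f p)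
    (C : Set Q) : e ⁻¹' topCriticalSet g C = topCriticalSet f (e ⁻¹' C) := by
  refine Subset.antisymm (fun p hp => ?_) (subset_preimage_topCriticalSet e h C)
  have hsub := subset_preimage_topCriticalSet e.symm (f := g) (g := f)
    (fun q => by rw [← h, e.apply_symm_apply]) (e ⁻¹' C)
  rw [← preimage_comp, e.self_comp_symm, preimage_id_eq, id] at hsub
  simpa using hsub hp

end Transport

section Planar

variable {A : Set (ℝ × ℝ)}

theorem countable_frontier_fibre (hfin : (topCriticalSet Prod.fst (frontier A)).Finite) (x : ℝ) :
    {y | (x, y) ∈ frontier A}.Countable := by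
  set T : Set ℝ := {y | (x, y) ∈ frontier A ∧ (x, y) ∉ topCriticalSet Prod.fst (frontier A)}
  have hdiscrete : DiscreteTopology T := by
    rw [discreteTopology_subtype_iff]
    intro y hy
    obtain ⟨U, hU, hinj⟩ := exists_injOn_of_notMem_topCriticalSet hy.1 hy.2
    have hmem : ∀ᶠ z in 𝓝 y, (x, z) ∈ U :=
      (by fun_prop : Continuous fun z : ℝ => (x, z)).continuousAt hU
    refine Filter.eventually_false_iff_eq_bot.1 ?_
    rw [Filter.eventually_inf_principal]
    filter_upwards [mem_nhdsWithin_of_mem_nhds hmem, self_mem_nhdsWithin] with z hz hne hzT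
    exact hne (congrArg Prod.snd
      (hinj ⟨hzT.1, hz⟩ ⟨hy.1, mem_of_mem_nhds hU⟩ rfl : (x, z) = (x, y)))
  have hT : T.Countable :=
    countable_coe_iff.1 (TopologicalSpace.separableSpace_iff_countable.1 inferInstance)
  have hcrit : {y | (x, y) ∈ topCriticalSet Prod.fst (frontier A)}.Finite :=
    hfin.preimage (f := fun y => (x, y)) fun a _ b _ h => congrArg Prod.snd h
  exact (hT.union hcrit.countable).mono fun y hy =>
    (em ((x, y) ∈ topCriticalSet Prod.fst (frontier A))).elim Or.inr fun h => Or.inl ⟨hy, h⟩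

theorem exists_abs_snd_le {K : Set ℝ} (hK : IsCompact (A ∩ Prod.fst ⁻¹' K)) :
    ∃ M, 0 ≤ M ∧ ∀ x ∈ K, ∀ y, (x, y) ∈ A → |y| ≤ M := by
  obtain ⟨R, hR⟩ := hK.isBounded.subset_closedBall 0
  refine ⟨|R|, abs_nonneg R, fun x hx y hy => ?_⟩
  have hnorm := mem_closedBall_zero_iff.1 (hR ⟨hy, hx⟩)
  rw [Prod.norm_def, max_le_iff] at hnorm
  exact hnorm.2.trans (le_abs_self R)

end Planar

section Height

variable {A : Set (ℝ × ℝ)} {x y y' : ℝ}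

/-- The signed length of the part of the vertical segment from `(x, 0)` to `(x, y)` that lies
outside `A`. -/
noncomputable def outerHeight (A : Set (ℝ × ℝ)) (x y : ℝ) : ℝ :=
  ∫ t in (0 : ℝ)..y, Aᶜ.indicator (fun _ => (1 : ℝ)) (x, t)

theorem intervalIntegrable_indicator_compl (hA : IsClosed A) (x a b : ℝ) :
    IntervalIntegrable (fun t => Aᶜ.indicator (fun _ => (1 : ℝ)) (x, t))
      MeasureTheory.volume a b := by
  refine (intervalIntegrable_const (c := (1 : ℝ))).mono_fun ?_ ?_
  · exact ((measurable_const.indicator hA.isOpen_compl.measurableSet).comp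
      measurable_prodMk_left).aestronglyMeasurable
  · exact Filter.Eventually.of_forall fun t => by
      by_cases h : (x, t) ∈ Aᶜ <;> simp [h]

theorem outerHeight_sub (hA : IsClosed A) (x y y' : ℝ) :
    outerHeight A x y' - outerHeight A x y =
      ∫ t in y..y', Aᶜ.indicator (fun _ => (1 : ℝ)) (x, t) :=
  intervalIntegral.integral_interval_sub_left (intervalIntegrable_indicator_compl hA x 0 y')
    (intervalIntegrable_indicator_compl hA x 0 y)

theorem outerHeight_zero (x : ℝ) : outerHeight A x 0 = 0 := intervalIntegral.integral_same

theorem monotone_outerHeight (hA : IsClosed A) (x : ℝ) : Monotone (outerHeight A x) := by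
  intro y y' h
  rw [← sub_nonneg, outerHeight_sub hA]
  exact intervalIntegral.integral_nonneg h fun t _ => indicator_nonneg (fun _ _ => zero_le_one) _

theorem lipschitzWith_outerHeight (hA : IsClosed A) (x : ℝ) :
    LipschitzWith 1 (outerHeight A x) := by
  refine LipschitzWith.of_dist_le_mul fun y y' => ?_
  rw [dist_comm, dist_comm y, Real.dist_eq, Real.dist_eq, outerHeight_sub hA, NNReal.coe_one,
    ← Real.norm_eq_abs]
  refine intervalIntegral.norm_integral_le_of_norm_le_const fun t _ => ?_
  by_cases h : (x, t) ∈ Aᶜ <;> simp [h]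

theorem continuousAt_indicator_compl (hA : IsClosed A) {t : ℝ} (h : (x, t) ∉ frontier A) :
    ContinuousAt (fun x => Aᶜ.indicator (fun _ => (1 : ℝ)) (x, t)) x := by
  have hcont : ContinuousAt (fun x => (x, t)) x := by fun_prop
  have hcases : (x, t) ∈ interior A ∨ (x, t) ∈ Aᶜ := by
    by_contra! hA'
    exact h ⟨subset_closure (not_notMem.1 hA'.2), hA'.1⟩
  rcases hcases with hinside | houtside
  · refine (continuousAt_const (y := (0 : ℝ))).congr ?_
    filter_upwards [hcont (isOpen_interior.mem_nhds hinside)] with z hz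
    exact (indicator_of_notMem (not_not.2 (interior_subset hz)) _).symm
  · refine (continuousAt_const (y := (1 : ℝ))).congr ?_
    filter_upwards [hcont (hA.isOpen_compl.mem_nhds houtside)] with z hz
    exact (indicator_of_mem (s := Aᶜ) hz (fun _ => (1 : ℝ))).symm

/- Dominated convergence: for fixed `t` the integrand is continuous in `x` away from the frontier
of `A`, which meets each vertical line in a null set. -/
theorem continuous_outerHeight (hA : IsClosed A)
    (hnull : ∀ x, {y | (x, y) ∈ frontier A}.Countable) :
    Continuous fun p : ℝ × ℝ => outerHeight A p.1 p.2 := by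
  refine continuous_prod_of_continuous_lipschitzWith' (fun p : ℝ × ℝ => outerHeight A p.1 p.2) 1
    (fun x => lipschitzWith_outerHeight hA x) (fun y => ?_)
  refine continuous_iff_continuousAt.2 fun x => ?_
  refine intervalIntegral.continuousAt_of_dominated_interval (bound := fun _ => 1)
    (Filter.Eventually.of_forall fun x => ?_) (Filter.Eventually.of_forall fun x => ?_)
    intervalIntegrable_const ?_
  · exact ((measurable_const.indicator hA.isOpen_compl.measurableSet).comp
      measurable_prodMk_left).aestronglyMeasurable
  · exact Filter.Eventually.of_forall fun t _ => by
      by_cases h : (x, t) ∈ Aᶜ <;> simp [h]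
  · filter_upwards [(hnull x).ae_notMem MeasureTheory.volume] with t ht _
    exact continuousAt_indicator_compl hA ht

theorem outerHeight_sub_of_forall_notMem (hA : IsClosed A) (h : ∀ z ∈ Ioo y y', (x, z) ∉ A)
    (hy : y ≤ y') : outerHeight A x y' - outerHeight A x y = y' - y :=
  calc outerHeight A x y' - outerHeight A x y
      = ∫ t in y..y', Aᶜ.indicator (fun _ => (1 : ℝ)) (x, t) := outerHeight_sub hA x y y'
    _ = ∫ _ in y..y', (1 : ℝ) := by
        rw [intervalIntegral.integral_of_le hy, intervalIntegral.integral_of_le hy,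
          MeasureTheory.integral_Ioc_eq_integral_Ioo, MeasureTheory.integral_Ioc_eq_integral_Ioo]
        exact MeasureTheory.setIntegral_congr_fun measurableSet_Ioo fun t ht =>
          indicator_of_mem (s := Aᶜ) (h t ht) (fun _ => (1 : ℝ))
    _ = y' - y := by simp

theorem outerHeight_lt_outerHeight (hA : IsClosed A) (hlt : y < y')
    (h : ¬ FibreJoined A x y y') : outerHeight A x y < outerHeight A x y' := by
  obtain ⟨z, hz, hzA⟩ : ∃ z ∈ uIcc y y', (x, z) ∉ A := by
    by_contra! hmem
    exact h hmem
  rw [uIcc_of_le hlt.le, ← closure_Ioo hlt.ne] at hz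
  have hopen : IsOpen {t | (x, t) ∉ A} :=
    hA.isOpen_compl.preimage (by fun_prop : Continuous fun t : ℝ => (x, t))
  obtain ⟨w, hwA, hw⟩ := mem_closure_iff.1 hz _ hopen hzA
  obtain ⟨a, b, hab, hsub⟩ := mem_nhds_iff_exists_Ioo_subset.1
    ((hopen.inter isOpen_Ioo).mem_nhds ⟨hwA, hw⟩)
  have hlt' : a < b := hab.1.trans hab.2
  have hIcc : Icc a b ⊆ Icc y y' := by
    rw [← closure_Ioo hlt'.ne, ← closure_Ioo hlt.ne]
    exact closure_mono fun t ht => (hsub ht).2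
  have hmono := monotone_outerHeight hA x
  calc outerHeight A x y ≤ outerHeight A x a := hmono (hIcc (left_mem_Icc.2 hlt'.le)).1
    _ < outerHeight A x b := by
        linarith [outerHeight_sub_of_forall_notMem hA (fun t ht => (hsub ht).1) hlt'.le]
    _ ≤ outerHeight A x y' := hmono (hIcc (right_mem_Icc.2 hlt'.le)).2

theorem FibreJoined.outerHeight_eq (hA : IsClosed A) (h : FibreJoined A x y y') :
    outerHeight A x y = outerHeight A x y' := by
  rw [eq_comm, ← sub_eq_zero, outerHeight_sub hA,
    intervalIntegral.integral_congr (g := fun _ => (0 : ℝ))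
      fun t ht => indicator_of_notMem (not_not.2 (h t ht)) _,
    intervalIntegral.integral_zero]

theorem outerHeight_eq_iff (hA : IsClosed A) :
    outerHeight A x y = outerHeight A x y' ↔ y = y' ∨ FibreJoined A x y y' := by
  refine ⟨fun heq => ?_, ?_⟩
  · rcases lt_trichotomy y y' with hlt | rfl | hlt
    · by_contra! hne
      exact (outerHeight_lt_outerHeight hA hlt hne.2).ne heq
    · exact Or.inl rfl
    · by_contra! hne
      exact (outerHeight_lt_outerHeight hA hlt fun hj => hne.2 hj.symm).ne' heq
  · rintro (rfl | hj)
    exacts [rfl, hj.outerHeight_eq hA]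

theorem le_outerHeight (hA : IsClosed A) {M : ℝ} (hM : 0 ≤ M) (h : ∀ z, (x, z) ∈ A → |z| ≤ M)
    (hy : M ≤ y) : y - M ≤ outerHeight A x y := by
  have hsub := outerHeight_sub_of_forall_notMem (x := x) hA
    (fun z hz hzA => absurd (h z hzA) (not_le.2 (hz.1.trans_le (le_abs_self z)))) hy
  have hmono := monotone_outerHeight hA x hM
  rw [outerHeight_zero] at hmono
  linarith

theorem outerHeight_le (hA : IsClosed A) {M : ℝ} (hM : 0 ≤ M) (h : ∀ z, (x, z) ∈ A → |z| ≤ M)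
    (hy : y ≤ -M) : outerHeight A x y ≤ y + M := by
  have hsub := outerHeight_sub_of_forall_notMem (x := x) hA (fun z hz hzA =>
    absurd (h z hzA) (not_le.2 ((lt_neg_of_lt_neg hz.2).trans_le (neg_le_abs z)))) hy
  have hmono := monotone_outerHeight hA x (neg_nonpos.2 hM)
  rw [outerHeight_zero] at hmono
  linarith

theorem abs_le_add_abs_outerHeight (hA : IsClosed A) {M : ℝ} (hM : 0 ≤ M)
    (h : ∀ z, (x, z) ∈ A → |z| ≤ M) (y : ℝ) : |y| ≤ M + |outerHeight A x y| := by
  refine abs_le.2 ⟨?_, ?_⟩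
  · rcases le_total y (-M) with hy | hy
    · linarith [outerHeight_le hA hM h hy, neg_abs_le (outerHeight A x y)]
    · linarith [abs_nonneg (outerHeight A x y)]
  · rcases le_total M y with hy | hy
    · linarith [le_outerHeight hA hM h hy, le_abs_self (outerHeight A x y)]
    · linarith [abs_nonneg (outerHeight A x y)]

theorem surjective_outerHeight (hA : IsClosed A) {M : ℝ} (hM : 0 ≤ M)
    (h : ∀ z, (x, z) ∈ A → |z| ≤ M) : Function.Surjective (outerHeight A x) := by
  intro c
  have htop := le_outerHeight hA hM h (y := M + |c|) (by linarith [abs_nonneg c])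
  have hbot := outerHeight_le hA hM h (y := -(M + |c|)) (by linarith [abs_nonneg c])
  refine mem_range_of_exists_le_of_exists_ge (lipschitzWith_outerHeight hA x).continuous
    ⟨-(M + |c|), ?_⟩ ⟨M + |c|, ?_⟩
  · linarith [neg_abs_le c]
  · linarith [le_abs_self c]

/-- The self-map of the plane that keeps the first coordinate and collapses each vertical segment
contained in `A` to a point, by replacing the second coordinate with the outer height. -/
noncomputable def verticalCollapse (A : Set (ℝ × ℝ)) (p : ℝ × ℝ) : ℝ × ℝ :=
  (p.1, outerHeight A p.1 p.2)

theorem surjective_verticalCollapse (hA : IsClosed A)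
    (hcpt : ∀ K : Set ℝ, IsCompact K → IsCompact (A ∩ Prod.fst ⁻¹' K)) :
    Function.Surjective (verticalCollapse A) := by
  rintro ⟨x, c⟩
  obtain ⟨M, hM, hbound⟩ := exists_abs_snd_le (hcpt {x} isCompact_singleton)
  obtain ⟨y, rfl⟩ := surjective_outerHeight hA hM (hbound x rfl) c
  exact ⟨(x, y), rfl⟩

theorem isProperMap_verticalCollapse (hA : IsClosed A)
    (hnull : ∀ x, {y | (x, y) ∈ frontier A}.Countable)
    (hcpt : ∀ K : Set ℝ, IsCompact K → IsCompact (A ∩ Prod.fst ⁻¹' K)) :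
    IsProperMap (verticalCollapse A) := by
  have hcont : Continuous (verticalCollapse A) :=
    continuous_fst.prodMk (continuous_outerHeight hA hnull)
  refine isProperMap_iff_isCompact_preimage.2 ⟨hcont, fun K hK => ?_⟩
  obtain ⟨R, hR⟩ := hK.isBounded.subset_closedBall 0
  obtain ⟨M, hM, hbound⟩ := exists_abs_snd_le (hcpt (Icc (-R) R) isCompact_Icc)
  refine (isCompact_closedBall (0 : ℝ × ℝ) (M + R)).of_isClosed_subset
    (hK.isClosed.preimage hcont) fun ⟨x, y⟩ hp => ?_
  have hnorm := mem_closedBall_zero_iff.1 (hR hp)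
  rw [Prod.norm_def, max_le_iff] at hnorm
  obtain ⟨hx, hheight⟩ : |x| ≤ R ∧ |outerHeight A x y| ≤ R := hnorm
  rw [mem_closedBall_zero_iff, Prod.norm_def, max_le_iff]
  refine ⟨show |x| ≤ M + R by linarith, show |y| ≤ M + R from ?_⟩
  linarith [abs_le_add_abs_outerHeight hA hM (hbound x (abs_le.1 hx)) y]

theorem verticalCollapse_eq_iff (hA : IsClosed A) {p q : ℝ × ℝ} :
    verticalCollapse A p = verticalCollapse A q ↔
      p.1 = q.1 ∧ (p.2 = q.2 ∨ FibreJoined A p.1 p.2 q.2) := by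
  obtain ⟨x, y⟩ := p
  obtain ⟨x', y'⟩ := q
  simp only [verticalCollapse, Prod.mk.injEq]
  constructor
  · rintro ⟨rfl, h⟩
    exact ⟨rfl, (outerHeight_eq_iff hA).1 h⟩
  · rintro ⟨rfl, h⟩
    exact ⟨rfl, (outerHeight_eq_iff hA).2 h⟩

end Height

/-- The shape that a domain of finite type takes in a global trivialisation of the vertical plane:
a closed surface in `ℝ × ℝ`, proper over the first coordinate, with finitely many topological
critical points on its frontier. -/
structure IsPlanarDomain (A : Set (ℝ × ℝ)) : Prop where
  isClosed : IsClosed A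
  isSurface : IsSurface A
  finite_topCriticalSet : (topCriticalSet Prod.fst (frontier A)).Finite
  isCompact_inter : ∀ K : Set ℝ, IsCompact K → IsCompact (A ∩ Prod.fst ⁻¹' K)

section Chart

variable {P : Type*} [TopologicalSpace P] {π : P → ℝ} {D : Set P} {Φ : P ≃ₜ ℝ × ℝ}

theorem IsDomainOfFiniteType.boundaryCurve_eq (hD : IsDomainOfFiniteType π D) (Φ : P ≃ₜ ℝ × ℝ) :
    boundaryCurve D = frontier D :=
  boundaryCurve_eq_frontier (Φ.trans Complex.equivRealProdCLM.toHomeomorph.symm) hD.isClosed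
    hD.isSurface

theorem IsDomainOfFiniteType.topCriticalSet_preimage (hD : IsDomainOfFiniteType π D)
    (hΦ : ∀ p, (Φ p).1 = π p) :
    topCriticalSet Prod.fst (frontier (Φ.symm ⁻¹' D)) =
      Φ.symm ⁻¹' topCriticalSet π (boundaryCurve D) := by
  rw [hD.boundaryCurve_eq Φ, ← Φ.symm.preimage_frontier]
  refine (preimage_topCriticalSet Φ.symm (fun z => ?_) _).symm
  rw [← hΦ, Φ.apply_symm_apply]

theorem IsDomainOfFiniteType.isCompact_inter (hD : IsDomainOfFiniteType π D) {K : Set ℝ}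
    (hK : IsCompact K) : IsCompact (D ∩ π ⁻¹' K) := by
  convert (hD.proper.isCompact_preimage hK).image continuous_subtype_val using 1
  ext p
  simp [and_comm]

theorem IsDomainOfFiniteType.isPlanarDomain (hD : IsDomainOfFiniteType π D)
    (hΦ : ∀ p, (Φ p).1 = π p) : IsPlanarDomain (Φ.symm ⁻¹' D) where
  isClosed := hD.isClosed.preimage Φ.symm.continuous
  isSurface := hD.isSurface.of_homeomorph (Φ.sets (by ext; simp))
  finite_topCriticalSet := by
    rw [hD.topCriticalSet_preimage hΦ]
    exact hD.finite_topCriticalSet.preimage Φ.symm.injective.injOn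
  isCompact_inter K hK := by
    convert (hD.isCompact_inter hK).image Φ.continuous using 1
    ext z
    rw [Φ.image_eq_preimage_symm]
    simp [← hΦ]

theorem mem_fiberComponent_iff (hΦ : ∀ p, (Φ p).1 = π p) {p q : P} (hp : p ∈ D) :
    q ∈ fiberComponent π D p ↔
      π p = π q ∧ FibreJoined (Φ.symm ⁻¹' D) (π p) (Φ p).2 (Φ q).2 := by
  have hsymm : ∀ w, Φ.symm (π w, (Φ w).2) = w := fun w => by
    rw [← hΦ]
    exact Φ.symm_apply_apply w
  have hpF : p ∈ π ⁻¹' {π p} ∩ D := ⟨rfl, hp⟩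
  constructor
  · intro hq
    have hsub := connectedComponentIn_subset (π ⁻¹' {π p} ∩ D) p
    refine ⟨(hsub hq).1.symm, fun z hz => ?_⟩
    have hpre : IsPreconnected ((fun w => (Φ w).2) '' fiberComponent π D p) :=
      isPreconnected_connectedComponentIn.image _ (by fun_prop : Continuous _).continuousOn
    obtain ⟨w, hw, rfl⟩ := hpre.ordConnected.uIcc_subset
      (mem_image_of_mem _ (mem_connectedComponentIn hpF)) (mem_image_of_mem _ hq) hz
    rw [mem_preimage, show π p = π w from (hsub hw).1.symm]
    simpa only [hsymm] using (hsub hw).2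
  · rintro ⟨hpq, hj⟩
    have hpre : IsPreconnected ((fun z => Φ.symm (π p, z)) '' uIcc (Φ p).2 (Φ q).2) :=
      isPreconnected_uIcc.image _ (by fun_prop : Continuous _).continuousOn
    refine hpre.subset_connectedComponentIn ⟨_, left_mem_uIcc, hsymm p⟩ ?_ ⟨_, right_mem_uIcc, ?_⟩
    · rintro _ ⟨z, hz, rfl⟩
      refine ⟨?_, hj z hz⟩
      change π (Φ.symm (π p, z)) = π p
      rw [← hΦ (Φ.symm _), Φ.apply_symm_apply]
    · rw [hpq]
      exact hsymm q

theorem vertEquiv_iff (hΦ : ∀ p, (Φ p).1 = π p) {p q : P} :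
    VertEquiv π D p q ↔ π p = π q ∧ ((Φ p).2 = (Φ q).2 ∨
      FibreJoined (Φ.symm ⁻¹' D) (π p) (Φ p).2 (Φ q).2) := by
  refine and_congr_right fun hpq => ?_
  have heq : (Φ p).2 = (Φ q).2 ↔ p = q := by
    refine ⟨fun h => Φ.injective (Prod.ext ?_ h), fun h => h ▸ rfl⟩
    rw [hΦ, hΦ, hpq]
  have hmem : (π p, (Φ p).2) ∈ Φ.symm ⁻¹' D ↔ p ∈ D := by rw [← hΦ]; simp
  by_cases hp : p ∈ D
  · rw [mem_fiberComponent_iff hΦ hp, heq]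
    constructor
    · rintro (hj | hne)
      exacts [Or.inr hj.2, absurd hp hne.2]
    · rintro (rfl | hj)
      exacts [Or.inl ⟨rfl, FibreJoined.refl (hmem.2 hp)⟩, Or.inl ⟨hpq, hj⟩]
  · have hnj : ¬FibreJoined (Φ.symm ⁻¹' D) (π p) (Φ p).2 (Φ q).2 := fun hj => hp (hmem.1 hj.left)
    have hnc : q ∉ fiberComponent π D p := fun hq =>
      hp (connectedComponentIn_nonempty_iff.1 ⟨q, hq⟩).2
    simp [hnj, hnc, heq, hp]

theorem IsDomainOfFiniteType.exists_collapse_homeomorph (hD : IsDomainOfFiniteType π D)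
    (hΦ : ∀ p, (Φ p).1 = π p) : ∃ h : Collapse π D ≃ₜ ℝ × ℝ,
      ∀ p, h (collapseMap π D p) = verticalCollapse (Φ.symm ⁻¹' D) (Φ p) := by
  set A := Φ.symm ⁻¹' D
  have hA : IsPlanarDomain A := hD.isPlanarDomain hΦ
  have hproper := isProperMap_verticalCollapse hA.isClosed
    (countable_frontier_fibre hA.finite_topCriticalSet) hA.isCompact_inter
  have hiff : ∀ p q, VertEquiv π D p q ↔
      verticalCollapse A (Φ p) = verticalCollapse A (Φ q) := fun p q => by
    rw [verticalCollapse_eq_iff hA.isClosed, vertEquiv_iff hΦ, hΦ, hΦ]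
  let k : Collapse π D → ℝ × ℝ :=
    Quotient.lift (fun p => verticalCollapse A (Φ p)) fun p q h => (hiff p q).1 h
  have hk : Continuous k := (hproper.continuous.comp Φ.continuous).quotient_lift _
  have hclosed : IsClosedMap k := by
    intro S hS
    have himage : k '' S = verticalCollapse A '' (Φ '' (collapseMap π D ⁻¹' S)) := by
      rw [← image_preimage_eq S (f := collapseMap π D) Quotient.mk_surjective,
        preimage_image_preimage, image_image, image_image]
      rfl
    rw [himage]
    exact hproper.isClosedMap _ (Φ.isClosedMap _ (hS.preimage continuous_quotient_mk'))
  have hbij : Function.Bijective k := by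
    refine ⟨fun u v => ?_, fun z => ?_⟩
    · induction u using Quotient.inductionOn with | _ p
      induction v using Quotient.inductionOn with | _ q
      exact fun h => Quotient.sound ((hiff p q).2 h)
    · obtain ⟨w, rfl⟩ := surjective_verticalCollapse hA.isClosed hA.isCompact_inter z
      exact ⟨collapseMap π D (Φ.symm w), by simp [k, collapseMap]⟩
  exact ⟨(isHomeomorph_iff_continuous_isClosedMap_bijective.2 ⟨hk, hclosed, hbij⟩).homeomorph k,
    fun p => rfl⟩

end Chart

/-! ### Valencies -/

theorem isVerticalPlane_of_homeomorph {Q : Type*} [TopologicalSpace Q] {f : Q → ℝ}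
    (h : Q ≃ₜ ℝ × ℝ) (hf : ∀ q, (h q).1 = f q) : IsVerticalPlane f where
  homeomorphic_plane := ⟨h⟩
  locally_trivial x := by
    have hfibre : ∀ y : ℝ, f (h.symm (x, y)) = x := fun y => by rw [← hf, h.apply_symm_apply]
    have : Continuous f := (continuous_fst.comp h.continuous).congr hf
    let F : (f ⁻¹' {x}) ≃ₜ ℝ :=
      { toFun := fun q => (h q.1).2
        invFun := fun y => ⟨h.symm (x, y), hfibre y⟩
        left_inv := fun q => Subtype.ext <| by
          rw [h.symm_apply_eq]
          exact Prod.ext ((hf q).trans q.2).symm rfl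
        right_inv := fun y => by simp
        continuous_toFun := by fun_prop
        continuous_invFun := by fun_prop }
    let H : Q ≃ₜ ℝ × (f ⁻¹' {x}) := h.trans ((Homeomorph.refl ℝ).prodCongr F.symm)
    refine ⟨{ H.toOpenPartialHomeomorph with
      baseSet := univ
      open_baseSet := isOpen_univ
      source_eq := rfl
      target_eq := by simp
      proj_toFun := fun q _ => hf q }, mem_univ x⟩

theorem IsVerticalPlane.continuous {P : Type*} [TopologicalSpace P] {π : P → ℝ}
    (hP : IsVerticalPlane π) : Continuous π := by
  obtain ⟨Φ, hΦ⟩ := hP.exists_homeomorph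
  exact (continuous_fst.comp Φ.continuous).congr hΦ

theorem IsVerticalPlane.t2Space {P : Type*} [TopologicalSpace P] {π : P → ℝ}
    (hP : IsVerticalPlane π) : T2Space P := by
  obtain ⟨h⟩ := hP.homeomorphic_plane
  exact h.symm.t2Space

section Turns

variable {A : Set (ℝ × ℝ)} {c d s ε ε' δ y y₁ y₂ : ℝ} {g : ℝ → ℝ}

theorem IsCap.mono (H : IsCap A c d s ε δ g) (hpos : 0 < ε') (hle : ε' ≤ ε) :
    IsCap A c d s ε' δ g where
  sign := H.sign
  width_pos := hpos
  height_pos := H.height_pos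
  continuousOn := H.continuousOn.mono (Ioo_subset_Ioo_right hle)
  mem u hu := H.mem u (Ioo_subset_Ioo_right hle hu)
  nonneg x y hx := H.nonneg x y (hx.trans_le hle)
  eq_of_mem := H.eq_of_mem
  fibreJoined x y hx := H.fibreJoined x y (hx.trans_le hle)

theorem IsCap.eq_of_fibreJoined (H : IsCap A c d s ε δ g) (hj : FibreJoined A c d y) : y = d := by
  rcases lt_trichotomy y d with hlt | rfl | hlt
  · obtain ⟨z, hz, hzd⟩ := exists_between (max_lt hlt (sub_lt_self d H.height_pos))
    obtain ⟨hyz, hδz⟩ := max_lt_iff.1 hz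
    exact absurd (H.eq_of_mem z (abs_lt.2 ⟨by linarith, by linarith [H.height_pos]⟩)
      (hj z (mem_uIcc.2 (Or.inr ⟨hyz.le, hzd.le⟩)))) hzd.ne
  · rfl
  · obtain ⟨z, hdz, hz⟩ := exists_between (lt_min hlt (lt_add_of_pos_right d H.height_pos))
    obtain ⟨hzy, hzδ⟩ := lt_min_iff.1 hz
    exact absurd (H.eq_of_mem z (abs_lt.2 ⟨by linarith [H.height_pos], by linarith⟩)
      (hj z (mem_uIcc.2 (Or.inl ⟨hdz.le, hzy.le⟩)))) hdz.ne'

theorem IsFork.mono (H : IsFork A c d s ε y₁ y₂) (hpos : 0 < ε') (hle : ε' ≤ ε) :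
    IsFork A c d s ε' y₁ y₂ where
  sign := H.sign
  width_pos := hpos
  lower_lt := H.lower_lt
  lt_upper := H.lt_upper
  fibreJoined := H.fibreJoined
  mem_lower x hx := H.mem_lower x (hx.trans_le hle)
  mem_upper x hx := H.mem_upper x (hx.trans_le hle)
  not_fibreJoined x hx := H.not_fibreJoined x (hx.trans_le hle)

theorem IsFork.mem_horizontal (H : IsFork A c d s ε y₁ y₂) {t : ℝ} (ht : t = 1 ∨ t = -1)
    (hy : y = y₁ ∨ y = y₂) : ∀ u ∈ Ioo 0 ε, (c + t * u, y) ∈ A := by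
  intro u hu
  have hlt : |c + t * u - c| < ε := by
    rw [add_sub_cancel_left, abs_sign_mul ht, abs_of_pos hu.1]
    exact hu.2
  rcases hy with rfl | rfl
  exacts [H.mem_lower _ hlt, H.mem_upper _ hlt]

theorem IsFork.fibreJoined_center (H : IsFork A c d s ε y₁ y₂) (hy : y = y₁ ∨ y = y₂) :
    FibreJoined A c y d := by
  have hd : d ∈ uIcc y₁ y₂ := mem_uIcc.2 (Or.inl ⟨H.lower_lt.le, H.lt_upper.le⟩)
  rcases hy with rfl | rfl
  exacts [H.fibreJoined.mono_right hd, H.fibreJoined.symm.mono_right (uIcc_comm y₁ y ▸ hd)]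

end Turns

/-- `r` is a continuous closed map on the plane whose fibres are the connected components of the
vertical fibres of `A` and the points outside `A`, and `f` is induced by the first projection.
This abstracts the collapsing map of a domain seen in a trivialisation of the vertical plane. -/
structure IsVerticalQuotient {Q : Type*} [TopologicalSpace Q] (A : Set (ℝ × ℝ)) (r : ℝ × ℝ → Q)
    (f : Q → ℝ) : Prop where
  continuous : Continuous r
  isClosedMap : IsClosedMap r
  proj : ∀ z, f (r z) = z.1
  eq_iff : ∀ z w, r z = r w ↔ z.1 = w.1 ∧ (z.2 = w.2 ∨ FibreJoined A z.1 z.2 w.2)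

theorem IsPlanarDomain.isCompact_fibre {A : Set (ℝ × ℝ)} (hA : IsPlanarDomain A) (c : ℝ) :
    IsCompact {y | (c, y) ∈ A} := by
  convert (hA.isCompact_inter _ (isCompact_singleton (x := c))).image continuous_snd using 1
  ext y
  simp

theorem IsPlanarDomain.topCriticalSet_subset {A : Set (ℝ × ℝ)} (hA : IsPlanarDomain A) :
    topCriticalSet Prod.fst (frontier A) ⊆ A :=
  fun _ hz => hA.isClosed.frontier_subset hz.1

namespace IsVerticalQuotient

variable {Q : Type*} [TopologicalSpace Q] {A S : Set (ℝ × ℝ)} {r : ℝ × ℝ → Q} {f : Q → ℝ}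
  {c d s t ε δ y y₁ y₂ : ℝ} {g : ℝ → ℝ}

theorem eq_of_fibreJoined (hr : IsVerticalQuotient A r f) {x y y' : ℝ} (h : FibreJoined A x y y') :
    r (x, y) = r (x, y') :=
  (hr.eq_iff _ _).2 ⟨rfl, Or.inr h⟩

theorem eq_iff_of_mem (hr : IsVerticalQuotient A r f) {x : ℝ} (hz : (c, d) ∈ A) :
    r (c, d) = r (x, y) ↔ c = x ∧ FibreJoined A c d y := by
  refine (hr.eq_iff _ _).trans (and_congr_right fun _ => or_iff_right_of_imp ?_)
  rintro (rfl : d = y)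
  exact .refl hz

theorem mem_image_iff (hr : IsVerticalQuotient A r f) (hS : S ⊆ A) {x : ℝ} :
    r (x, y) ∈ r '' S ↔ ∃ z, FibreJoined A x y z ∧ (x, z) ∈ S := by
  constructor
  · rintro ⟨⟨x', z⟩, hz, h⟩
    obtain ⟨rfl, hj⟩ := (hr.eq_iff_of_mem (hS hz)).1 h
    exact ⟨z, hj.symm, hz⟩
  · rintro ⟨z, hj, hz⟩
    exact ⟨_, hz, (hr.eq_of_fibreJoined hj).symm⟩

theorem exists_nhds_forall_mem (hr : IsVerticalQuotient A r f) {W : Set (ℝ × ℝ)} (hW : IsOpen W)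
    {v : Q} (hv : ∀ z, r z = v → z ∈ W) : ∃ U ∈ 𝓝 v, ∀ z, r z ∈ U → z ∈ W := by
  refine ⟨(r '' Wᶜ)ᶜ, (hr.isClosedMap _ hW.isClosed_compl).isOpen_compl.mem_nhds ?_, fun z hz => ?_⟩
  · rintro ⟨z, hz, h⟩
    exact hz (hv z h)
  · by_contra h
    exact hz ⟨z, h, rfl⟩

theorem isProperMap (hr : IsVerticalQuotient A r f) (hf : Continuous f) (hA : IsPlanarDomain A) :
    IsProperMap ((r '' A).domRestrict f) := by
  refine isProperMap_iff_isCompact_preimage.2 ⟨hf.comp continuous_subtype_val, fun K hK => ?_⟩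
  rw [Subtype.isCompact_iff]
  convert (hA.isCompact_inter K hK).image hr.continuous using 1
  ext v
  constructor
  · rintro ⟨⟨_, z, hz, rfl⟩, hv, rfl⟩
    exact ⟨z, ⟨hz, by simpa [hr.proj] using hv⟩, rfl⟩
  · rintro ⟨z, ⟨hz, hzK⟩, rfl⟩
    exact ⟨⟨r z, z, hz, rfl⟩, by simpa [hr.proj] using hzK, rfl⟩

theorem finite_fibre (hr : IsVerticalQuotient A r f) (hA : IsPlanarDomain A) (c : ℝ) :
    (r '' A ∩ f ⁻¹' {c}).Finite := by
  have hfibre : r '' A ∩ f ⁻¹' {c} = r '' (A ∩ Prod.fst ⁻¹' {c}) := by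
    rw [← image_inter_preimage, ← preimage_comp, (funext hr.proj : f ∘ r = Prod.fst)]
  rw [hfibre]
  refine (hA.isCompact_inter _ isCompact_singleton).induction_on (p := fun t => (r '' t).Finite)
    (by simp) (fun s t hst ht => ht.subset (image_mono hst))
    (fun s t hs ht => by rw [image_union]; exact hs.union ht) ?_
  rintro ⟨c, d⟩ ⟨hz, rfl⟩
  obtain ⟨δ, hδ, hjoined⟩ :=
    exists_fibreJoined_of_mem hA.isClosed hA.isSurface hA.finite_topCriticalSet hz
  refine ⟨{z | |z.2 - d| < δ} ∩ (A ∩ Prod.fst ⁻¹' {c}), ?_, ?_⟩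
  · refine Filter.inter_mem (mem_nhdsWithin_of_mem_nhds ?_) self_mem_nhdsWithin
    exact (isOpen_lt (by fun_prop : Continuous fun z : ℝ × ℝ => |z.2 - d|)
      continuous_const).mem_nhds (by simpa using hδ)
  · refine (finite_singleton (r (c, d))).subset ?_
    rintro _ ⟨⟨x, y⟩, ⟨hy, hyA, rfl⟩, rfl⟩
    exact (hr.eq_of_fibreJoined (hjoined y hy hyA)).symm

theorem hasLocalSections [T2Space Q] (hr : IsVerticalQuotient A r f) (hA : IsPlanarDomain A) :
    HasLocalSections f (r '' A \ r '' topCriticalSet Prod.fst (frontier A)) := by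
  rintro _ ⟨⟨⟨c, d⟩, hz, rfl⟩, hv⟩
  obtain ⟨a, b, hab, hd⟩ := exists_isFibreSegment (hA.isCompact_fibre c) hz
  obtain ⟨m, hm, ε, hε, W, hW, hcW, hmA, hjoined⟩ := hab.exists_band hA.isClosed hA.isSurface
    hA.finite_topCriticalSet fun z hzab hzS =>
      hv ((hr.mem_image_iff hA.topCriticalSet_subset).2 ⟨z, hab.fibreJoined hd hzab, hzS⟩)
  have hcont : Continuous fun x => r (x, m) := hr.continuous.comp (by fun_prop)
  have hcm : r (c, m) = r (c, d) := hr.eq_of_fibreJoined (hab.fibreJoined hm hd)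
  obtain ⟨η, hη, hηV⟩ := Metric.eventually_nhds_iff.1 <| hcont.continuousAt <|
    (hA.finite_topCriticalSet.image r).isClosed.isOpen_compl.mem_nhds
      (hcm ▸ hv : r (c, m) ∉ r '' topCriticalSet Prod.fst (frontier A))
  have habs {x} (hx : x ∈ Ioo (c - min ε η) (c + min ε η)) : |x - c| < ε ∧ |x - c| < η := by
    rw [← lt_min_iff, abs_lt]
    exact ⟨by linarith [hx.1], by linarith [hx.2]⟩
  obtain ⟨U, hU, hUW⟩ := hr.exists_nhds_forall_mem (v := r (c, d))
    (hW.inter (isOpen_Ioo.preimage continuous_fst :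
      IsOpen (Prod.fst ⁻¹' Ioo (c - min ε η) (c + min ε η)))) fun ⟨x, y⟩ hxy => by
      obtain ⟨rfl, hj⟩ := (hr.eq_iff_of_mem hz).1 hxy.symm
      exact ⟨hcW y (hab.mem_of_fibreJoined d hd y hj), by simpa using ⟨hε, hη⟩⟩
  rw [hr.proj]
  refine ⟨min ε η, lt_min hε hη, fun x => r (x, m), ⟨hcont.continuousOn, fun x hx => ?_,
    fun x _ => hr.proj _⟩, hcm, U, hU, ?_⟩
  · exact ⟨⟨_, hmA x (habs hx).1, rfl⟩, hηV (habs hx).2⟩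
  · rintro _ ⟨⟨⟨⟨x, y⟩, hxA, rfl⟩, -⟩, hxU⟩
    obtain ⟨hxW, hx⟩ := hUW _ hxU
    rw [hr.proj]
    exact ⟨hx, (hr.eq_of_fibreJoined (hjoined x y hxW hxA)).symm⟩

theorem isSectionalGraph [T2Space Q] (hr : IsVerticalQuotient A r f) (hf : Continuous f)
    (hA : IsPlanarDomain A) :
    IsSectionalGraph f (r '' A) (r '' topCriticalSet Prod.fst (frontier A)) where
  continuous := hf
  isClosed := hr.isClosedMap _ hA.isClosed
  proper := hr.isProperMap hf hA
  finite_fibre := hr.finite_fibre hA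
  hasLocalSections := hr.hasLocalSections hA

theorem exists_forall_notMem_image (hr : IsVerticalQuotient A r f) (hS : S.Finite) (c : ℝ) :
    ∃ η > 0, ∀ x y, |x - c| < η → x ≠ c → r (x, y) ∉ r '' S := by
  have hfin : (Prod.fst '' S \ {c}).Finite := (hS.image _).subset sdiff_subset
  obtain ⟨η, hη, hball⟩ := Metric.eventually_nhds_iff.1
    (hfin.isClosed.isOpen_compl.mem_nhds fun h => h.2 rfl : ∀ᶠ x in 𝓝 c, x ∉ Prod.fst '' S \ {c})
  refine ⟨η, hη, fun x y hx hxc => ?_⟩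
  rintro ⟨z, hz, hzr⟩
  refine hball hx ⟨⟨z, hz, ?_⟩, hxc⟩
  rw [← hr.proj z, hzr, hr.proj]

section Curve

variable (hε : ∀ x y, |x - c| < ε → x ≠ c → r (x, y) ∉ r '' S) (hs : s = 1 ∨ s = -1)
  (hgA : ∀ u ∈ Ioo 0 ε, (c + s * u, g u) ∈ A)

include hε hs hgA

omit [TopologicalSpace Q] in
theorem mapsTo_curve : MapsTo (fun u => r (c + s * u, g u)) (Ioo 0 ε) (r '' A \ r '' S) := by
  intro u hu
  refine ⟨mem_image_of_mem r (hgA u hu), hε _ _ ?_ fun h => ?_⟩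
  · rw [add_sub_cancel_left, abs_sign_mul hs, abs_of_pos hu.1]
    exact hu.2
  · rcases hs with rfl | rfl <;> linarith [hu.1]

theorem mapsTo_curve_connectedComponentIn (hr : IsVerticalQuotient A r f)
    (hg : ContinuousOn g (Ioo 0 ε)) {u : ℝ} (hu : u ∈ Ioo 0 ε) :
    MapsTo (fun u => r (c + s * u, g u)) (Ioo 0 ε)
      (connectedComponentIn (r '' A \ r '' S) (r (c + s * u, g u))) := by
  have hcont : ContinuousOn (fun u => r (c + s * u, g u)) (Ioo 0 ε) :=
    hr.continuous.comp_continuousOn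
      ((by fun_prop : Continuous fun u : ℝ => c + s * u).continuousOn.prodMk hg)
  exact mapsTo_iff_image_subset.2 <| (isPreconnected_Ioo.image _ hcont).subset_connectedComponentIn
    (mem_image_of_mem _ hu) (mapsTo_curve hε hs hgA).image_subset

end Curve

theorem exists_nhds_of_isCap (hr : IsVerticalQuotient A r f) (H : IsCap A c d s ε δ g) :
    ∃ U ∈ 𝓝 (r (c, d)), ∀ x y, r (x, y) ∈ U → |x - c| < ε ∧ |y - d| < δ := by
  obtain ⟨U, hU, hUW⟩ := hr.exists_nhds_forall_mem (v := r (c, d))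
    (W := {z | |z.1 - c| < ε} ∩ {z | |z.2 - d| < δ})
    ((isOpen_lt (by fun_prop) continuous_const).inter (isOpen_lt (by fun_prop) continuous_const))
    fun ⟨x, y⟩ hxy => by
      obtain ⟨rfl, hj⟩ : x = c ∧ (y = d ∨ FibreJoined A x y d) := (hr.eq_iff _ _).1 hxy
      obtain rfl : y = d := hj.elim id fun hj => H.eq_of_fibreJoined hj.symm
      simp [H.width_pos, H.height_pos]
  exact ⟨U, hU, fun x y => hUW (x, y)⟩

theorem eq_connectedComponentIn_of_isCap (hr : IsVerticalQuotient A r f)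
    (H : IsCap A c d s ε δ g) (hε : ∀ x y, |x - c| < ε → x ≠ c → r (x, y) ∉ r '' S)
    (hcd : (c, d) ∈ S) {e : Set Q} (he : e ∈ components (r '' A \ r '' S))
    (hcl : r (c, d) ∈ closure e) {u : ℝ} (hu : u ∈ Ioo 0 ε) :
    e = connectedComponentIn (r '' A \ r '' S) (r (c + s * u, g u)) := by
  obtain ⟨v, -, rfl⟩ := he
  obtain ⟨U, hU, hUbox⟩ := hr.exists_nhds_of_isCap H
  obtain ⟨w, hwU, hw⟩ := mem_closure_iff_nhds.1 hcl U hU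
  obtain ⟨⟨⟨x, y⟩, hxA, rfl⟩, hwS⟩ := connectedComponentIn_subset _ _ hw
  obtain ⟨hx, hy⟩ := hUbox x y hwU
  have hxc : x ≠ c := by
    rintro rfl
    obtain rfl := H.eq_of_mem y hy hxA
    exact hwS (mem_image_of_mem r hcd)
  have hpos : s * (x - c) ∈ Ioo 0 ε := by
    refine ⟨lt_of_le_of_ne (H.nonneg x y hx hy hxA) fun h => ?_, (le_abs_self _).trans_lt ?_⟩
    · rw [eq_comm, ← abs_eq_zero, abs_sign_mul H.sign, abs_eq_zero, sub_eq_zero] at h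
      exact hxc h
    · rwa [abs_sign_mul H.sign]
  have hparam : r (c + s * (s * (x - c)), g (s * (x - c))) = r (x, y) := by
    rw [← mul_assoc, sign_mul_self H.sign, one_mul, add_sub_cancel]
    exact (hr.eq_of_fibreJoined (H.fibreJoined x y hx hy hxA)).symm
  have hmem := mapsTo_curve_connectedComponentIn hε H.sign H.mem hr H.continuousOn hu hpos
  beta_reduce at hmem
  rw [hparam] at hmem
  rw [connectedComponentIn_eq hw, ← connectedComponentIn_eq hmem]

theorem valency_le_one_of_isCap (hr : IsVerticalQuotient A r f) (hS : S.Finite) (hcd : (c, d) ∈ S)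
    (H : IsCap A c d s ε δ g) : valency (components (r '' A \ r '' S)) (r (c, d)) ≤ 1 := by
  obtain ⟨η, hη, hηS⟩ := hr.exists_forall_notMem_image hS c
  have hκ : 0 < min ε η := lt_min H.width_pos hη
  have heq {e} (he : e ∈ components (r '' A \ r '' S)) (hcl : r (c, d) ∈ closure e) :=
    hr.eq_connectedComponentIn_of_isCap (H.mono hκ (min_le_left _ _))
      (fun x y hx => hηS x y (hx.trans_le (min_le_right _ _))) hcd he hcl
      ⟨half_pos hκ, half_lt_self hκ⟩
  exact encard_le_one_iff.2 fun e e' he he' => (heq he.1 he.2).trans (heq he'.1 he'.2).symm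

section Fork

variable [T2Space Q] (hr : IsVerticalQuotient A r f) (H : IsFork A c d s ε y₁ y₂)
  (hε : ∀ x y, |x - c| < ε → x ≠ c → r (x, y) ∉ r '' S)

include hr H hε

omit [TopologicalSpace Q] [T2Space Q] hr in
theorem mem_diff_of_isFork (ht : t = 1 ∨ t = -1) (hy : y = y₁ ∨ y = y₂) {u : ℝ}
    (hu : u ∈ Ioo 0 ε) : r (c + t * u, y) ∈ r '' A \ r '' S :=
  mapsTo_curve hε ht (H.mem_horizontal ht hy) hu

omit [T2Space Q] in
theorem mem_closure_connectedComponentIn_of_isFork (ht : t = 1 ∨ t = -1) (hy : y = y₁ ∨ y = y₂)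
    {u : ℝ} (hu : u ∈ Ioo 0 ε) :
    r (c, d) ∈ closure (connectedComponentIn (r '' A \ r '' S) (r (c + t * u, y))) := by
  have hcont : Continuous fun u : ℝ => r (c + t * u, y) := hr.continuous.comp (by fun_prop)
  have hmaps := mapsTo_curve_connectedComponentIn hε ht (H.mem_horizontal ht hy) hr
    continuousOn_const hu
  have hzero : r (c + t * 0, y) = r (c, d) := by
    rw [mul_zero, add_zero]
    exact hr.eq_of_fibreJoined (H.fibreJoined_center hy)
  rw [← hzero]
  exact hmaps.closure hcont (closure_Ioo H.width_pos.ne ▸ left_mem_Icc.2 H.width_pos.le)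

theorem connectedComponentIn_ne_of_isFork (hY : HasLocalSections f (r '' A \ r '' S)) {u : ℝ}
    (hu : u ∈ Ioo 0 ε) : connectedComponentIn (r '' A \ r '' S) (r (c + s * u, y₁)) ≠
      connectedComponentIn (r '' A \ r '' S) (r (c + s * u, y₂)) := by
  intro heq
  have hmem {y} (hy : y = y₁ ∨ y = y₂) := mem_diff_of_isFork H hε H.sign hy hu
  have hmem₁ := hmem (Or.inl rfl)
  have hsame := injOn_connectedComponentIn hY hmem₁ (mem_connectedComponentIn hmem₁)
    (heq ▸ mem_connectedComponentIn (hmem (Or.inr rfl))) (by rw [hr.proj, hr.proj])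
  rcases ((hr.eq_iff _ _).1 hsame).2 with hy | hj
  · exact (H.lower_lt.trans H.lt_upper).ne hy
  · refine H.not_fibreJoined _ ?_ ?_ hj
    · rw [add_sub_cancel_left, abs_sign_mul H.sign, abs_of_pos hu.1]
      exact hu.2
    · rw [add_sub_cancel_left, ← mul_assoc, sign_mul_self H.sign, one_mul]
      exact hu.1

theorem connectedComponentIn_ne_neg_of_isFork (hG : IsSectionalGraph f (r '' A) (r '' S))
    (hcd : (c, d) ∈ S) {y' : ℝ} (hy : y = y₁ ∨ y = y₂) (hy' : y' = y₁ ∨ y' = y₂) {u : ℝ}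
    (hu : u ∈ Ioo 0 ε) : connectedComponentIn (r '' A \ r '' S) (r (c + s * u, y)) ≠
      connectedComponentIn (r '' A \ r '' S) (r (c + -s * u, y')) := by
  intro heq
  have hneg : -s = 1 ∨ -s = -1 := by rcases H.sign with rfl | rfl <;> simp
  refine hG.notMem_uIcc_of_mem_closure
    (mem_connectedComponentIn (mem_diff_of_isFork H hε H.sign hy hu))
    (heq ▸ mem_connectedComponentIn (mem_diff_of_isFork H hε hneg hy' hu))
    (mem_closure_connectedComponentIn_of_isFork hr H hε H.sign hy hu) (mem_image_of_mem r hcd) ?_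
  simp only [hr.proj, mem_uIcc]
  rcases H.sign with rfl | rfl
  · exact Or.inr ⟨by linarith [hu.1], by linarith [hu.1]⟩
  · exact Or.inl ⟨by linarith [hu.1], by linarith [hu.1]⟩

end Fork

/- Two edges leave a fork on the side where it is cut, and at least one on the other side. -/
theorem three_le_valency_of_isFork [T2Space Q] (hr : IsVerticalQuotient A r f) (hS : S.Finite)
    (hG : IsSectionalGraph f (r '' A) (r '' S)) (hcd : (c, d) ∈ S) (H : IsFork A c d s ε y₁ y₂) :
    3 ≤ valency (components (r '' A \ r '' S)) (r (c, d)) := by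
  obtain ⟨η, hη, hηS⟩ := hr.exists_forall_notMem_image hS c
  have hκ : 0 < min ε η := lt_min H.width_pos hη
  have hu : min ε η / 2 ∈ Ioo 0 (min ε η) := ⟨half_pos hκ, half_lt_self hκ⟩
  replace H := H.mono hκ (min_le_left _ _)
  replace hηS x y (hx : |x - c| < min ε η) := hηS x y (hx.trans_le (min_le_right _ _))
  have hneg : -s = 1 ∨ -s = -1 := by rcases H.sign with rfl | rfl <;> simp
  have hedge {t y} (ht : t = 1 ∨ t = -1) (hy : y = y₁ ∨ y = y₂) :
      connectedComponentIn (r '' A \ r '' S) (r (c + t * (min ε η / 2), y)) ∈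
        {e | e ∈ components (r '' A \ r '' S) ∧ r (c, d) ∈ closure e} :=
    ⟨mem_image_of_mem _ (mem_diff_of_isFork H hηS ht hy hu),
      mem_closure_connectedComponentIn_of_isFork hr H hηS ht hy hu⟩
  have hne {y} (hy : y = y₁ ∨ y = y₂) :=
    connectedComponentIn_ne_neg_of_isFork hr H hηS hG hcd hy (Or.inl rfl : y₁ = y₁ ∨ y₁ = y₂) hu
  rw [← encard_eq_three.2 ⟨_, _, _, connectedComponentIn_ne_of_isFork hr H hηS
    hG.hasLocalSections hu, hne (Or.inl rfl), hne (Or.inr rfl), rfl⟩]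
  refine encard_mono ?_
  rintro e (rfl | rfl | rfl)
  exacts [hedge H.sign (Or.inl rfl), hedge H.sign (Or.inr rfl), hedge hneg (Or.inl rfl)]

theorem valency_ne_two [T2Space Q] (hr : IsVerticalQuotient A r f) (hf : Continuous f)
    (hA : IsPlanarDomain A) {v : Q} (hv : v ∈ r '' topCriticalSet Prod.fst (frontier A)) :
    valency (components (r '' A \ r '' topCriticalSet Prod.fst (frontier A))) v ≠ 2 := by
  obtain ⟨⟨c, d⟩, hz, rfl⟩ := hv
  obtain ⟨s, ε, δ, g, H⟩ | ⟨s, ε, y₁, y₂, H⟩ :=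
    exists_isCap_or_exists_isFork hA.isClosed hA.isSurface hA.finite_topCriticalSet hz
  · exact ((hr.valency_le_one_of_isCap hA.finite_topCriticalSet hz H).trans_lt (by decide)).ne
  · exact (lt_of_lt_of_le (by decide) (hr.three_le_valency_of_isFork hA.finite_topCriticalSet
      (hr.isSectionalGraph hf hA) hz H)).ne'

end IsVerticalQuotient

/-! ### The Poincaré–Reeb set -/

section ConnectedFibres

variable {P Q : Type*} [TopologicalSpace P] [TopologicalSpace Q] {ρ : P → Q} {Y : Set Q}

/- Over `Y` the map `ρ` restricts to a closed surjection, hence to a quotient map, whose fibres are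
still connected. -/
theorem isConnected_preimage_of_isClosedMap (hc : Continuous ρ) (hcl : IsClosedMap ρ)
    (hconn : ∀ q, IsConnected (ρ ⁻¹' {q})) (hY : IsConnected Y) : IsConnected (ρ ⁻¹' Y) := by
  have hsurj : Function.Surjective ρ := fun q => (hconn q).nonempty
  have : ConnectedSpace Y := isConnected_iff_connectedSpace.1 hY
  have hquot : IsQuotientMap (Y.restrictPreimage ρ) :=
    (hcl.restrictPreimage Y).isQuotientMap hc.restrictPreimage (hsurj.restrictPreimage Y)
  have hfibre (t : Y) : IsConnected (Y.restrictPreimage ρ ⁻¹' {t}) := by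
    have heq : Subtype.val '' (Y.restrictPreimage ρ ⁻¹' {t}) = ρ ⁻¹' {t.1} := by
      ext w
      constructor
      · rintro ⟨w, hw, rfl⟩
        exact congrArg Subtype.val hw
      · rintro (hw : ρ w = t.1)
        exact ⟨⟨w, by rw [mem_preimage, hw]; exact t.2⟩, Subtype.ext hw, rfl⟩
    exact ⟨image_nonempty.1 (heq ▸ (hconn t.1).1),
      IsInducing.subtypeVal.isPreconnected_image.1 (heq ▸ (hconn t.1).2)⟩
  have huniv := hquot.isCoinducing.isConnected_preimage_of_isClosed hfibre isClosed_univ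
    isConnected_univ
  have himage := huniv.image Subtype.val continuous_subtype_val.continuousOn
  rwa [preimage_univ, image_univ, Subtype.range_coe] at himage

theorem image_connectedComponentIn_preimage (hc : Continuous ρ) (hcl : IsClosedMap ρ)
    (hconn : ∀ q, IsConnected (ρ ⁻¹' {q})) {p : P} (hp : ρ p ∈ Y) :
    ρ '' connectedComponentIn (ρ ⁻¹' Y) p = connectedComponentIn Y (ρ p) := by
  refine Subset.antisymm ?_ ?_
  · exact (hc.continuousOn.mapsTo_connectedComponentIn hp).image_subset.trans
      (connectedComponentIn_mono _ (image_preimage_subset ρ Y))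
  · have hpre := isConnected_preimage_of_isClosedMap hc hcl hconn
      (isConnected_connectedComponentIn_iff.2 hp)
    have hsub := hpre.isPreconnected.subset_connectedComponentIn
      (mem_connectedComponentIn hp : ρ p ∈ connectedComponentIn Y (ρ p))
      (preimage_mono (connectedComponentIn_subset Y (ρ p)))
    rw [← image_preimage_eq (connectedComponentIn Y (ρ p)) fun q => (hconn q).nonempty]
    exact image_mono hsub

end ConnectedFibres

section Collapse

variable {P : Type*} [TopologicalSpace P] {π : P → ℝ} {D : Set P} {p q : P}

theorem collapseMap_eq_iff : collapseMap π D p = collapseMap π D q ↔ VertEquiv π D p q :=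
  Quotient.eq

theorem vertEquiv_iff_of_mem (hp : p ∈ D) : VertEquiv π D p q ↔ q ∈ fiberComponent π D p := by
  constructor
  · rintro ⟨-, h | h⟩
    exacts [h, absurd hp h.2]
  · exact fun h => ⟨(connectedComponentIn_subset _ _ h).1.symm, Or.inl h⟩

theorem vertEquiv_iff_of_notMem (hp : p ∉ D) : VertEquiv π D p q ↔ p = q := by
  constructor
  · rintro ⟨-, h | h⟩
    exacts [absurd (connectedComponentIn_nonempty_iff.1 ⟨q, h⟩).2 hp, h.1]
  · rintro rfl
    exact (vertEquiv_equivalence π D).refl _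

theorem isConnected_collapseMap_fibre (v : Collapse π D) :
    IsConnected (collapseMap π D ⁻¹' {v}) := by
  induction v using Quotient.inductionOn with | _ p
  have hfibre : collapseMap π D ⁻¹' {⟦p⟧} = {q | VertEquiv π D p q} :=
    Set.ext fun _ => eq_comm.trans collapseMap_eq_iff
  rw [hfibre]
  by_cases hp : p ∈ D
  · simp only [vertEquiv_iff_of_mem hp]
    exact isConnected_connectedComponentIn_iff.2 ⟨rfl, hp⟩
  · simp only [vertEquiv_iff_of_notMem hp, ofPred_eq_eq_singleton']
    exact isConnected_singleton

theorem topCriticalSet_boundaryCurve_subset : topCriticalSet π (boundaryCurve D) ⊆ D := by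
  rintro _ ⟨⟨q, -, rfl⟩, -⟩
  exact q.2

theorem collapseMap_mem_reebSet_iff : collapseMap π D p ∈ reebSet π D ↔ p ∈ D := by
  refine ⟨?_, mem_image_of_mem _⟩
  rintro ⟨q, hq, h⟩
  exact (connectedComponentIn_subset _ _ ((vertEquiv_iff_of_mem hq).1 (collapseMap_eq_iff.1 h))).2

theorem collapseMap_mem_reebVertices_iff :
    collapseMap π D p ∈ reebVertices π D ↔ p ∈ ⋃₀ criticalSegments π D := by
  constructor
  · rintro ⟨q, hq, h⟩
    have hqD := topCriticalSet_boundaryCurve_subset hq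
    have hqq : q ∈ fiberComponent π D q := mem_connectedComponentIn ⟨rfl, hqD⟩
    exact ⟨_, ⟨⟨q, hqD, rfl⟩, q, hqq, hq⟩,
      (vertEquiv_iff_of_mem hqD).1 (collapseMap_eq_iff.1 h)⟩
  · rintro ⟨_, ⟨⟨w, hw, rfl⟩, q, hqw, hq⟩, hp⟩
    refine ⟨q, hq, ?_⟩
    rw [← collapseMap_eq_iff.2 ((vertEquiv_iff_of_mem hw).2 hqw),
      collapseMap_eq_iff.2 ((vertEquiv_iff_of_mem hw).2 hp)]

theorem preimage_reebSet_diff_reebVertices :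
    collapseMap π D ⁻¹' (reebSet π D \ reebVertices π D) = D \ ⋃₀ criticalSegments π D :=
  Set.ext fun _ =>
    and_congr collapseMap_mem_reebSet_iff (not_congr collapseMap_mem_reebVertices_iff)

theorem reebEdges_eq (hcl : IsClosedMap (collapseMap π D)) :
    reebEdges π D = closure '' components (reebSet π D \ reebVertices π D) := by
  have hc : Continuous (collapseMap π D) := continuous_quotient_mk'
  have hband : ∀ p ∈ D \ ⋃₀ criticalSegments π D,
      collapseMap π D '' closure (connectedComponentIn (D \ ⋃₀ criticalSegments π D) p) =
      closure (connectedComponentIn (reebSet π D \ reebVertices π D) (collapseMap π D p)) := by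
    rw [← preimage_reebSet_diff_reebVertices]
    intro p hp
    rw [← hcl.closure_image_eq_of_continuous hc,
      image_connectedComponentIn_preimage hc hcl isConnected_collapseMap_fibre (mem_preimage.1 hp)]
  ext e
  constructor
  · rintro ⟨_, ⟨p, hp, rfl⟩, rfl⟩
    refine ⟨_, mem_image_of_mem _ ?_, (hband p hp).symm⟩
    rwa [← preimage_reebSet_diff_reebVertices] at hp
  · rintro ⟨_, ⟨v, hv, rfl⟩, rfl⟩
    obtain ⟨p, rfl⟩ : ∃ p, collapseMap π D p = v := Quotient.exists_rep v
    rw [← mem_preimage, preimage_reebSet_diff_reebVertices] at hv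
    exact ⟨_, ⟨p, hv, rfl⟩, hband p hv⟩

theorem IsTransversalGraph.closure_diff_vertices {V G : Set P} {E : Set (Set P)}
    (H : IsTransversalGraph π G V E) {e : Set P} (he : e ∈ E) : closure e \ V = e := by
  refine Subset.antisymm (fun w hw => ?_) fun w hw =>
    ⟨subset_closure hw, disjoint_left.1 (H.disjoint_vertices e he) hw⟩
  by_contra hwe
  exact hw.2 (H.ends_subset e he ⟨hw.1, hwe⟩)

theorem reebOpenEdges_eq (hcl : IsClosedMap (collapseMap π D))
    (H : IsTransversalGraph (collapseProj π D) (reebSet π D) (reebVertices π D)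
      (components (reebSet π D \ reebVertices π D))) :
    reebOpenEdges π D = components (reebSet π D \ reebVertices π D) := by
  rw [reebOpenEdges, reebEdges_eq hcl, image_image]
  exact (image_congr fun e he => H.closure_diff_vertices he).trans (image_id' _)

end Collapse

namespace IsDomainOfFiniteType

variable {P : Type*} [TopologicalSpace P] {π : P → ℝ} {D : Set P} {Φ : P ≃ₜ ℝ × ℝ}

theorem isVerticalPlane_collapseProj (hD : IsDomainOfFiniteType π D) (hΦ : ∀ p, (Φ p).1 = π p) :
    IsVerticalPlane (collapseProj π D) := by
  obtain ⟨h, hh⟩ := hD.exists_collapse_homeomorph hΦ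
  refine isVerticalPlane_of_homeomorph h fun v => ?_
  obtain ⟨p, rfl⟩ : ∃ p, collapseMap π D p = v := Quotient.exists_rep v
  rw [hh]
  exact hΦ p

theorem isClosedMap_collapseMap (hD : IsDomainOfFiniteType π D) (hΦ : ∀ p, (Φ p).1 = π p) :
    IsClosedMap (collapseMap π D) := by
  have hA := hD.isPlanarDomain hΦ
  have hproper := isProperMap_verticalCollapse hA.isClosed
    (countable_frontier_fibre hA.finite_topCriticalSet) hA.isCompact_inter
  obtain ⟨h, hh⟩ := hD.exists_collapse_homeomorph hΦ
  have hfactor : collapseMap π D = h.symm ∘ verticalCollapse (Φ.symm ⁻¹' D) ∘ Φ :=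
    funext fun p => (h.eq_symm_apply.2 (hh p))
  rw [hfactor]
  exact h.symm.isClosedMap.comp (hproper.isClosedMap.comp Φ.isClosedMap)

theorem isVerticalQuotient (hD : IsDomainOfFiniteType π D) (hΦ : ∀ p, (Φ p).1 = π p) :
    IsVerticalQuotient (Φ.symm ⁻¹' D) (collapseMap π D ∘ Φ.symm) (collapseProj π D) where
  continuous := continuous_quotient_mk'.comp Φ.symm.continuous
  isClosedMap := (hD.isClosedMap_collapseMap hΦ).comp Φ.symm.isClosedMap
  proj z := (hΦ _).symm.trans (by rw [Φ.apply_symm_apply])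
  eq_iff z w := by
    refine collapseMap_eq_iff.trans ((vertEquiv_iff hΦ).trans ?_)
    simp only [← hΦ, Φ.apply_symm_apply]

theorem image_eq_reebSet (D : Set P) (Φ : P ≃ₜ ℝ × ℝ) :
    (collapseMap π D ∘ Φ.symm) '' (Φ.symm ⁻¹' D) = reebSet π D := by
  rw [image_comp, image_preimage_eq _ Φ.symm.surjective, reebSet]

theorem image_topCriticalSet_eq_reebVertices (hD : IsDomainOfFiniteType π D)
    (hΦ : ∀ p, (Φ p).1 = π p) :
    (collapseMap π D ∘ Φ.symm) '' topCriticalSet Prod.fst (frontier (Φ.symm ⁻¹' D)) =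
      reebVertices π D := by
  rw [hD.topCriticalSet_preimage hΦ, image_comp, image_preimage_eq _ Φ.symm.surjective,
    reebVertices]

theorem isTransversalGraph_components (hD : IsDomainOfFiniteType π D)
    (hΦ : ∀ p, (Φ p).1 = π p) :
    IsTransversalGraph (collapseProj π D) (reebSet π D) (reebVertices π D)
      (components (reebSet π D \ reebVertices π D)) := by
  have hplane := hD.isVerticalPlane_collapseProj hΦ
  have := hplane.t2Space
  have H := (hD.isVerticalQuotient hΦ).isSectionalGraph hplane.continuous (hD.isPlanarDomain hΦ)
  rw [image_eq_reebSet, hD.image_topCriticalSet_eq_reebVertices hΦ] at H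
  exact H.isTransversalGraph (hD.finite_topCriticalSet.image _)
    (image_mono topCriticalSet_boundaryCurve_subset)

theorem valency_components_ne_two (hD : IsDomainOfFiniteType π D) (hΦ : ∀ p, (Φ p).1 = π p)
    {v : Collapse π D} (hv : v ∈ reebVertices π D) :
    valency (components (reebSet π D \ reebVertices π D)) v ≠ 2 := by
  have hplane := hD.isVerticalPlane_collapseProj hΦ
  have := hplane.t2Space
  have hr := hD.isVerticalQuotient hΦ
  rw [← image_eq_reebSet D Φ, ← hD.image_topCriticalSet_eq_reebVertices hΦ]
  rw [← hD.image_topCriticalSet_eq_reebVertices hΦ] at hv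
  exact hr.valency_ne_two hplane.continuous (hD.isPlanarDomain hΦ) hv

end IsDomainOfFiniteType

end PoincareReeb

theorem mainTheorem8 {P : Type*} [TopologicalSpace P] (π : P → ℝ) (D : Set P)
    (hP : IsVerticalPlane π) (hD : IsDomainOfFiniteType π D) :
    IsVerticalPlane (collapseProj π D) ∧
    (∀ e ∈ reebEdges π D, IsClosedSegment e) ∧
    IsTransversalGraph (collapseProj π D) (reebSet π D) (reebVertices π D) (reebOpenEdges π D) ∧
    closure '' reebOpenEdges π D = reebEdges π D ∧
    (∀ v ∈ reebVertices π D, valency (reebOpenEdges π D) v ≠ 2) := by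
  obtain ⟨Φ, hΦ⟩ := hP.exists_homeomorph
  have hclosed : IsClosedMap (collapseMap π D) := hD.isClosedMap_collapseMap hΦ
  have hgraph := hD.isTransversalGraph_components hΦ
  have hedges := reebEdges_eq hclosed
  rw [reebOpenEdges_eq hclosed hgraph]
  refine ⟨hD.isVerticalPlane_collapseProj hΦ, ?_, hgraph, hedges.symm,
    fun v hv => hD.valency_components_ne_two hΦ hv⟩
  rw [hedges]
  rintro _ ⟨e, he, rfl⟩
  exact hgraph.edge_segment e he
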